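/- Identify an integer partition $\alpha=(\alpha_1\ge\alpha_2\ge\cdots)$ (an infinite weakly decreasing sequence of nonnegative integers, finitely many of them nonzero) with its Ferrers board. A partition $\alpha$ \emph{contains} $\mu$ if some rows and columns of the board of $\alpha$ can be deleted so that, after top/left justifying the remaining boxes, one obtains the board of $\mu$; otherwise $\alpha$ \emph{avoids} $\mu$. Let $\mathrm{Av}_n(\mu)$ be the set of partitions of $n$ that avoid $\mu$. Let $\mu$ be a nonempty strict partition (its positive parts are distinct) that is not a staircase, i.e. not of the form $(m,m-1,\ldots,1)$ with $m\ge 1$. Then $\mu$ can be written as $$\mu=(k+1,k,k-1,\ldots,k-\ell+1,a_0,a_1,\ldots),\qquad k-\ell>a_0\ge 0,\ \ \ell\ge 0,$$ where $k,\ell$ are integers and $a_0,a_1,\ldots$ are all the remaining parts of $\mu$, continued by zeros; and for every such representation $$|\mathrm{Av}_n(\mu)|=\frac{n^{k-1}\log^{\ell} n}{\ell!\,(k-1)!\,\prod_{j=0}^{k-\ell-1}\left(k-\ell-a_j-j\right)}\left(1+O\!\left(\frac1{\log n}\right)\right)\qquad (n\to\infty),$$ where the implied constant may depend on $\mu$.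 -/

import Mathlib

open Filter Asymptotics

namespace PartitionPattern

/-- Top/left justification after deletion of the rows in `R` and the columns in `C`: a surviving
box moves up by the number of deleted rows above it and left by the number of deleted columns to
its left. -/
def justify (R C : Finset ℕ) (c : ℕ × ℕ) : ℕ × ℕ :=
  (c.1 - (R.filter (· < c.1)).card, c.2 - (C.filter (· < c.2)).card)

/-- `α` contains `μ`: some rows and columns of the Ferrers board of `α` can be deleted so that,
after top/left justifying the remaining boxes, one obtains the Ferrers board of `μ`. -/
def Contains (α μ : YoungDiagram) : Prop :=
  ∃ R C : Finset ℕ,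
    (α.cells.filter (fun c => c.1 ∉ R ∧ c.2 ∉ C)).image (justify R C) = μ.cells

/-- The set of partitions of weight `n` that avoid `μ`. -/
def Av (n : ℕ) (μ : YoungDiagram) : Set YoungDiagram :=
  {α | α.card = n ∧ ¬ Contains α μ}

/-- All positive parts are distinct. -/
def IsStrict (μ : YoungDiagram) : Prop :=
  ∀ i j, 0 < μ.rowLen i → μ.rowLen i = μ.rowLen j → i = j

/-- `μ = (m, m - 1, …, 1)` for some `m`; the empty partition is the case `m = 0`. -/
def IsStaircase (μ : YoungDiagram) : Prop :=
  ∃ m : ℕ, ∀ i, μ.rowLen i = m - i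

/-- `μ = (k + 1, k, …, k - ℓ + 1, a 0, a 1, …)` with `k - ℓ > a 0` (in particular `ℓ < k`). -/
structure HasForm (μ : YoungDiagram) (k ℓ : ℕ) (a : ℕ → ℕ) : Prop where
  head : ∀ i ≤ ℓ, μ.rowLen i = k + 1 - i
  tail : ∀ j, μ.rowLen (ℓ + 1 + j) = a j
  gap : a 0 + ℓ < k

/-- The main term `n^(k-1) log^ℓ n / (ℓ! (k-1)! ∏_{j=0}^{k-ℓ-1} (k - ℓ - a_j - j))`. -/
noncomputable def mainTerm (k ℓ : ℕ) (a : ℕ → ℕ) (n : ℕ) : ℝ :=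
  (n : ℝ) ^ (k - 1) * Real.log n ^ ℓ /
    ((ℓ.factorial : ℝ) * ((k - 1).factorial : ℝ) *
      ∏ j ∈ Finset.range (k - ℓ), ((k : ℝ) - ℓ - a j - j))

/-- There are finitely many partitions of `n`, so `Set.ncard (Av n μ)` is the true count. -/
theorem Av_finite (n : ℕ) (μ : YoungDiagram) : (Av n μ).Finite := by
  have key : ∀ (α : YoungDiagram) (i j : ℕ), (i, j) ∈ α → i < α.card ∧ j < α.card := by
    intro α i j h
    constructor
    · have : (Finset.range (i + 1)).card ≤ α.cells.card :=
        Finset.card_le_card_of_injOn (fun x => (x, j))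
          (fun x hx => by
            have hx' : x < i + 1 := by simpa using hx
            exact (YoungDiagram.mem_cells _).2 (α.up_left_mem (by omega) le_rfl h))
          (fun x _ y _ hxy => by simpa using hxy)
      simpa using this
    · have : (Finset.range (j + 1)).card ≤ α.cells.card :=
        Finset.card_le_card_of_injOn (fun x => (i, x))
          (fun x hx => by
            have hx' : x < j + 1 := by simpa using hx
            exact (YoungDiagram.mem_cells _).2 (α.up_left_mem le_rfl (by omega) h))
          (fun x _ y _ hxy => by simpa using hxy)
      simpa using this
  refine Set.Finite.of_finite_image (f := YoungDiagram.cells)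
    (Set.Finite.subset
      (Finset.finite_toSet (Finset.range n ×ˢ Finset.range n).powerset) ?_) ?_
  · rintro _ ⟨α, ⟨hα, -⟩, rfl⟩
    simp only [Finset.coe_powerset, Set.mem_preimage, Set.mem_powerset_iff]
    rintro ⟨i, j⟩ hij
    have := key α i j (by simpa using hij)
    simp only [Finset.coe_product, Finset.coe_range, Set.mem_prod, Set.mem_Iio]
    omega
  · intro α _ β _ h
    exact YoungDiagram.ext h

end PartitionPattern

/-! For strict `μ`, containment depends only on the set `D` of part sizes of `α`: `α` contains `μ`
iff `D` has elements `b 0 > b 1 > …`, ending at the level 0, whose successive gaps are at least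
those of `μ` (`contains_iff_exists_parts`). Hence `|Av_n(μ)|` is the sum of `numSol D n` over the
sets `D` without such a chain.

The top `ℓ` gaps of `μ` equal 1. Searching for a chain greedily from the bottom shows that a
chain-free set has at most `k` elements, with equality exactly when it is `D' ∪ C`, where `D'` is a
union of blocks of prescribed sizes with `κ = k - ℓ` elements (`Full`) and `C` is any set of `ℓ`
elements above `D'` (`card_filter_lt_of_not_hasChain`, `not_hasChain_of_full`). Smaller sets
contribute only `n^(k-3/2)` up to logarithms.

A fixed `k`-set containing two consecutive integers is the part set of about `n^(k-1) / ((k-1)! ∏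
d)` partitions of `n`. Summing the reciprocals over `C` gives `log^ℓ n / ℓ!`; summing over `D'`
gives a convergent series that telescopes to the reciprocal of the product in the main term
(`hasSum_invProd_full`, `prod_mainTerm_eq`).

The difficulty is uniformity in `D'` and `C`. The two largest elements of `D'` are consecutive (or
`D' = {1}`), which makes the error for a single set explicit and summable
(`abs_numSol_union_sub_le_of_endsInPair`). Sets `D'` with maximum beyond a power of `log n` are only
bounded from above, by counting the solutions that involve the consecutive pair
(`sum_numSol_pair_union_le`). `exists_abs_sum_sum_numSol_sub_le` combines the two ranges. -/

namespace PartitionPattern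

open Finset PowerSeries

/-! ### Counting partitions with a prescribed set of part sizes -/

/-- The generating series `∑_{m ≥ 1} X ^ (c * m)` of the multiples of a part `c`. -/
noncomputable def multSeries (c : ℕ) : PowerSeries ℕ :=
  PowerSeries.mk fun j => if c ∣ j ∧ j ≠ 0 then 1 else 0

/-- The number of partitions of `n` whose set of part sizes is exactly `D`. -/
noncomputable def numSol (D : Finset ℕ) (n : ℕ) : ℕ :=
  coeff n (∏ c ∈ D, multSeries c)

theorem coeff_multSeries (c j : ℕ) :
    coeff j (multSeries c) = if c ∣ j ∧ j ≠ 0 then 1 else 0 := by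
  simp [multSeries]

theorem coeff_multSeries_mul {c : ℕ} (hc : 1 ≤ c) (F : PowerSeries ℕ) (n : ℕ) :
    coeff n (multSeries c * F) = ∑ m ∈ Icc 1 (n / c), coeff (n - c * m) F := by
  rw [coeff_mul]
  simp_rw [coeff_multSeries, ite_mul, one_mul, zero_mul]
  rw [← Finset.sum_filter]
  symm
  refine Finset.sum_bij (fun m _ => (c * m, n - c * m)) ?_ ?_ ?_ ?_
  · intro m hm
    rw [Finset.mem_Icc] at hm
    have h1 : c * m ≤ n := by
      have := (Nat.le_div_iff_mul_le (by omega : 0 < c)).1 hm.2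
      linarith [mul_comm m c]
    simp only [mem_filter, HasAntidiagonal.mem_antidiagonal]
    refine ⟨by omega, Dvd.intro _ rfl, ?_⟩
    have : 0 < c * m := Nat.mul_pos (by omega) (by omega)
    omega
  · intro a _ b _ h
    simp only [Prod.mk.injEq] at h
    exact Nat.eq_of_mul_eq_mul_left (by omega) h.1
  · rintro ⟨i, j⟩ h
    simp only [mem_filter, HasAntidiagonal.mem_antidiagonal] at h
    obtain ⟨h1, ⟨m, rfl⟩, h3⟩ := h
    refine ⟨m, ?_, ?_⟩
    · rw [Finset.mem_Icc]
      constructor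
      · by_contra h
        have : m = 0 := by omega
        subst this
        simp at h3
      · rw [Nat.le_div_iff_mul_le (by omega : 0 < c)]
        linarith [mul_comm m c]
    · simp only [Prod.mk.injEq, true_and]
      omega
  · intro m hm
    rfl

theorem numSol_insert {c : ℕ} (hc : 1 ≤ c) {D : Finset ℕ} (hD : c ∉ D) (n : ℕ) :
    numSol (insert c D) n = ∑ m ∈ Icc 1 (n / c), numSol D (n - c * m) := by
  unfold numSol
  rw [Finset.prod_insert hD, coeff_multSeries_mul hc]

theorem numSol_zero {D : Finset ℕ} (hD : D.Nonempty) : numSol D 0 = 0 := by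
  obtain ⟨d, hd⟩ := hD
  unfold numSol
  rw [coeff_zero_eq_constantCoeff_apply, map_prod]
  apply Finset.prod_eq_zero hd
  rw [← coeff_zero_eq_constantCoeff_apply, coeff_multSeries]
  simp

/-- Stopping at `(n - 1) / c` keeps the remaining weight positive. The asymptotic estimates hold
only for positive arguments: `numSol {1}` is 1 there but 0 at 0. -/
theorem numSol_insert' {c : ℕ} (hc : 1 ≤ c) {D : Finset ℕ} (hD : c ∉ D) (hne : D.Nonempty)
    (n : ℕ) :
    numSol (insert c D) n = ∑ m ∈ Icc 1 ((n - 1) / c), numSol D (n - c * m) := by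
  rw [numSol_insert hc hD]
  symm
  apply Finset.sum_subset
  · apply Finset.Icc_subset_Icc le_rfl
    exact Nat.div_le_div_right (by omega)
  · intro m hm hm'
    rw [Finset.mem_Icc] at hm hm'
    have h2 : ¬ m ≤ (n - 1) / c := fun h => hm' ⟨hm.1, h⟩
    rw [Nat.le_div_iff_mul_le (by omega : 0 < c)] at h2
    have h3 : n - c * m = 0 := by
      rw [mul_comm]; omega
    rw [h3, numSol_zero hne]

theorem numSol_eq_card (D : Finset ℕ) (n : ℕ) :
    numSol D n = ((finsuppAntidiag D n).filter fun l => ∀ d ∈ D, d ∣ l d ∧ l d ≠ 0).card := by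
  unfold numSol
  rw [coeff_prod, Finset.card_filter]
  refine Finset.sum_congr rfl fun l _ => ?_
  simp_rw [coeff_multSeries]
  rw [Finset.prod_ite_zero]
  simp

end PartitionPattern

/-! ### Power sums and the asymptotics of `numSol` when parts are added -/

namespace PartitionPattern

open Finset PowerSeries

/-- Together with the next lemma this replaces the integral of `x ^ p` when sums over arithmetic
progressions are estimated. -/
theorem mul_sub_le_pow_sub_pow {x y : ℝ} (hy : 0 ≤ y) (hxy : y ≤ x) (p : ℕ) :
    (p + 1) * y ^ p * (x - y) ≤ x ^ (p + 1) - y ^ (p + 1) := by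
  induction p with
  | zero => simp
  | succ p ih =>
    have h1 : x ^ (p + 2) - y ^ (p + 2)
        = x * (x ^ (p + 1) - y ^ (p + 1)) + y ^ (p + 1) * (x - y) := by ring
    have h2 : 0 ≤ (p + 1) * y ^ p * (x - y) :=
      mul_nonneg (by positivity) (by linarith)
    have h3 : y * ((p + 1) * y ^ p * (x - y)) ≤ x * (x ^ (p + 1) - y ^ (p + 1)) :=
      mul_le_mul hxy ih h2 (by linarith)
    rw [show p + 1 + 1 = p + 2 from rfl, h1]
    push_cast
    calc ((p : ℝ) + 1 + 1) * y ^ (p + 1) * (x - y)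
        = y * ((p + 1) * y ^ p * (x - y)) + y ^ (p + 1) * (x - y) := by ring
      _ ≤ _ := by linarith

theorem pow_sub_pow_le_mul_sub {x y : ℝ} (hy : 0 ≤ y) (hxy : y ≤ x) (p : ℕ) :
    x ^ (p + 1) - y ^ (p + 1) ≤ (p + 1) * x ^ p * (x - y) := by
  induction p with
  | zero => simp
  | succ p ih =>
    have h1 : x ^ (p + 2) - y ^ (p + 2)
        = x * (x ^ (p + 1) - y ^ (p + 1)) + y ^ (p + 1) * (x - y) := by ring
    have h3 : x * (x ^ (p + 1) - y ^ (p + 1)) ≤ x * ((p + 1) * x ^ p * (x - y)) :=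
      mul_le_mul_of_nonneg_left ih (by linarith)
    have h4 : y ^ (p + 1) * (x - y) ≤ x ^ (p + 1) * (x - y) :=
      mul_le_mul_of_nonneg_right (pow_le_pow_left₀ hy hxy _) (by linarith)
    rw [show p + 1 + 1 = p + 2 from rfl, h1]
    push_cast
    calc _ ≤ x * ((p + 1) * x ^ p * (x - y)) + x ^ (p + 1) * (x - y) := by linarith
      _ = _ := by ring

theorem sum_Icc_pow_le (n c : ℝ) (hc : 0 ≤ c) (p K : ℕ) (hK : c * K ≤ n) :
    (p + 1) * c * ∑ m ∈ Icc 1 K, (n - c * m) ^ p ≤ n ^ (p + 1) - (n - c * K) ^ (p + 1) := by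
  induction K with
  | zero => simp
  | succ K ih =>
    push_cast at hK ⊢
    have hK' : c * K ≤ n := by nlinarith
    rw [Finset.sum_Icc_succ_top (by omega), mul_add]
    have := mul_sub_le_pow_sub_pow (x := n - c * K) (y := n - c * (K + 1)) (by linarith)
      (by nlinarith) p
    have h2 : n - c * K - (n - c * (K + 1)) = c := by ring
    rw [h2] at this
    push_cast
    linarith [ih hK', mul_right_comm ((p : ℝ) + 1) c ((n - c * (K + 1)) ^ p)]

theorem le_sum_range_pow (n c : ℝ) (hc : 0 ≤ c) (p K : ℕ) (hK : c * K ≤ n) :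
    n ^ (p + 1) - (n - c * K) ^ (p + 1) ≤ (p + 1) * c * ∑ m ∈ range K, (n - c * m) ^ p := by
  induction K with
  | zero => simp
  | succ K ih =>
    push_cast at hK ⊢
    have hK' : c * K ≤ n := by nlinarith
    rw [Finset.sum_range_succ, mul_add ((p + 1 : ℝ) * c)]
    have := pow_sub_pow_le_mul_sub (x := n - c * K) (y := n - c * (K + 1)) (by linarith)
      (by nlinarith) p
    have h2 : n - c * K - (n - c * (K + 1)) = c := by ring
    rw [h2] at this
    linarith [ih hK', mul_right_comm ((p : ℝ) + 1) c ((n - c * K) ^ p)]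

/-- The integral lies between the right and left Riemann sums with step `c`, which differ by the
term `n ^ p` at `m = 0`, up to the leftover piece treated in `hlast`. -/
theorem abs_sum_pow_sub_le {n c : ℕ} (hn : 1 ≤ n) (hc : 1 ≤ c) (p : ℕ) :
    |∑ m ∈ Icc 1 ((n - 1) / c), ((n - c * m : ℕ) : ℝ) ^ p - (n : ℝ) ^ (p + 1) / ((p + 1) * c)|
      ≤ (n : ℝ) ^ p := by
  set K := (n - 1) / c with hKdef
  have hK1 : c * K ≤ n - 1 := Nat.mul_div_le _ _
  have hK2 : n - 1 < c * (K + 1) := Nat.lt_mul_div_succ _ (by omega)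
  have hcK : (c : ℝ) * K ≤ n := by
    have : c * K ≤ n := by omega
    exact_mod_cast this
  have hcK2 : (n : ℝ) ≤ c * K + c := by
    have : n ≤ c * K + c := by
      have : c * (K + 1) = c * K + c := by ring
      omega
    exact_mod_cast this
  have hcast : ∑ m ∈ Icc 1 K, ((n - c * m : ℕ) : ℝ) ^ p
      = ∑ m ∈ Icc 1 K, ((n : ℝ) - c * m) ^ p := by
    refine Finset.sum_congr rfl fun m hm => ?_
    rw [Finset.mem_Icc] at hm
    have : c * m ≤ n := le_trans (Nat.mul_le_mul_left c hm.2) (by omega)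
    rw [Nat.cast_sub this]
    push_cast
    rfl
  rw [hcast]
  have hc0 : (0 : ℝ) < c := by exact_mod_cast hc
  have hup := sum_Icc_pow_le n c hc0.le p K hcK
  have hlo := le_sum_range_pow n c hc0.le p K hcK
  have hy0 : 0 ≤ (n : ℝ) - c * K := by linarith
  have hyp : 0 ≤ ((n : ℝ) - c * K) ^ (p + 1) := by positivity
  have hrange : ∑ m ∈ range K, ((n : ℝ) - c * m) ^ p + ((n : ℝ) - c * K) ^ p
      = (n : ℝ) ^ p + ∑ m ∈ Icc 1 K, ((n : ℝ) - c * m) ^ p := by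
    rw [← Finset.sum_range_succ (fun m : ℕ => ((n : ℝ) - c * m) ^ p), Finset.range_eq_Ico,
      Finset.sum_eq_sum_Ico_succ_bot (Nat.succ_pos _)]
    simp [Finset.Ico_add_one_right_eq_Icc]
  set Sg := ∑ m ∈ Icc 1 K, ((n : ℝ) - c * m) ^ p with hSg
  -- The last interval, from `c * K` to `n`, has length at most `c`, so its integral is covered by
  -- the extra term `m = K` of the left sum.
  have hlast : ((n : ℝ) - c * K) ^ (p + 1) ≤ (p + 1) * c * ((n : ℝ) - c * K) ^ p := by
    rw [pow_succ, mul_comm]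
    refine mul_le_mul_of_nonneg_right ?_ (by positivity)
    have : (c : ℝ) ≤ (p + 1) * c := by nlinarith [(Nat.cast_nonneg p : (0 : ℝ) ≤ p)]
    linarith
  have hq : (0 : ℝ) < (p + 1) * c := by positivity
  rw [abs_le]
  constructor
  · have : (n : ℝ) ^ (p + 1) / ((p + 1) * c) ≤ n ^ p + Sg := by
      rw [div_le_iff₀ hq, ← hrange]
      nlinarith
    linarith
  · have : Sg ≤ (n : ℝ) ^ (p + 1) / ((p + 1) * c) := by
      rw [le_div_iff₀ hq]
      nlinarith
    have : (0 : ℝ) ≤ (n : ℝ) ^ p := by positivity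
    linarith

/-- One convolution step: at most `n / c` terms each inherit the error `δ`, and the Riemann sum
costs `A * n ^ p`. -/
theorem abs_sum_sub_le {f : ℕ → ℝ} {A δ : ℝ} {p n c : ℕ} (hA : 0 ≤ A) (hc : 1 ≤ c)
    (hf : ∀ N, 1 ≤ N → N ≤ n → |f N - A * (N : ℝ) ^ p| ≤ δ) {N : ℕ} (h1 : 1 ≤ N) (hN : N ≤ n) :
    |∑ m ∈ Icc 1 ((N - 1) / c), f (N - c * m) - A * (N : ℝ) ^ (p + 1) / ((p + 1) * c)|
      ≤ n / c * δ + A * (n : ℝ) ^ p := by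
  have hδ : 0 ≤ δ := (abs_nonneg _).trans (hf N h1 hN)
  have hsplit : ∑ m ∈ Icc 1 ((N - 1) / c), f (N - c * m)
        - A * (N : ℝ) ^ (p + 1) / ((p + 1) * c)
      = ∑ m ∈ Icc 1 ((N - 1) / c), (f (N - c * m) - A * ((N - c * m : ℕ) : ℝ) ^ p)
        + A * (∑ m ∈ Icc 1 ((N - 1) / c), ((N - c * m : ℕ) : ℝ) ^ p
          - (N : ℝ) ^ (p + 1) / ((p + 1) * c)) := by
    rw [Finset.sum_sub_distrib, ← Finset.mul_sum]
    ring
  rw [hsplit]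
  refine (abs_add_le _ _).trans (add_le_add ?_ ?_)
  · refine (Finset.abs_sum_le_sum_abs _ _).trans ?_
    have : ∀ m ∈ Icc 1 ((N - 1) / c), |f (N - c * m) - A * ((N - c * m : ℕ) : ℝ) ^ p| ≤ δ := by
      intro m hm
      rw [Finset.mem_Icc] at hm
      have h2 : c * m ≤ N - 1 := (Nat.mul_le_mul_left c hm.2).trans (Nat.mul_div_le _ _)
      exact hf _ (by omega) (by omega)
    refine (Finset.sum_le_card_nsmul _ _ _ this).trans ?_
    rw [nsmul_eq_mul, Nat.card_Icc]
    refine mul_le_mul_of_nonneg_right ?_ hδ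
    simp only [Nat.add_sub_cancel]
    refine Nat.cast_div_le.trans ?_
    gcongr
    omega
  · rw [abs_mul, abs_of_nonneg hA]
    refine mul_le_mul_of_nonneg_left ((abs_sum_pow_sub_le h1 hc p).trans ?_) hA
    gcongr

/-- Induction on `C` by the convolution step. The bound is shaped so that the recursion closes: a
new part `c` multiplies the error by `n / c` and adds `c` to the sum inside the bracket. The only
loss is a factorial in a denominator. -/
theorem abs_numSol_union_sub_le {D : Finset ℕ} (hD : D.Nonempty) {a δ : ℝ} (ha : 0 ≤ a)
    {p n : ℕ} (hn : 1 ≤ n)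
    (hbase : ∀ N, 1 ≤ N → N ≤ n →
      |(numSol D N : ℝ) - a / (p.factorial : ℝ) * (N : ℝ) ^ p| ≤ δ)
    (C : Finset ℕ) (hC : ∀ c ∈ C, 1 ≤ c) (hdisj : Disjoint C D) :
    ∀ N, 1 ≤ N → N ≤ n →
      |(numSol (C ∪ D) N : ℝ)
          - a / (((p + C.card).factorial : ℝ) * ∏ c ∈ C, (c : ℝ)) * (N : ℝ) ^ (p + C.card)|
        ≤ (n : ℝ) ^ C.card / (∏ c ∈ C, (c : ℝ)) * (δ + a * (n : ℝ) ^ p * (∑ c ∈ C, (c : ℝ)) / n) := by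
  induction C using Finset.induction_on with
  | empty => simpa using hbase
  | insert c C hcC ih =>
    intro N h1 hN
    have hc1 : 1 ≤ c := hC c (Finset.mem_insert_self _ _)
    have hC' : ∀ c ∈ C, 1 ≤ c := fun x hx => hC x (Finset.mem_insert_of_mem hx)
    rw [Finset.disjoint_insert_left] at hdisj
    have ih' := ih hC' hdisj.2
    have hprod : (1 : ℝ) ≤ ∏ c ∈ C, (c : ℝ) := by
      rw [← Nat.cast_prod]
      exact_mod_cast Nat.succ_le_of_lt (Finset.prod_pos fun x hx => hC' x hx)
    have hnot : c ∉ C ∪ D := by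
      simp [hcC, hdisj.1]
    have hcp : (0 : ℝ) < c := by exact_mod_cast hc1
    have hnp : (0 : ℝ) < n := by exact_mod_cast hn
    have hfp : (1 : ℝ) ≤ ((p + C.card).factorial : ℝ) := by
      exact_mod_cast Nat.succ_le_of_lt (Nat.factorial_pos _)
    have key := abs_sum_sub_le (f := fun N => (numSol (C ∪ D) N : ℝ)) (c := c) (by positivity) hc1
      ih' h1 hN
    rw [Finset.insert_union, numSol_insert' hc1 hnot (hD.mono Finset.subset_union_right),
      Finset.card_insert_of_notMem hcC, Finset.prod_insert hcC, Finset.sum_insert hcC]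
    push_cast
    have e1 : a / (((p + C.card).factorial : ℝ) * ∏ c ∈ C, (c : ℝ)) * (N : ℝ) ^ (p + C.card + 1)
          / (((p + C.card : ℕ) + 1) * c)
        = a / (((p + (C.card + 1)).factorial : ℝ) * (c * ∏ c ∈ C, (c : ℝ)))
          * (N : ℝ) ^ (p + (C.card + 1)) := by
      rw [← add_assoc, Nat.factorial_succ]
      push_cast
      field_simp
    rw [e1] at key
    refine key.trans ?_
    have e2 : a / (((p + C.card).factorial : ℝ) * ∏ c ∈ C, (c : ℝ)) * (n : ℝ) ^ (p + C.card)
        ≤ a / (∏ c ∈ C, (c : ℝ)) * (n : ℝ) ^ (p + C.card) := by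
      gcongr
      nlinarith
    refine (add_le_add_right e2 _).trans (le_of_eq ?_)
    field_simp
    ring

end PartitionPattern

/-! ### Two consecutive part sizes -/

namespace PartitionPattern

open Finset PowerSeries

theorem numSol_singleton (e N : ℕ) : numSol {e} N = if e ∣ N ∧ N ≠ 0 then 1 else 0 := by
  simp [numSol, coeff_multSeries]

/-- With `m` copies of `e + 1`, the remainder is a multiple of `e` iff `m ≡ N` modulo `e`, because
`e + 1 ≡ 1`. -/
theorem numSol_pair {e : ℕ} (he : 1 ≤ e) (N : ℕ) :
    numSol {e, e + 1} N
      = ((Icc 1 ((N - 1) / (e + 1))).filter fun m => m ≡ N [MOD e]).card := by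
  rw [Finset.pair_comm, numSol_insert' (by omega) (by simp) (by simp), Finset.card_filter]
  refine Finset.sum_congr rfl fun m hm => ?_
  rw [Finset.mem_Icc] at hm
  have h2 : (e + 1) * m ≤ N - 1 := (Nat.mul_le_mul_left _ hm.2).trans (Nat.mul_div_le _ _)
  have h3 : 1 ≤ (e + 1) * m := Nat.succ_le_of_lt (Nat.mul_pos (by omega) (by omega))
  rw [numSol_singleton]
  have h4 : (e + 1) * m ≡ m [MOD e] := by
    have : (e + 1) * m = m + e * m := by ring
    rw [this]
    exact Nat.ModEq.symm (by simp [Nat.ModEq])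
  refine if_congr ?_ rfl rfl
  rw [← Nat.modEq_iff_dvd' (by omega)]
  constructor
  · rintro ⟨h, -⟩
    exact h4.symm.trans h
  · intro h
    exact ⟨h4.trans h, by omega⟩

/-- A residue class modulo `e` is counted in an interval of length about `N / (e + 1)`. The error is
bounded independently of `e`, which gives all later uniformity. -/
theorem abs_numSol_pair_sub_le {e : ℕ} (he : 1 ≤ e) {N : ℕ} (hN : 1 ≤ N) :
    |(numSol {e, e + 1} N : ℝ) - (N : ℝ) / (e * (e + 1))| ≤ 2 := by
  set K := (N - 1) / (e + 1) with hK
  have hcard := Nat.Ioc_filter_modEq_card 0 K (r := e) (by omega) N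
  have hIcc : Icc 1 K = Ioc 0 K := by ext; simp; omega
  rw [numSol_pair he, ← hK, hIcc]
  have he0 : (0 : ℝ) < e := by exact_mod_cast he
  have hK1 : (e + 1) * K ≤ N - 1 := Nat.mul_div_le _ _
  have hK2 : N - 1 < (e + 1) * (K + 1) := Nat.lt_mul_div_succ _ (by omega)
  have hb1 : ((e : ℝ) + 1) * K ≤ N := by
    have : (e + 1) * K ≤ N := by omega
    exact_mod_cast this
  have hb2 : (N : ℝ) ≤ (e + 1) * (K + 1) := by
    have : N ≤ (e + 1) * (K + 1) := by omega
    exact_mod_cast this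
  have hc1 : (K : ℝ) / e ≤ N / (e * (e + 1)) := by
    rw [div_le_div_iff₀ he0 (by positivity)]
    nlinarith
  have hc2 : (N : ℝ) / (e * (e + 1)) ≤ K / e + 1 := by
    rw [div_add_one he0.ne', div_le_div_iff₀ (by positivity) he0]
    have : (1 : ℝ) ≤ e := by exact_mod_cast he
    have hK0 : (0 : ℝ) ≤ K := Nat.cast_nonneg _
    have : (e + 1) * ((K : ℝ) + 1) ≤ (K + e) * (e + 1) := by nlinarith
    nlinarith
  set c := (filter (fun m => m ≡ N [MOD e]) (Ioc 0 K)).card with hc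
  set x : ℚ := ((K : ℕ) - (N : ℕ) : ℚ) / (e : ℚ) with hx
  set y : ℚ := (((0 : ℕ) : ℚ) - (N : ℕ) : ℚ) / (e : ℚ) with hy
  have hxy : (x : ℚ) - y = K / e := by
    rw [hx, hy]; push_cast; ring
  have heq : (0 : ℚ) < e := by exact_mod_cast he
  have hfx1 := Int.floor_le x
  have hfx2 := Int.lt_floor_add_one x
  have hfy1 := Int.floor_le y
  have hfy2 := Int.lt_floor_add_one y
  have hmono : ⌊y⌋ ≤ ⌊x⌋ := by
    apply Int.floor_le_floor
    have : (0 : ℚ) ≤ K / e := by positivity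
    linarith
  rw [max_eq_left (by linarith)] at hcard
  have hcq : (c : ℚ) = ⌊x⌋ - ⌊y⌋ := by
    have : ((c : ℤ) : ℚ) = ((⌊x⌋ - ⌊y⌋ : ℤ) : ℚ) := by rw [hcard]
    push_cast at this
    exact this
  have d1 : (c : ℚ) ≤ K / e + 1 := by rw [hcq]; linarith
  have d2 : (K : ℚ) / e - 1 ≤ c := by rw [hcq]; linarith
  have d1' : (c : ℝ) ≤ K / e + 1 := by
    have := (Rat.cast_le (K := ℝ)).2 d1
    push_cast at this
    exact this
  have d2' : (K : ℝ) / e - 1 ≤ c := by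
    have := (Rat.cast_le (K := ℝ)).2 d2
    push_cast at this
    exact this
  rw [abs_le]
  constructor <;> linarith

/-- Map a solution to its total number of parts `s = (N - m) / e`. Then `N = e * s + m` with `m <
s`, so `e` is the quotient of `N` by `s`. -/
theorem numSol_pair_le_card {e : ℕ} (he : 1 ≤ e) (N : ℕ) :
    numSol {e, e + 1} N ≤ ((Icc 1 N).filter fun s => N / s = e).card := by
  rw [numSol_pair he]
  have key : ∀ m ∈ (Icc 1 ((N - 1) / (e + 1))).filter (fun m => m ≡ N [MOD e]),
      e * ((N - m) / e) + m = N ∧ m < (N - m) / e := by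
    intro m hm
    rw [mem_filter, Finset.mem_Icc] at hm
    have h2 : (e + 1) * m ≤ N - 1 := (Nat.mul_le_mul_left _ hm.1.2).trans (Nat.mul_div_le _ _)
    have h3 : 1 ≤ (e + 1) * m := Nat.succ_le_of_lt (Nat.mul_pos (by omega) (by omega))
    have h4 : (e + 1) * m = e * m + m := by ring
    have h5 : e ∣ N - m := (Nat.modEq_iff_dvd' (by omega)).1 hm.2
    have h6 : e * ((N - m) / e) = N - m := Nat.mul_div_cancel' h5
    refine ⟨by omega, ?_⟩
    have : e * m < e * ((N - m) / e) := by omega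
    exact Nat.lt_of_mul_lt_mul_left this
  refine Finset.card_le_card_of_injOn (fun m => (N - m) / e) ?_ ?_
  · intro m hm
    obtain ⟨h1, h2⟩ := key m hm
    simp only [coe_filter, Set.mem_ofPred_eq, Finset.mem_Icc]
    set s := (N - m) / e
    have hsN : s ≤ N := by nlinarith
    refine ⟨⟨by omega, hsN⟩, ?_⟩
    exact Nat.div_eq_of_lt_le (by omega) (by rw [Nat.add_mul, one_mul]; omega)
  · intro m hm m' hm' h
    obtain ⟨h1, -⟩ := key m hm
    obtain ⟨h1', -⟩ := key m' hm'
    simp only at h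
    rw [← h] at h1'
    omega

end PartitionPattern

/-! ### Upper bounds for sums of `numSol` over families of sets -/

namespace PartitionPattern

open Finset PowerSeries

/-- The elementary symmetric sum of degree `j` in the values `f x`, `x ∈ s`. -/
def elemSum {R : Type*} [CommSemiring R] (s : Finset ℕ) (j : ℕ) (f : ℕ → R) : R :=
  ∑ T ∈ s.powersetCard j, ∏ x ∈ T, f x

theorem sum_powersetCard_succ_insert {R : Type*} [AddCommMonoid R] {s : Finset ℕ} {x : ℕ}
    (hx : x ∉ s) (j : ℕ) (F : Finset ℕ → R) :
    ∑ T ∈ (insert x s).powersetCard (j + 1), F T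
      = ∑ T ∈ s.powersetCard (j + 1), F T + ∑ T ∈ s.powersetCard j, F (insert x T) := by
  have hnot : ∀ (i : ℕ), ∀ T ∈ s.powersetCard i, x ∉ T := fun i T hT h =>
    hx ((mem_powersetCard.1 hT).1 h)
  rw [powersetCard_succ_insert hx, Finset.sum_union, Finset.sum_image]
  · intro T hT T' hT' h
    have h1 := hnot j T hT
    have h2 := hnot j T' hT'
    rw [← erase_insert h1, h, erase_insert h2]
  · rw [Finset.disjoint_left]
    intro T hT hT'
    obtain ⟨U, _, rfl⟩ := mem_image.1 hT'
    exact hnot _ _ hT (mem_insert_self _ _)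

theorem elemSum_zero {R : Type*} [CommSemiring R] (s : Finset ℕ) (f : ℕ → R) :
    elemSum s 0 f = 1 := by simp [elemSum]

theorem elemSum_succ_insert {R : Type*} [CommSemiring R] {s : Finset ℕ} {x : ℕ} (hx : x ∉ s)
    (j : ℕ) (f : ℕ → R) :
    elemSum (insert x s) (j + 1) f = elemSum s (j + 1) f + f x * elemSum s j f := by
  unfold elemSum
  rw [sum_powersetCard_succ_insert hx, Finset.mul_sum]
  congr 1
  refine Finset.sum_congr rfl fun T hT => ?_
  rw [Finset.prod_insert fun h => hx ((mem_powersetCard.1 hT).1 h)]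

theorem elemSum_nonneg {s : Finset ℕ} {f : ℕ → ℝ} (hf : ∀ x ∈ s, 0 ≤ f x) (j : ℕ) :
    0 ≤ elemSum s j f :=
  Finset.sum_nonneg fun _ hT => Finset.prod_nonneg fun x hx =>
    hf x ((mem_powersetCard.1 hT).1 hx)

theorem elemSum_succ_empty {R : Type*} [CommSemiring R] (j : ℕ) (f : ℕ → R) :
    elemSum ∅ (j + 1) f = 0 := by
  rw [elemSum, powersetCard_eq_empty.2 (by simp), Finset.sum_empty]

/-- The expansion of the power contains every squarefree monomial. The remainder is given as a
witness `Y` because the intended semiring, power series over `ℕ`, has no subtraction; its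
coefficients are automatically nonnegative. -/
theorem exists_sum_pow_eq_elemSum_add {R : Type*} [CommSemiring R] (s : Finset ℕ) (f : ℕ → R) :
    ∀ j : ℕ, ∃ Y, (∑ x ∈ s, f x) ^ j = elemSum s j f + Y := by
  have hpow : ∀ (a p : R) (j : ℕ), ∃ Z, (a + p) ^ j = p ^ j + Z := by
    intro a p j
    induction j with
    | zero => exact ⟨0, by simp⟩
    | succ j ih =>
      obtain ⟨Z, hZ⟩ := ih
      exact ⟨a * (p ^ j + Z) + p * Z, by rw [pow_succ, hZ]; ring⟩
  induction s using Finset.induction_on with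
  | empty =>
    rintro (_ | j)
    · exact ⟨0, by simp [elemSum_zero]⟩
    · exact ⟨0, by simp [elemSum_succ_empty]⟩
  | insert x s hx ih =>
    rintro (_ | j)
    · exact ⟨0, by simp [elemSum_zero]⟩
    · obtain ⟨Y, hY⟩ := ih j
      obtain ⟨Y', hY'⟩ := ih (j + 1)
      obtain ⟨Z, hZ⟩ := hpow (f x) (∑ x ∈ s, f x) j
      rw [pow_succ] at hY'
      refine ⟨Y' + f x * Y + (f x + ∑ x ∈ s, f x) * Z, ?_⟩
      rw [Finset.sum_insert hx, pow_succ, hZ, elemSum_succ_insert hx]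
      calc _ = (∑ x ∈ s, f x) ^ j * (∑ x ∈ s, f x) + f x * (∑ x ∈ s, f x) ^ j
            + (f x + ∑ x ∈ s, f x) * Z := by ring
        _ = _ := by rw [hY', hY]; ring

theorem coeff_mul_elemSum_le (s : Finset ℕ) (f : ℕ → PowerSeries ℕ) (F : PowerSeries ℕ)
    (j n : ℕ) :
    coeff n (F * elemSum s j f) ≤ coeff n (F * (∑ x ∈ s, f x) ^ j) := by
  obtain ⟨Y, hY⟩ := exists_sum_pow_eq_elemSum_add s f j
  rw [hY, mul_add, map_add]
  exact Nat.le_add_right _ _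

/-- The partial sums of the coefficients of a power series. -/
noncomputable def coeffSum (n : ℕ) (F : PowerSeries ℕ) : ℕ := ∑ j ∈ range (n + 1), coeff j F

theorem coeffSum_mul_le (n : ℕ) (F G : PowerSeries ℕ) :
    coeffSum n (F * G) ≤ coeffSum n F * coeffSum n G := by
  unfold coeffSum
  rw [Finset.sum_mul_sum, ← Finset.sum_product']
  set U := range (n + 1) ×ˢ range (n + 1)
  rw [← Finset.sum_filter_add_sum_filter_not U (fun x => x.1 + x.2 ≤ n)]
  refine le_trans (le_of_eq ?_) (Nat.le_add_right _ _)
  rw [← Finset.sum_fiberwise_of_maps_to (s := U.filter fun x => x.1 + x.2 ≤ n)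
    (t := range (n + 1)) (g := fun x => x.1 + x.2)]
  · refine Finset.sum_congr rfl fun j hj => ?_
    rw [coeff_mul]
    refine Finset.sum_congr ?_ fun _ _ => rfl
    ext ⟨a, b⟩
    simp only [U, HasAntidiagonal.mem_antidiagonal, mem_filter, mem_product, mem_range] at hj ⊢
    omega
  · intro x hx
    simp only [mem_filter, mem_range] at hx ⊢
    omega

theorem coeffSum_pow_le (n : ℕ) (F : PowerSeries ℕ) (j : ℕ) :
    coeffSum n (F ^ j) ≤ coeffSum n F ^ j := by
  induction j with
  | zero =>
    simp [coeffSum, coeff_one]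
  | succ j ih =>
    rw [pow_succ, pow_succ]
    exact (coeffSum_mul_le _ _ _).trans (Nat.mul_le_mul_right _ ih)

theorem coeffSum_multSeries (n c : ℕ) : coeffSum n (multSeries c) = n / c := by
  rw [← Nat.card_multiples' n c, Finset.card_filter]
  refine Finset.sum_congr rfl fun j _ => ?_
  rw [coeff_multSeries]
  exact if_congr and_comm rfl rfl

theorem coeffSum_sum_multSeries_le (n : ℕ) :
    (coeffSum n (∑ c ∈ Icc 1 n, multSeries c) : ℝ) ≤ n * (1 + Real.log n) := by
  have h1 : coeffSum n (∑ c ∈ Icc 1 n, multSeries c) = ∑ c ∈ Icc 1 n, n / c := by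
    simp_rw [← coeffSum_multSeries, coeffSum, map_sum]
    exact Finset.sum_comm
  rw [h1]
  push_cast
  have h2 : ∑ c ∈ Icc 1 n, ((n / c : ℕ) : ℝ) ≤ ∑ c ∈ Icc 1 n, (n : ℝ) * (c : ℝ)⁻¹ := by
    refine Finset.sum_le_sum fun c _ => ?_
    rw [← div_eq_mul_inv]
    exact Nat.cast_div_le
  refine h2.trans ?_
  rw [← Finset.mul_sum]
  refine mul_le_mul_of_nonneg_left ?_ (Nat.cast_nonneg n)
  have := harmonic_le_one_add_log n
  rw [harmonic_eq_sum_Icc] at this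
  push_cast at this
  exact this

theorem card_divisors_le_two_mul_sqrt (n : ℕ) : n.divisors.card ≤ 2 * n.sqrt := by
  rcases Nat.eq_zero_or_pos n with rfl | hn
  · simp
  have hsub : n.divisors ⊆ Icc 1 n.sqrt ∪ (Icc 1 n.sqrt).image (fun d => n / d) := by
    intro d hd
    obtain ⟨⟨e, rfl⟩, h0⟩ := Nat.mem_divisors.1 hd
    have hd0 : 0 < d := Nat.pos_of_ne_zero fun h => h0 (by simp [h])
    have he0 : 0 < e := Nat.pos_of_ne_zero fun h => h0 (by simp [h])
    rw [mem_union, mem_image, Finset.mem_Icc]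
    rcases le_total d e with h | h
    · left
      exact ⟨hd0, Nat.le_sqrt.2 (Nat.mul_le_mul_left d h)⟩
    · right
      refine ⟨e, ?_, Nat.mul_div_cancel _ he0⟩
      rw [Finset.mem_Icc]
      exact ⟨he0, Nat.le_sqrt.2 (Nat.mul_le_mul_right e h)⟩
  refine (card_le_card hsub).trans ((card_union_le _ _).trans ?_)
  have := card_image_le (s := Icc 1 n.sqrt) (f := fun d => n / d)
  simp only [Nat.card_Icc, Nat.add_sub_cancel] at this ⊢
  omega

theorem coeff_sum_multSeries_le (n i : ℕ) (hi : i ≤ n) :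
    coeff i (∑ c ∈ Icc 1 n, multSeries c) ≤ 2 * n.sqrt := by
  rw [map_sum]
  simp_rw [coeff_multSeries]
  rw [← Finset.card_filter]
  refine le_trans ?_ ((card_divisors_le_two_mul_sqrt i).trans
    (Nat.mul_le_mul_left 2 (Nat.sqrt_le_sqrt hi)))
  refine card_le_card fun c hc => ?_
  rw [mem_filter] at hc
  exact Nat.mem_divisors.2 hc.2

/-- The sum is at most the coefficient of an `(s + 1)`-st power. One factor is bounded
coefficientwise by a divisor count and the other `s` by partial sums, so half a power of `n` is
saved over the trivial order `n ^ (s + 1)`, up to logarithms. -/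
theorem sum_numSol_powersetCard_le (n s : ℕ) :
    (∑ D ∈ (Icc 1 n).powersetCard (s + 1), numSol D n : ℕ)
      ≤ coeffSum n (∑ c ∈ Icc 1 n, multSeries c) ^ s * (2 * n.sqrt) := by
  set T := ∑ c ∈ Icc 1 n, multSeries c with hT
  have h1 : ∑ D ∈ (Icc 1 n).powersetCard (s + 1), numSol D n
      = coeff n (1 * elemSum (Icc 1 n) (s + 1) multSeries) := by
    rw [one_mul, elemSum, map_sum]
    rfl
  rw [h1]
  refine (coeff_mul_elemSum_le _ _ _ _ _).trans ?_
  rw [one_mul, ← hT, pow_succ, coeff_mul]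
  calc _ ≤ ∑ p ∈ antidiagonal n, coeff p.1 (T ^ s) * (2 * n.sqrt) := by
        refine Finset.sum_le_sum fun p hp => Nat.mul_le_mul_left _ ?_
        rw [HasAntidiagonal.mem_antidiagonal] at hp
        exact coeff_sum_multSeries_le n p.2 (by omega)
    _ = coeffSum n (T ^ s) * (2 * n.sqrt) := by
        rw [← Finset.sum_mul, coeffSum,
          Finset.Nat.sum_antidiagonal_eq_sum_range_succ_mk]
    _ ≤ _ := Nat.mul_le_mul_right _ (coeffSum_pow_le _ _ _)

/-- Each `s` has a single quotient `N / s`, so the sets are disjoint over `e`; a quotient of at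
least `E` forces `s ≤ N / E`. -/
theorem sum_card_filter_div_eq_le {E : ℕ} (hE : 1 ≤ E) (n N : ℕ) :
    ∑ e ∈ Icc E n, ((Icc 1 N).filter fun s => N / s = e).card ≤ N / E := by
  rw [← Finset.card_biUnion]
  · have hsub : (Icc E n).biUnion (fun e => (Icc 1 N).filter fun s => N / s = e)
        ⊆ Icc 1 (N / E) := by
      intro s hs
      simp only [mem_biUnion, Finset.mem_Icc, mem_filter] at hs ⊢
      obtain ⟨e, he, hs, rfl⟩ := hs
      refine ⟨hs.1, ?_⟩
      rw [Nat.le_div_iff_mul_le (by omega)]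
      have := (Nat.le_div_iff_mul_le (by omega : 0 < s)).1 he.1
      linarith [mul_comm s E]
    simpa using card_le_card hsub
  · intro a _ b _ hab
    rw [Function.onFun, Finset.disjoint_left]
    intro s hs hs'
    rw [mem_filter] at hs hs'
    exact hab (hs.2.symm.trans hs'.2)

/-- A consecutive pair above `E` costs only `n / E` altogether, where two free parts would cost
about `n` times logarithms. This controls the large extremal sets. -/
theorem sum_numSol_pair_union_le {E : ℕ} (hE : 1 ≤ E) (n j : ℕ) :
    ∑ e ∈ Icc E n, ∑ R ∈ ((Icc 1 n).powersetCard j).filter (Disjoint {e, e + 1}),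
        numSol ({e, e + 1} ∪ R) n
      ≤ coeffSum n (∑ c ∈ Icc 1 n, multSeries c) ^ j * (n / E) := by
  set T := ∑ c ∈ Icc 1 n, multSeries c with hT
  have h1 : ∀ e ∈ Icc E n, ∑ R ∈ ((Icc 1 n).powersetCard j).filter (Disjoint {e, e + 1}),
        numSol ({e, e + 1} ∪ R) n
      ≤ ∑ p ∈ antidiagonal n, coeff p.1 (T ^ j) *
          ((Icc 1 p.2).filter fun s => p.2 / s = e).card := by
    intro e he
    rw [Finset.mem_Icc] at he
    calc _ = ∑ R ∈ ((Icc 1 n).powersetCard j).filter (Disjoint {e, e + 1}),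
          coeff n ((∏ c ∈ {e, e + 1}, multSeries c) * ∏ c ∈ R, multSeries c) := by
          refine Finset.sum_congr rfl fun R hR => ?_
          rw [numSol, Finset.prod_union (mem_filter.1 hR).2]
      _ ≤ ∑ R ∈ (Icc 1 n).powersetCard j,
          coeff n ((∏ c ∈ {e, e + 1}, multSeries c) * ∏ c ∈ R, multSeries c) :=
          Finset.sum_le_sum_of_subset (filter_subset _ _)
      _ = coeff n ((∏ c ∈ {e, e + 1}, multSeries c) * elemSum (Icc 1 n) j multSeries) := by
          rw [elemSum, Finset.mul_sum, map_sum]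
      _ ≤ coeff n ((∏ c ∈ {e, e + 1}, multSeries c) * T ^ j) := coeff_mul_elemSum_le _ _ _ _ _
      _ = ∑ p ∈ antidiagonal n, coeff p.1 (T ^ j) * numSol {e, e + 1} p.2 := by
          rw [mul_comm, coeff_mul]
          rfl
      _ ≤ _ := Finset.sum_le_sum fun p _ =>
          Nat.mul_le_mul_left _ (numSol_pair_le_card (by omega) _)
  refine (Finset.sum_le_sum h1).trans ?_
  rw [Finset.sum_comm]
  simp_rw [← Finset.mul_sum]
  calc _ ≤ ∑ p ∈ antidiagonal n, coeff p.1 (T ^ j) * (n / E) := by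
        refine Finset.sum_le_sum fun p hp => Nat.mul_le_mul_left _ ?_
        rw [HasAntidiagonal.mem_antidiagonal] at hp
        exact (sum_card_filter_div_eq_le hE n p.2).trans (Nat.div_le_div_right (by omega))
    _ = coeffSum n (T ^ j) * (n / E) := by
        rw [← Finset.sum_mul, coeffSum, Finset.Nat.sum_antidiagonal_eq_sum_range_succ_mk]
    _ ≤ _ := Nat.mul_le_mul_right _ (coeffSum_pow_le _ _ _)

end PartitionPattern

/-! ### Elementary symmetric sums of reciprocals and powers of the logarithm -/

namespace PartitionPattern

open Finset PowerSeries

/-- Expanding the power sum times `elemSum s j f` gives `(j + 1) * elemSum s (j + 1) f` plus terms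
with a repeated index. These are nonnegative and, since `f ≤ 1`, total at most `j * elemSum s j f`.
-/
theorem succ_mul_elemSum_succ_bounds (s : Finset ℕ) (f : ℕ → ℝ) (hf0 : ∀ x ∈ s, 0 ≤ f x)
    (hf1 : ∀ x ∈ s, f x ≤ 1) :
    ∀ j : ℕ, ((j : ℝ) + 1) * elemSum s (j + 1) f ≤ (∑ x ∈ s, f x) * elemSum s j f ∧
      (∑ x ∈ s, f x - j) * elemSum s j f ≤ ((j : ℝ) + 1) * elemSum s (j + 1) f := by
  induction s using Finset.induction_on with
  | empty =>
    intro j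
    rw [elemSum_succ_empty]
    rcases j with _ | j
    · simp
    · simp [elemSum_succ_empty]
  | insert x s hx ih =>
    have ih' := ih (fun y hy => hf0 y (mem_insert_of_mem hy))
      (fun y hy => hf1 y (mem_insert_of_mem hy))
    have hx0 := hf0 x (mem_insert_self _ _)
    have hx1 := hf1 x (mem_insert_self _ _)
    have hnn := fun j => elemSum_nonneg (s := s) (f := f)
      (fun y hy => hf0 y (mem_insert_of_mem hy)) j
    intro j
    rw [elemSum_succ_insert hx, Finset.sum_insert hx]
    rcases j with _ | j
    · have := ih' 0
      simp only [elemSum_zero, Nat.cast_zero] at this ⊢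
      constructor <;> linarith [this.1, this.2]
    · rw [elemSum_succ_insert hx]
      obtain ⟨h1, h2⟩ := ih' j
      obtain ⟨h3, h4⟩ := ih' (j + 1)
      have e0 := hnn j
      have e1 := hnn (j + 1)
      push_cast at h3 h4 ⊢
      set A := elemSum s j f
      set B := elemSum s (j + 1) f
      set C := elemSum s (j + 1 + 1) f
      set p := ∑ x ∈ s, f x
      have m1 := mul_le_mul_of_nonneg_left h1 hx0
      have m2 := mul_le_mul_of_nonneg_left h2 hx0
      have m3 : 0 ≤ f x * A := mul_nonneg hx0 e0
      have m4 : f x * (f x * A) ≤ f x * A := mul_le_of_le_one_left m3 hx1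
      have m5 : 0 ≤ f x * (f x * A) := mul_nonneg hx0 m3
      constructor <;> nlinarith

theorem elemSum_le_pow (s : Finset ℕ) (f : ℕ → ℝ) (hf0 : ∀ x ∈ s, 0 ≤ f x) (j : ℕ) :
    elemSum s j f ≤ (∑ x ∈ s, f x) ^ j := by
  induction s using Finset.induction_on generalizing j with
  | empty =>
    rcases j with _ | j
    · simp [elemSum_zero]
    · simp [elemSum_succ_empty]
  | insert x s hx ih =>
    have hf0' : ∀ y ∈ s, 0 ≤ f y := fun y hy => hf0 y (mem_insert_of_mem hy)
    have hx0 := hf0 x (mem_insert_self _ _)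
    have hp : 0 ≤ ∑ x ∈ s, f x := Finset.sum_nonneg hf0'
    rcases j with _ | j
    · simp [elemSum_zero]
    · rw [elemSum_succ_insert hx, Finset.sum_insert hx]
      have h1 := ih hf0' (j + 1)
      have h2 := mul_le_mul_of_nonneg_left (ih hf0' j) hx0
      set p := ∑ x ∈ s, f x
      have h3 : p ^ j ≤ (f x + p) ^ j := pow_le_pow_left₀ hp (by linarith) j
      calc _ ≤ p ^ (j + 1) + f x * p ^ j := by linarith
        _ = (f x + p) * p ^ j := by ring
        _ ≤ (f x + p) * (f x + p) ^ j := mul_le_mul_of_nonneg_left h3 (by linarith)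
        _ = _ := by ring

theorem abs_factorial_mul_elemSum_sub_pow_le (s : Finset ℕ) (f : ℕ → ℝ)
    (hf0 : ∀ x ∈ s, 0 ≤ f x) (hf1 : ∀ x ∈ s, f x ≤ 1) (j : ℕ) :
    0 ≤ j.factorial * elemSum s j f ∧ j.factorial * elemSum s j f ≤ (∑ x ∈ s, f x) ^ j ∧
      (∑ x ∈ s, f x) ^ j - j.factorial * elemSum s j f ≤ j ^ 2 * (∑ x ∈ s, f x) ^ (j - 1) := by
  have hp : 0 ≤ ∑ x ∈ s, f x := Finset.sum_nonneg hf0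
  induction j with
  | zero => simp [elemSum_zero]
  | succ j ih =>
    obtain ⟨h0, h1, h2⟩ := ih
    obtain ⟨b1, b2⟩ := succ_mul_elemSum_succ_bounds s f hf0 hf1 j
    set p := ∑ x ∈ s, f x
    have hF : (0 : ℝ) < j.factorial := by exact_mod_cast j.factorial_pos
    have e1 : ((j + 1).factorial : ℝ) * elemSum s (j + 1) f
        = j.factorial * ((j + 1) * elemSum s (j + 1) f) := by
      rw [Nat.factorial_succ]; push_cast; ring
    have c1 := mul_le_mul_of_nonneg_left b1 hF.le
    have c2 := mul_le_mul_of_nonneg_left b2 hF.le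
    rw [e1]
    set X := (j.factorial : ℝ) * elemSum s j f with hX
    have c1' : (j.factorial : ℝ) * ((j + 1) * elemSum s (j + 1) f) ≤ p * X := by
      rw [hX]; linarith
    have c2' : (p - j) * X ≤ (j.factorial : ℝ) * ((j + 1) * elemSum s (j + 1) f) := by
      rw [hX]; linarith
    refine ⟨?_, ?_, ?_⟩
    · have := elemSum_nonneg hf0 (j + 1)
      positivity
    · rw [pow_succ, mul_comm _ p]
      exact c1'.trans (mul_le_mul_of_nonneg_left h1 hp)
    · have h3 : p * (p ^ j - X) ≤ j ^ 2 * p ^ j := by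
        rcases j with _ | j
        · simp [hX, elemSum_zero]
        · have := mul_le_mul_of_nonneg_left h2 hp
          simp only [Nat.add_sub_cancel] at this
          calc _ ≤ _ := this
            _ = _ := by ring
      have h4 : (j : ℝ) * X ≤ j * p ^ j := mul_le_mul_of_nonneg_left h1 (Nat.cast_nonneg j)
      have h5 : 0 ≤ p ^ j := by positivity
      rw [pow_succ]
      push_cast
      have h6 : 0 ≤ (j : ℝ) * p ^ j := by positivity
      nlinarith

theorem sum_inv_Ioc_bounds {M n : ℕ} (hM : 1 ≤ M) (hMn : M ≤ n) :
    Real.log n - (1 + Real.log M) ≤ ∑ d ∈ Ioc M n, (d : ℝ)⁻¹ ∧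
      ∑ d ∈ Ioc M n, (d : ℝ)⁻¹ ≤ 1 + Real.log n := by
  have hh : ∀ n : ℕ, ((harmonic n : ℚ) : ℝ) = ∑ d ∈ Ioc 0 n, (d : ℝ)⁻¹ := by
    intro n
    rw [harmonic_eq_sum_Icc]
    push_cast
    rfl
  have hsplit : ∑ d ∈ Ioc 0 n, (d : ℝ)⁻¹ = ∑ d ∈ Ioc 0 M, (d : ℝ)⁻¹ + ∑ d ∈ Ioc M n, (d : ℝ)⁻¹ :=
    (Finset.sum_Ioc_consecutive _ (Nat.zero_le _) hMn).symm
  have h1 := harmonic_le_one_add_log n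
  have h2 := harmonic_le_one_add_log M
  have h3 := log_add_one_le_harmonic n
  rw [hh] at h1 h2 h3
  have h4 : Real.log n ≤ Real.log ↑(n + 1) := by
    apply Real.log_le_log
    · exact_mod_cast (by omega : 0 < n)
    · push_cast; linarith
  have h5 : (0 : ℝ) ≤ ∑ d ∈ Ioc 0 M, (d : ℝ)⁻¹ := Finset.sum_nonneg fun d _ => by positivity
  constructor <;> linarith

/-- The cutoff `M` enters the error only through `1 + log M`, so the bound can later be summed over
extremal sets with maximum `M`. -/
theorem abs_factorial_mul_elemSum_inv_sub_log_pow_le {M n : ℕ} (hM : 1 ≤ M) (hMn : M ≤ n)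
    (j : ℕ) :
    |j.factorial * elemSum (Ioc M n) j (fun d => (d : ℝ)⁻¹) - Real.log n ^ j|
      ≤ 2 * j ^ 2 * (1 + Real.log M) * (1 + Real.log n) ^ (j - 1) := by
  obtain ⟨b1, b2⟩ := sum_inv_Ioc_bounds hM hMn
  obtain ⟨h0, h1, h2⟩ := abs_factorial_mul_elemSum_sub_pow_le (Ioc M n) (fun d => (d : ℝ)⁻¹)
    (fun d _ => by positivity)
    (fun d hd => inv_le_one_of_one_le₀ (by
      rw [Finset.mem_Ioc] at hd
      exact_mod_cast (by omega : 1 ≤ d))) j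
  have hp : 0 ≤ ∑ d ∈ Ioc M n, (d : ℝ)⁻¹ := Finset.sum_nonneg fun d _ => by positivity
  set p := ∑ d ∈ Ioc M n, (d : ℝ)⁻¹
  set X := (j.factorial : ℝ) * elemSum (Ioc M n) j (fun d => (d : ℝ)⁻¹)
  have hL : 0 ≤ Real.log n := Real.log_natCast_nonneg n
  have hLM : 0 ≤ Real.log M := Real.log_natCast_nonneg M
  set L := Real.log n
  rcases j with _ | j
  · simp [X, elemSum_zero]
  simp only [Nat.add_sub_cancel] at h2 ⊢
  have q1 : p ^ j ≤ (1 + L) ^ j := pow_le_pow_left₀ hp b2 j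
  have q2 : L ^ j ≤ (1 + L) ^ j := pow_le_pow_left₀ hL (by linarith) j
  have hQ : 0 ≤ (1 + L) ^ j := by positivity
  have hd : |p ^ (j + 1) - L ^ (j + 1)| ≤ (j + 1) * (1 + Real.log M) * (1 + L) ^ j := by
    rw [abs_le]
    rcases le_total p L with h | h
    · have := pow_sub_pow_le_mul_sub hp h j
      have h3 : (j + 1) * L ^ j * (L - p) ≤ (j + 1) * (1 + L) ^ j * (1 + Real.log M) := by
        apply mul_le_mul _ (by linarith) (by linarith) (by positivity)
        gcongr
      have h4 : p ^ (j + 1) ≤ L ^ (j + 1) := pow_le_pow_left₀ hp h _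
      have h5 : 0 ≤ (j + 1) * (1 + Real.log M) * (1 + L) ^ j := by positivity
      constructor <;> linarith
    · have := pow_sub_pow_le_mul_sub hL h j
      have h3 : (j + 1) * p ^ j * (p - L) ≤ (j + 1) * (1 + L) ^ j * (1 + Real.log M) := by
        apply mul_le_mul _ (by linarith) (by linarith) (by positivity)
        gcongr
      have h4 : L ^ (j + 1) ≤ p ^ (j + 1) := pow_le_pow_left₀ hL h _
      have h5 : 0 ≤ (j + 1) * (1 + Real.log M) * (1 + L) ^ j := by positivity
      constructor <;> linarith
  push_cast at h2 ⊢
  have h6 : |X - p ^ (j + 1)| ≤ (j + 1) ^ 2 * (1 + Real.log M) * (1 + L) ^ j := by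
    have : ((j : ℝ) + 1) ^ 2 * p ^ j ≤ (j + 1) ^ 2 * (1 + Real.log M) * (1 + L) ^ j := by
      apply mul_le_mul _ q1 (by positivity) (by positivity)
      nlinarith [sq_nonneg ((j : ℝ) + 1)]
    rw [abs_le]
    have h5 : 0 ≤ ((j : ℝ) + 1) ^ 2 * (1 + Real.log M) * (1 + L) ^ j := by positivity
    constructor <;> linarith
  have h7 : (j + 1) * (1 + Real.log M) * (1 + L) ^ j
      ≤ (j + 1) ^ 2 * (1 + Real.log M) * (1 + L) ^ j := by
    gcongr
    nlinarith [(Nat.cast_nonneg j : (0 : ℝ) ≤ j)]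
  calc |X - L ^ (j + 1)| = |(X - p ^ (j + 1)) + (p ^ (j + 1) - L ^ (j + 1))| := by ring_nf
    _ ≤ _ := abs_add_le _ _
    _ ≤ _ := by linarith

/-- Multiplying `∏ c⁻¹` by one of its `c` deletes that element, and a given `j`-set is obtained in
at most `s.card` ways. -/
theorem sum_sum_mul_prod_inv_le (s : Finset ℕ) (hs : ∀ x ∈ s, 1 ≤ x) (j : ℕ) :
    ∑ C ∈ s.powersetCard (j + 1), (∑ c ∈ C, (c : ℝ)) * ∏ c ∈ C, (c : ℝ)⁻¹
      ≤ s.card * elemSum s j (fun d => (d : ℝ)⁻¹) := by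
  induction s using Finset.induction_on generalizing j with
  | empty =>
    rw [powersetCard_eq_empty.2 (by simp)]
    simp
  | insert x s hx ih =>
    have hs' : ∀ y ∈ s, 1 ≤ y := fun y hy => hs y (mem_insert_of_mem hy)
    have hx1 : 1 ≤ x := hs x (mem_insert_self _ _)
    have hx0 : (0 : ℝ) < x := by exact_mod_cast hx1
    have hnn := elemSum_nonneg (s := s) (f := fun d : ℕ => (d : ℝ)⁻¹) (fun y _ => by positivity)
    rw [sum_powersetCard_succ_insert hx, Finset.card_insert_of_notMem hx]
    have h1 : ∑ T ∈ s.powersetCard j, (∑ c ∈ insert x T, (c : ℝ)) * ∏ c ∈ insert x T, (c : ℝ)⁻¹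
        = elemSum s j (fun d => (d : ℝ)⁻¹)
          + (x : ℝ)⁻¹ * ∑ C ∈ s.powersetCard j, (∑ c ∈ C, (c : ℝ)) * ∏ c ∈ C, (c : ℝ)⁻¹ := by
      rw [elemSum, Finset.mul_sum, ← Finset.sum_add_distrib]
      refine Finset.sum_congr rfl fun T hT => ?_
      have hxT : x ∉ T := fun h => hx ((mem_powersetCard.1 hT).1 h)
      rw [Finset.sum_insert hxT, Finset.prod_insert hxT]
      field_simp
    rw [h1]
    have h2 := ih hs' j
    push_cast
    rcases j with _ | j
    · simp only [elemSum_zero] at h2 ⊢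
      simp at h2 ⊢
      linarith
    · have h3 := mul_le_mul_of_nonneg_left (ih hs' j) (inv_nonneg.2 hx0.le)
      rw [elemSum_succ_insert hx]
      have h4 : 0 ≤ (x : ℝ)⁻¹ * elemSum s j (fun d => (d : ℝ)⁻¹) :=
        mul_nonneg (by positivity) (hnn j)
      nlinarith

end PartitionPattern

/-! ### Uniform estimates for sets whose lower part ends in a consecutive pair -/

namespace PartitionPattern

open Finset PowerSeries

/-- A set of part sizes whose two largest elements are consecutive, or `{1}`. -/
def EndsInPair (D : Finset ℕ) : Prop :=
  (∀ d ∈ D, 1 ≤ d) ∧ (D = {1} ∨ 2 ≤ D.sup id ∧ D.sup id - 1 ∈ D ∧ D.sup id ∈ D)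

theorem EndsInPair.exists_pair {D : Finset ℕ} (hD : EndsInPair D) (h1 : D ≠ {1}) :
    ∃ e, 1 ≤ e ∧ D.sup id = e + 1 ∧ e ∈ D ∧ e + 1 ∈ D := by
  rcases hD.2 with h | ⟨h2, h3, h4⟩
  · exact absurd h h1
  · refine ⟨D.sup id - 1, by omega, by omega, h3, ?_⟩
    rwa [Nat.sub_add_cancel (by omega)]

theorem numSol_one {N : ℕ} (hN : 1 ≤ N) : numSol {1} N = 1 := by
  rw [numSol_singleton, if_pos ⟨one_dvd _, by omega⟩]

/-- Start from the pair `{e, e + 1}` with density `1 / (e (e + 1))`, or from `{1}`, and add all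
other parts. The elements of `D` below the pair are at most `e`, so their sum is absorbed by that
density; this leaves only `D.card` in the error. -/
theorem abs_numSol_union_sub_le_of_endsInPair {D : Finset ℕ} (hD : EndsInPair D) (C : Finset ℕ)
    (hC : ∀ c ∈ C, D.sup id < c) {n : ℕ} (hn : 1 ≤ n) :
    |(numSol (D ∪ C) n : ℝ) - (n : ℝ) ^ (D.card + C.card - 1) / (D.card + C.card - 1).factorial
        * ((∏ d ∈ D, (d : ℝ)⁻¹) * ∏ c ∈ C, (c : ℝ)⁻¹)|
      ≤ (n : ℝ) ^ (D.card + C.card - 1) / n * (D.card * ∏ c ∈ C, (c : ℝ)⁻¹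
        + (∏ d ∈ D, (d : ℝ)⁻¹) * ((∑ c ∈ C, (c : ℝ)) * ∏ c ∈ C, (c : ℝ)⁻¹)) := by
  have hn0 : (0 : ℝ) < n := by exact_mod_cast hn
  have hC1 : ∀ c ∈ C, 1 ≤ c := fun c hc => by have := hC c hc; omega
  have hCp : (0 : ℝ) < ∏ c ∈ C, (c : ℝ) := Finset.prod_pos fun c hc => by exact_mod_cast hC1 c hc
  have hdisj : Disjoint C D := by
    rw [Finset.disjoint_left]
    intro c hc hcD
    have h1 := hC c hc
    have h2 : c ≤ D.sup id := Finset.le_sup (f := id) hcD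
    omega
  by_cases h1 : D = {1}
  · subst h1
    have key := abs_numSol_union_sub_le (D := {1}) (by simp) (a := 1) (δ := 0) (p := 0)
      zero_le_one hn (fun N hN _ => by simp [numSol_one hN]) C hC1 hdisj n hn le_rfl
    rw [Finset.union_comm]
    simp only [card_singleton, prod_singleton, Nat.cast_one, inv_one, one_mul,
      Finset.prod_inv_distrib, Nat.add_sub_cancel_left, zero_add, pow_zero, mul_one] at key ⊢
    have e1 : (1 : ℝ) / (C.card.factorial * ∏ c ∈ C, (c : ℝ)) * (n : ℝ) ^ C.card
        = (n : ℝ) ^ C.card / C.card.factorial * (∏ c ∈ C, (c : ℝ))⁻¹ := by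
      field_simp
    rw [e1] at key
    refine key.trans ?_
    have e2 : (n : ℝ) ^ C.card / (∏ c ∈ C, (c : ℝ)) * ((∑ c ∈ C, (c : ℝ)) / n)
        = (n : ℝ) ^ C.card / n * ((∑ c ∈ C, (c : ℝ)) * (∏ c ∈ C, (c : ℝ))⁻¹) := by
      field_simp
    rw [e2]
    gcongr
    have : 0 ≤ (∏ c ∈ C, (c : ℝ))⁻¹ := by positivity
    linarith
  · obtain ⟨e, he, hsup, he1, he2⟩ := hD.exists_pair h1
    set B := D \ {e, e + 1} with hB
    have hpair : ({e, e + 1} : Finset ℕ) ⊆ D := by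
      intro x hx
      simp only [mem_insert, mem_singleton] at hx
      rcases hx with rfl | rfl <;> assumption
    have hDB : D = {e, e + 1} ∪ B := (Finset.union_sdiff_of_subset hpair).symm
    have hdB : Disjoint ({e, e + 1} : Finset ℕ) B := Finset.disjoint_sdiff
    have hBD : B ⊆ D := Finset.sdiff_subset
    have hBC : Disjoint C B := hdisj.mono_right hBD
    have hB1 : ∀ b ∈ B, 1 ≤ b := fun b hb => hD.1 b (hBD hb)
    have hBe : ∀ b ∈ B, b ≤ e := by
      intro b hb
      have h2 : b ≤ D.sup id := Finset.le_sup (f := id) (hBD hb)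
      have h3 : b ∉ ({e, e + 1} : Finset ℕ) := (Finset.mem_sdiff.1 hb).2
      simp only [mem_insert, mem_singleton, not_or] at h3
      omega
    have hcardD : D.card = B.card + 2 := by
      rw [hDB, Finset.card_union_of_disjoint hdB, Finset.card_pair (by omega), add_comm]
    have he0 : (0 : ℝ) < e := by exact_mod_cast he
    have hprodD : ∏ d ∈ D, (d : ℝ)⁻¹ = (e * (e + 1) : ℝ)⁻¹ * (∏ b ∈ B, (b : ℝ))⁻¹ := by
      rw [hDB, Finset.prod_union hdB, Finset.prod_pair (by omega), Finset.prod_inv_distrib,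
        mul_inv]
      push_cast
      rfl
    have hBp : (1 : ℝ) ≤ ∏ b ∈ B, (b : ℝ) := by
      rw [← Nat.cast_prod]
      exact_mod_cast Nat.succ_le_of_lt (Finset.prod_pos fun x hx => hB1 x hx)
    have key := abs_numSol_union_sub_le (D := {e, e + 1}) (by simp) (a := (e * (e + 1) : ℝ)⁻¹)
      (δ := 2) (p := 1) (by positivity) hn
      (fun N hN _ => by
        have := abs_numSol_pair_sub_le he hN
        simpa [div_eq_inv_mul] using this)
      (C ∪ B) (fun c hc => (mem_union.1 hc).elim (hC1 c) (hB1 c))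
      (Finset.disjoint_union_left.2 ⟨hdisj.mono_right hpair, hdB.symm⟩) n hn le_rfl
    have hset : C ∪ B ∪ {e, e + 1} = D ∪ C := by
      conv_rhs => rw [hDB]
      ext x; simp only [mem_union]; tauto
    rw [hset, Finset.card_union_of_disjoint hBC, Finset.prod_union hBC, Finset.sum_union hBC] at key
    rw [hprodD, Finset.prod_inv_distrib]
    have hk1 : 1 + (C.card + B.card) = D.card + C.card - 1 := by omega
    have hk2 : (n : ℝ) ^ (C.card + B.card) = (n : ℝ) ^ (D.card + C.card - 1) / n := by
      rw [← hk1, pow_add _ 1, pow_one, mul_div_cancel_left₀ _ hn0.ne']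
    rw [hk1, hk2] at key
    set k1 := D.card + C.card - 1
    have e1 : (e * (e + 1) : ℝ)⁻¹ / (k1.factorial * ((∏ c ∈ C, (c : ℝ)) * ∏ b ∈ B, (b : ℝ)))
          * (n : ℝ) ^ k1
        = (n : ℝ) ^ k1 / k1.factorial * ((e * (e + 1) : ℝ)⁻¹ * (∏ b ∈ B, (b : ℝ))⁻¹
          * (∏ c ∈ C, (c : ℝ))⁻¹) := by
      have : (0 : ℝ) < ∏ b ∈ B, (b : ℝ) := by linarith
      field_simp
    rw [e1] at key
    refine key.trans ?_
    have hsumB : (e * (e + 1) : ℝ)⁻¹ * ∑ b ∈ B, (b : ℝ) ≤ B.card := by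
      have h3 : ∑ b ∈ B, (b : ℝ) ≤ B.card * (e * (e + 1)) := by
        rw [← nsmul_eq_mul]
        refine Finset.sum_le_card_nsmul _ _ _ fun b hb => ?_
        have : (b : ℝ) ≤ e := by exact_mod_cast hBe b hb
        nlinarith
      rw [inv_mul_le_iff₀ (by positivity)]
      linarith [mul_comm (B.card : ℝ) (e * (e + 1))]
    have hBinv : (∏ b ∈ B, (b : ℝ))⁻¹ ≤ 1 := inv_le_one_of_one_le₀ hBp
    have hBinv0 : 0 ≤ (∏ b ∈ B, (b : ℝ))⁻¹ := inv_nonneg.2 (by linarith)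
    have hCinv0 : 0 ≤ (∏ c ∈ C, (c : ℝ))⁻¹ := by positivity
    set PB := (∏ b ∈ B, (b : ℝ))⁻¹ with hPB
    set PC := (∏ c ∈ C, (c : ℝ))⁻¹ with hPC
    set a := (e * (e + 1) : ℝ)⁻¹
    have e2 : (n : ℝ) ^ k1 / n / ((∏ c ∈ C, (c : ℝ)) * ∏ b ∈ B, (b : ℝ))
          * (2 + a * (n : ℝ) ^ 1 * (∑ c ∈ C, (c : ℝ) + ∑ b ∈ B, (b : ℝ)) / n)
        = (n : ℝ) ^ k1 / n * ((PC * PB) * (2 + a * ∑ c ∈ C, (c : ℝ) + a * ∑ b ∈ B, (b : ℝ))) := by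
      rw [hPB, hPC]
      have : (0 : ℝ) < ∏ b ∈ B, (b : ℝ) := by linarith
      field_simp
      ring
    rw [e2]
    refine mul_le_mul_of_nonneg_left ?_ (by positivity)
    have h5 : PC * PB * (2 + a * ∑ b ∈ B, (b : ℝ)) ≤ PC * 1 * (2 + B.card) := by
      gcongr
    rw [hcardD]
    push_cast
    nlinarith

theorem one_add_log_le_two_mul_sqrt {M : ℕ} (hM : 1 ≤ M) :
    1 + Real.log M ≤ 2 * Real.sqrt M := by
  have hM0 : (0 : ℝ) < M := by exact_mod_cast hM
  have h1 : Real.log M = 2 * Real.log (Real.sqrt M) := by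
    rw [Real.log_sqrt hM0.le]; ring
  have := Real.log_le_sub_one_of_pos (Real.sqrt_pos.2 hM0)
  linarith

theorem EndsInPair.one_le_sup {D : Finset ℕ} (hD : EndsInPair D) : 1 ≤ D.sup id := by
  rcases hD.2 with rfl | h
  · simp
  · omega

/-- Two errors are added: those of the individual sets `D ∪ C`, and that of replacing the symmetric
sum by `log^ℓ n / ℓ!`. The logarithm of `D.sup id` is weakened to a square root, still light enough
for the weights to be summable over `D`. -/
theorem abs_sum_numSol_sub_le {D : Finset ℕ} (hD : EndsInPair D) {n : ℕ} (hDn : D.sup id ≤ n)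
    (ℓ : ℕ) :
    |∑ C ∈ (Ioc (D.sup id) n).powersetCard ℓ, (numSol (D ∪ C) n : ℝ)
        - (n : ℝ) ^ (D.card + ℓ - 1) * Real.log n ^ ℓ
          / ((D.card + ℓ - 1).factorial * ℓ.factorial) * ∏ d ∈ D, (d : ℝ)⁻¹|
      ≤ (n : ℝ) ^ (D.card + ℓ - 1) * (1 + Real.log n) ^ ℓ * (D.card / n
          + 6 * ℓ ^ 2 * (Real.sqrt (D.sup id : ℕ) * ∏ d ∈ D, (d : ℝ)⁻¹) / (1 + Real.log n)) := by
  have hM := hD.one_le_sup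
  set M := D.sup id with hMdef
  have hn : 1 ≤ n := by omega
  have hn0 : (0 : ℝ) < n := by exact_mod_cast hn
  set P := ∏ d ∈ D, (d : ℝ)⁻¹ with hP
  have hP0 : 0 ≤ P := Finset.prod_nonneg fun d _ => by positivity
  set k1 := D.card + ℓ - 1 with hk1
  have hL : 0 ≤ Real.log n := Real.log_natCast_nonneg n
  set L := Real.log n with hLdef
  set e := elemSum (Ioc M n) ℓ (fun d => (d : ℝ)⁻¹) with he
  obtain ⟨b1, b2⟩ := sum_inv_Ioc_bounds hM hDn
  have hp : 0 ≤ ∑ d ∈ Ioc M n, (d : ℝ)⁻¹ := Finset.sum_nonneg fun d _ => by positivity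
  have hele : ∀ j, elemSum (Ioc M n) j (fun d => (d : ℝ)⁻¹) ≤ (1 + L) ^ j := fun j =>
    (elemSum_le_pow _ _ (fun d _ => by positivity) j).trans (pow_le_pow_left₀ hp b2 j)
  -- the contribution of the individual estimates
  have hA : |∑ C ∈ (Ioc M n).powersetCard ℓ, (numSol (D ∪ C) n : ℝ)
      - (n : ℝ) ^ k1 / k1.factorial * (P * e)|
      ≤ (n : ℝ) ^ k1 * (D.card * (1 + L) ^ ℓ / n + P * (ℓ * (1 + L) ^ (ℓ - 1))) := by
    have hsum : (n : ℝ) ^ k1 / k1.factorial * (P * e)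
        = ∑ C ∈ (Ioc M n).powersetCard ℓ, (n : ℝ) ^ k1 / k1.factorial
            * (P * ∏ c ∈ C, (c : ℝ)⁻¹) := by
      rw [he, elemSum, Finset.mul_sum, Finset.mul_sum]
    rw [hsum, ← Finset.sum_sub_distrib]
    refine (Finset.abs_sum_le_sum_abs _ _).trans ?_
    have hterm : ∀ C ∈ (Ioc M n).powersetCard ℓ,
        |(numSol (D ∪ C) n : ℝ) - (n : ℝ) ^ k1 / k1.factorial * (P * ∏ c ∈ C, (c : ℝ)⁻¹)|
          ≤ (n : ℝ) ^ k1 / n * (D.card * ∏ c ∈ C, (c : ℝ)⁻¹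
            + P * ((∑ c ∈ C, (c : ℝ)) * ∏ c ∈ C, (c : ℝ)⁻¹)) := by
      intro C hC
      rw [mem_powersetCard] at hC
      have := abs_numSol_union_sub_le_of_endsInPair hD C
        (fun c hc => (Finset.mem_Ioc.1 (hC.1 hc)).1) hn
      rw [hC.2] at this
      exact this
    refine (Finset.sum_le_sum hterm).trans ?_
    rw [← Finset.mul_sum, Finset.sum_add_distrib, ← Finset.mul_sum, ← Finset.mul_sum]
    have hG : ∑ C ∈ (Ioc M n).powersetCard ℓ, (∑ c ∈ C, (c : ℝ)) * ∏ c ∈ C, (c : ℝ)⁻¹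
        ≤ n * (ℓ * (1 + L) ^ (ℓ - 1)) := by
      rcases ℓ with _ | j
      · simp
      · refine (sum_sum_mul_prod_inv_le _ (fun x hx => ?_) j).trans ?_
        · rw [Finset.mem_Ioc] at hx; omega
        · have h1 : ((Ioc M n).card : ℝ) ≤ n := by
            rw [Nat.card_Ioc]; exact_mod_cast Nat.sub_le _ _
          have h2 : (1 : ℝ) ≤ ((j + 1 : ℕ) : ℝ) := by exact_mod_cast Nat.succ_pos j
          have h3 := hele j
          have h4 : 0 ≤ (1 + L) ^ j := by positivity
          rw [Nat.add_sub_cancel]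
          refine mul_le_mul h1 (h3.trans ?_) (elemSum_nonneg (fun d _ => by positivity) j) hn0.le
          nlinarith
    have hE : ∑ C ∈ (Ioc M n).powersetCard ℓ, ∏ c ∈ C, (c : ℝ)⁻¹ ≤ (1 + L) ^ ℓ := hele ℓ
    calc _ ≤ (n : ℝ) ^ k1 / n * (D.card * (1 + L) ^ ℓ + P * (n * (ℓ * (1 + L) ^ (ℓ - 1)))) := by
          gcongr
      _ = _ := by field_simp
  have hB : |(n : ℝ) ^ k1 / k1.factorial * (P * e)
      - (n : ℝ) ^ k1 * L ^ ℓ / (k1.factorial * ℓ.factorial) * P|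
      ≤ (n : ℝ) ^ k1 * (P * (2 * ℓ ^ 2 * (1 + Real.log M) * (1 + L) ^ (ℓ - 1))) := by
    have h1 := abs_factorial_mul_elemSum_inv_sub_log_pow_le hM hDn ℓ
    have hf1 : (1 : ℝ) ≤ k1.factorial := by exact_mod_cast Nat.succ_le_of_lt (Nat.factorial_pos _)
    have hf2 : (1 : ℝ) ≤ ℓ.factorial := by exact_mod_cast Nat.succ_le_of_lt (Nat.factorial_pos _)
    have h2 : (n : ℝ) ^ k1 / k1.factorial * (P * e)
        - (n : ℝ) ^ k1 * L ^ ℓ / (k1.factorial * ℓ.factorial) * P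
        = (n : ℝ) ^ k1 * P / (k1.factorial * ℓ.factorial) * (ℓ.factorial * e - L ^ ℓ) := by
      field_simp
    rw [h2, abs_mul, abs_of_nonneg (by positivity), ← mul_assoc]
    refine mul_le_mul (div_le_self (by positivity) ?_) h1 (abs_nonneg _) (by positivity)
    nlinarith
  -- The factor `ℓ` makes the identity valid at `ℓ = 0`, where the truncated exponent `ℓ - 1` is
  -- wrong.
  have hpow : ((1 : ℝ) + L) ^ (ℓ - 1) * ℓ = (1 + L) ^ ℓ / (1 + L) * ℓ := by
    rcases ℓ with _ | j
    · simp
    · rw [pow_succ, Nat.add_sub_cancel, mul_div_cancel_right₀ _ (by positivity)]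
  have hsq := one_add_log_le_two_mul_sqrt hM
  have hS : 1 ≤ Real.sqrt M := by
    rw [Real.one_le_sqrt]; exact_mod_cast hM
  have hfin : (ℓ * (1 + L) ^ (ℓ - 1) : ℝ) + 2 * ℓ ^ 2 * (1 + Real.log M) * (1 + L) ^ (ℓ - 1)
      ≤ 6 * ℓ ^ 2 * Real.sqrt M * ((1 + L) ^ ℓ / (1 + L)) := by
    have h1 : (ℓ * (1 + L) ^ (ℓ - 1) : ℝ) + 2 * ℓ ^ 2 * (1 + Real.log M) * (1 + L) ^ (ℓ - 1)
        = (1 + 2 * ℓ * (1 + Real.log M)) * ((1 + L) ^ ℓ / (1 + L) * ℓ) := by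
      rw [← hpow]; ring
    rw [h1]
    have h2 : 0 ≤ (1 + L) ^ ℓ / (1 + L) := by positivity
    rcases Nat.eq_zero_or_pos ℓ with h | h
    · simp [h]
    · have h3 : (1 : ℝ) ≤ ℓ := by exact_mod_cast h
      have h4 : (1 + 2 * ℓ * (1 + Real.log M)) ≤ 6 * ℓ * Real.sqrt M := by nlinarith
      calc _ ≤ 6 * ℓ * Real.sqrt M * ((1 + L) ^ ℓ / (1 + L) * ℓ) := by gcongr
        _ = _ := by ring
  have hfin2 := mul_le_mul_of_nonneg_left hfin hP0
  have hnk : (0 : ℝ) ≤ (n : ℝ) ^ k1 := by positivity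
  calc _ ≤ _ := abs_sub_le _ ((n : ℝ) ^ k1 / k1.factorial * (P * e)) _
    _ ≤ _ := add_le_add hA hB
    _ = (n : ℝ) ^ k1 * (D.card * (1 + L) ^ ℓ / n + P * (ℓ * (1 + L) ^ (ℓ - 1)
          + 2 * ℓ ^ 2 * (1 + Real.log M) * (1 + L) ^ (ℓ - 1))) := by ring
    _ ≤ (n : ℝ) ^ k1 * (D.card * (1 + L) ^ ℓ / n
          + P * (6 * ℓ ^ 2 * Real.sqrt M * ((1 + L) ^ ℓ / (1 + L)))) := by gcongr
    _ = _ := by ring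

end PartitionPattern

/-! ### Convergence and tails of the series over extremal sets -/

namespace PartitionPattern

open Finset PowerSeries

theorem exists_one_add_log_pow_le (q : ℕ) :
    ∃ K : ℝ, 0 ≤ K ∧ ∀ e : ℕ, 1 ≤ e → (1 + Real.log e) ^ q ≤ K * (e : ℝ) ^ (1 / 4 : ℝ) := by
  set ε : ℝ := 1 / (4 * (q + 1)) with hε
  have hε0 : 0 < ε := by positivity
  refine ⟨(1 + 1 / ε) ^ q, by positivity, fun e he => ?_⟩
  have he1 : (1 : ℝ) ≤ e := by exact_mod_cast he
  have h1 : Real.log e ≤ (e : ℝ) ^ ε / ε := Real.log_le_rpow_div (by linarith) hε0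
  have h2 : (1 : ℝ) ≤ (e : ℝ) ^ ε := Real.one_le_rpow he1 hε0.le
  have h3 : 1 + Real.log e ≤ (1 + 1 / ε) * (e : ℝ) ^ ε := by
    rw [add_mul, one_mul, one_div_mul_eq_div]
    linarith
  have h4 : 0 ≤ Real.log e := Real.log_natCast_nonneg e
  calc (1 + Real.log e) ^ q ≤ ((1 + 1 / ε) * (e : ℝ) ^ ε) ^ q := by gcongr
    _ = (1 + 1 / ε) ^ q * (e : ℝ) ^ (ε * q) := by
        rw [mul_pow, Real.rpow_mul (by linarith), Real.rpow_natCast]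
    _ ≤ _ := by
        refine mul_le_mul_of_nonneg_left (Real.rpow_le_rpow_of_exponent_le he1 ?_) (by positivity)
        · rw [hε, one_div_mul_eq_div, div_le_div_iff₀ (by positivity) (by norm_num)]
          linarith

/-- The weight of all sets with largest elements `e`, `e + 1` in the tail estimate. -/
noncomputable def pairWeight (q e : ℕ) : ℝ :=
  Real.sqrt ((e + 1 : ℕ) : ℝ) * ((e : ℝ)⁻¹ * ((e : ℝ) + 1)⁻¹) * (1 + Real.log e) ^ q

theorem pairWeight_nonneg (q e : ℕ) : 0 ≤ pairWeight q e := by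
  have := Real.log_natCast_nonneg e
  unfold pairWeight
  positivity

/-- The weight is of order `e ^ (-3/2)` times a power of `log e`. Spending `e ^ (1/4)` on the
logarithms leaves the exponent `5/4 > 1`. -/
theorem summable_pairWeight (q : ℕ) : Summable (pairWeight q) := by
  obtain ⟨K, hK0, hK⟩ := exists_one_add_log_pow_le q
  have hs : Summable fun e : ℕ => K * (1 / (e : ℝ) ^ (5 / 4 : ℝ)) :=
    (Real.summable_one_div_nat_rpow.2 (by norm_num)).mul_left K
  refine Summable.of_nonneg_of_le (pairWeight_nonneg q) (fun e => ?_) hs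
  rcases Nat.eq_zero_or_pos e with rfl | he
  · simp [pairWeight]
  have he0 : (0 : ℝ) < e := by exact_mod_cast he
  have h1 : Real.sqrt ((e + 1 : ℕ) : ℝ) * ((e : ℝ)⁻¹ * ((e : ℝ) + 1)⁻¹)
      ≤ (e : ℝ)⁻¹ * (Real.sqrt e)⁻¹ := by
    push_cast
    have h2 : Real.sqrt ((e : ℝ) + 1) * ((e : ℝ) + 1)⁻¹ = (Real.sqrt ((e : ℝ) + 1))⁻¹ := by
      rw [← div_eq_mul_inv, Real.sqrt_div_self', one_div]
    calc _ = (e : ℝ)⁻¹ * (Real.sqrt ((e : ℝ) + 1) * ((e : ℝ) + 1)⁻¹) := by ring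
      _ ≤ _ := by
        rw [h2]
        gcongr
        linarith
  have h3 : (e : ℝ)⁻¹ * (Real.sqrt e)⁻¹ * (e : ℝ) ^ (1 / 4 : ℝ) = 1 / (e : ℝ) ^ (5 / 4 : ℝ) := by
    have h4 : 1 / (e : ℝ) ^ (5 / 4 : ℝ) = (e : ℝ) ^ (-(5 / 4) : ℝ) := by
      rw [Real.rpow_neg he0.le, one_div]
    rw [h4, Real.sqrt_eq_rpow, ← Real.rpow_neg_one, ← Real.rpow_neg he0.le, ← Real.rpow_add he0,
      ← Real.rpow_add he0]
    norm_num
  calc pairWeight q e ≤ (e : ℝ)⁻¹ * (Real.sqrt e)⁻¹ * (K * (e : ℝ) ^ (1 / 4 : ℝ)) := by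
        unfold pairWeight
        have : 0 ≤ Real.log e := Real.log_natCast_nonneg e
        refine mul_le_mul h1 (hK e he) (by positivity) (by positivity)
    _ = K * ((e : ℝ)⁻¹ * (Real.sqrt e)⁻¹ * (e : ℝ) ^ (1 / 4 : ℝ)) := by ring
    _ = _ := by rw [h3]

/-- The product of the reciprocals of the elements of `D`. -/
noncomputable def invProd (D : Finset ℕ) : ℝ := ∏ d ∈ D, (d : ℝ)⁻¹

theorem invProd_nonneg (D : Finset ℕ) : 0 ≤ invProd D :=
  Finset.prod_nonneg fun d _ => by positivity

theorem EndsInPair.decomp {D : Finset ℕ} {e : ℕ} (hD : EndsInPair D)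
    (hsup : D.sup id = e + 1) (he1 : e ∈ D) (he2 : e + 1 ∈ D) :
    D = {e, e + 1} ∪ (D \ {e, e + 1}) ∧ (D \ {e, e + 1}) ⊆ Icc 1 e ∧
      (D \ {e, e + 1}).card = D.card - 2 := by
  have hpair : ({e, e + 1} : Finset ℕ) ⊆ D := by
    intro x hx
    simp only [mem_insert, mem_singleton] at hx
    rcases hx with rfl | rfl <;> assumption
  refine ⟨(Finset.union_sdiff_of_subset hpair).symm, fun b hb => ?_, ?_⟩
  · have h1 := hD.1 b (sdiff_subset hb)
    have h2 : b ≤ D.sup id := Finset.le_sup (f := id) (sdiff_subset hb)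
    have h3 := (Finset.mem_sdiff.1 hb).2
    simp only [mem_insert, mem_singleton, not_or] at h3
    rw [Finset.mem_Icc]
    omega
  · rw [Finset.card_sdiff_of_subset hpair, Finset.card_pair (by omega)]

/-- The set `{1}` accounts for the 1. Any other set splits into its top pair `e, e + 1` and `κ - 2`
elements of `Icc 1 e`, whose reciprocal products sum to at most `(1 + log e) ^ (κ - 2)`. -/
theorem sum_sqrt_mul_invProd_le (κ : ℕ) (u : Finset (Finset ℕ))
    (hu : ∀ D ∈ u, EndsInPair D ∧ D.card = κ) :
    ∑ D ∈ u, Real.sqrt (D.sup id : ℕ) * invProd D ≤ 1 + ∑' e, pairWeight (κ - 2) e := by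
  rw [← Finset.sum_filter_add_sum_filter_not u (fun D => D = {1})]
  refine add_le_add ?_ ?_
  · calc _ ≤ ∑ D ∈ ({{1}} : Finset (Finset ℕ)), Real.sqrt (D.sup id : ℕ) * invProd D := by
          refine Finset.sum_le_sum_of_subset_of_nonneg (fun D hD => ?_) fun D _ _ =>
            mul_nonneg (Real.sqrt_nonneg _) (invProd_nonneg _)
          rw [mem_singleton]
          exact (mem_filter.1 hD).2
      _ ≤ 1 := by simp [invProd]
  · set v := u.filter fun D => ¬ D = {1} with hv
    have hv' : ∀ D ∈ v, EndsInPair D ∧ D.card = κ ∧ D ≠ {1} := fun D hD =>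
      ⟨(hu D (mem_filter.1 hD).1).1, (hu D (mem_filter.1 hD).1).2, (mem_filter.1 hD).2⟩
    set X := v.sup fun D => D.sup id with hX
    have hXle : ∀ D ∈ v, D.sup id ≤ X := fun D hD => Finset.le_sup (f := fun D => D.sup id) hD
    have hcover : ∑ D ∈ v, Real.sqrt (D.sup id : ℕ) * invProd D
        ≤ ∑ x ∈ (range X).sigma fun e => (Icc 1 e).powersetCard (κ - 2),
            Real.sqrt ((x.1 + 1 : ℕ) : ℝ) * ((x.1 : ℝ)⁻¹ * ((x.1 : ℝ) + 1)⁻¹) * invProd x.2 := by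
      have hinj : Set.InjOn (fun D : Finset ℕ =>
          (⟨D.sup id - 1, D \ {D.sup id - 1, D.sup id - 1 + 1}⟩ : Σ _ : ℕ, Finset ℕ)) v := by
        intro D hD D' hD' h
        obtain ⟨e, he, h1, h2, h3⟩ := (hv' D hD).1.exists_pair (hv' D hD).2.2
        obtain ⟨e', he', h1', h2', h3'⟩ := (hv' D' hD').1.exists_pair (hv' D' hD').2.2
        simp only [h1, h1', Nat.add_sub_cancel, Sigma.mk.injEq, heq_eq_eq] at h
        obtain ⟨rfl, h⟩ := h
        rw [((hv' D hD).1.decomp h1 h2 h3).1, ((hv' D' hD').1.decomp h1' h2' h3').1, h]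
      calc _ = ∑ x ∈ v.image (fun D : Finset ℕ =>
              (⟨D.sup id - 1, D \ {D.sup id - 1, D.sup id - 1 + 1}⟩ : Σ _ : ℕ, Finset ℕ)),
            Real.sqrt ((x.1 + 1 : ℕ) : ℝ) * ((x.1 : ℝ)⁻¹ * ((x.1 : ℝ) + 1)⁻¹) * invProd x.2 := by
            rw [Finset.sum_image hinj]
            refine Finset.sum_congr rfl fun D hD => ?_
            obtain ⟨e, he, h1, h2, h3⟩ := (hv' D hD).1.exists_pair (hv' D hD).2.2
            obtain ⟨h4, -, -⟩ := (hv' D hD).1.decomp h1 h2 h3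
            simp only [h1, Nat.add_sub_cancel]
            have h5 : invProd D = ((e : ℝ)⁻¹ * ((e : ℝ) + 1)⁻¹) * invProd (D \ {e, e + 1}) := by
              conv_lhs => rw [h4]
              unfold invProd
              rw [Finset.prod_union disjoint_sdiff, Finset.prod_pair (by omega)]
              push_cast
              rfl
            rw [h5]
            ring
        _ ≤ _ := by
            refine Finset.sum_le_sum_of_subset_of_nonneg ?_ fun x _ _ =>
              mul_nonneg (by positivity) (invProd_nonneg _)
            intro x hx
            obtain ⟨D, hD, rfl⟩ := mem_image.1 hx
            obtain ⟨e, he, h1, h2, h3⟩ := (hv' D hD).1.exists_pair (hv' D hD).2.2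
            obtain ⟨-, h4, h5⟩ := (hv' D hD).1.decomp h1 h2 h3
            have := hXle D hD
            simp only [h1, Nat.add_sub_cancel, mem_sigma, mem_range, mem_powersetCard]
            exact ⟨by omega, h4, by rw [h5, (hv' D hD).2.1]⟩
    refine hcover.trans ?_
    rw [Finset.sum_sigma]
    refine le_trans (Finset.sum_le_sum fun e _ => ?_)
      ((summable_pairWeight (κ - 2)).sum_le_tsum (range X) fun e _ => pairWeight_nonneg _ e)
    simp only
    rw [← Finset.mul_sum]
    unfold pairWeight
    refine mul_le_mul_of_nonneg_left ?_ (by positivity)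
    refine (elemSum_le_pow (Icc 1 e) (fun d => (d : ℝ)⁻¹) (fun d _ => by positivity) _).trans ?_
    have := harmonic_le_one_add_log e
    rw [harmonic_eq_sum_Icc] at this
    push_cast at this
    exact pow_le_pow_left₀ (Finset.sum_nonneg fun d _ => by positivity) this _

/-- Record `D ∪ C` as its distinguished pair and the remaining elements. This is injective: the pair
gives `D.sup id`, which cuts the union back into `D` and `C`. -/
theorem sum_sum_numSol_le_of_lt_sup {κ ℓ E n : ℕ} (hE : 1 ≤ E) (u : Finset (Finset ℕ))
    (hu : ∀ D ∈ u, EndsInPair D ∧ D.card = κ ∧ E < D.sup id ∧ D.sup id ≤ n) :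
    ∑ D ∈ u, ∑ C ∈ (Ioc (D.sup id) n).powersetCard ℓ, numSol (D ∪ C) n
      ≤ coeffSum n (∑ c ∈ Icc 1 n, multSeries c) ^ (κ + ℓ - 2) * (n / E) := by
  refine le_trans ?_ (sum_numSol_pair_union_le hE n (κ + ℓ - 2))
  have hpair : ∀ D ∈ u, ∃ e, 1 ≤ e ∧ D.sup id = e + 1 ∧ e ∈ D ∧ e + 1 ∈ D := by
    intro D hD
    refine (hu D hD).1.exists_pair fun h => ?_
    have := (hu D hD).2.2.1
    rw [h] at this
    simp at this
    omega
  set φ : (Σ _ : Finset ℕ, Finset ℕ) → (Σ _ : ℕ, Finset ℕ) := fun x =>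
    ⟨x.1.sup id - 1, (x.1 ∪ x.2) \ {x.1.sup id - 1, x.1.sup id - 1 + 1}⟩ with hφ
  have hsub : ∀ x ∈ u.sigma (fun D => (Ioc (D.sup id) n).powersetCard ℓ),
      ({x.1.sup id - 1, x.1.sup id - 1 + 1} : Finset ℕ) ⊆ x.1 ∪ x.2 := by
    rintro ⟨D, C⟩ hx y hy
    obtain ⟨e, he, h1, h2, h3⟩ := hpair D (mem_sigma.1 hx).1
    simp only [h1, Nat.add_sub_cancel, mem_insert, mem_singleton] at hy
    rcases hy with rfl | rfl
    · exact mem_union_left _ h2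
    · exact mem_union_left _ h3
  have hlow : ∀ x ∈ u.sigma (fun D => (Ioc (D.sup id) n).powersetCard ℓ),
      (x.1 ∪ x.2).filter (· ≤ x.1.sup id) = x.1 ∧
      (x.1 ∪ x.2).filter (fun y => ¬ y ≤ x.1.sup id) = x.2 := by
    rintro ⟨D, C⟩ hx
    have hC : ∀ c ∈ C, D.sup id < c := fun c hc =>
      (Finset.mem_Ioc.1 ((mem_powersetCard.1 (mem_sigma.1 hx).2).1 hc)).1
    have hD : ∀ d ∈ D, d ≤ D.sup id := fun d hd => Finset.le_sup (f := id) hd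
    constructor
    · ext y
      simp only [mem_filter, mem_union]
      constructor
      · rintro ⟨h | h, h'⟩
        · exact h
        · exact absurd h' (not_le.2 (hC y h))
      · exact fun h => ⟨Or.inl h, hD y h⟩
    · ext y
      simp only [mem_filter, mem_union]
      constructor
      · rintro ⟨h | h, h'⟩
        · exact absurd (hD y h) h'
        · exact h
      · exact fun h => ⟨Or.inr h, not_le.2 (hC y h)⟩
  have hinj : Set.InjOn φ (u.sigma (fun D => (Ioc (D.sup id) n).powersetCard ℓ)) := by
    intro x hx y hy h
    simp only [hφ, Sigma.mk.injEq, heq_eq_eq] at h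
    have hsx := hsub x hx
    have hsy := hsub y hy
    have hun : x.1 ∪ x.2 = y.1 ∪ y.2 := by
      rw [← Finset.union_sdiff_of_subset hsx, ← Finset.union_sdiff_of_subset hsy, h.2, h.1]
    obtain ⟨e, he, h1, -, -⟩ := hpair x.1 (mem_sigma.1 hx).1
    obtain ⟨e', he', h1', -, -⟩ := hpair y.1 (mem_sigma.1 hy).1
    have hs : x.1.sup id = y.1.sup id := by omega
    obtain ⟨a1, a2⟩ := hlow x hx
    obtain ⟨b1, b2⟩ := hlow y hy
    rw [hun, hs] at a1 a2
    have c1 := a1.symm.trans b1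
    have c2 := a2.symm.trans b2
    obtain ⟨x1, x2⟩ := x
    obtain ⟨y1, y2⟩ := y
    simp only at c1 c2
    rw [c1, c2]
  rw [Finset.sum_sigma', Finset.sum_sigma']
  calc _ = ∑ y ∈ (u.sigma (fun D => (Ioc (D.sup id) n).powersetCard ℓ)).image φ,
        numSol ({y.1, y.1 + 1} ∪ y.2) n := by
        rw [Finset.sum_image hinj]
        refine Finset.sum_congr rfl fun x hx => ?_
        simp only [hφ]
        rw [Finset.union_sdiff_of_subset (hsub x hx)]
    _ ≤ _ := by
        refine Finset.sum_le_sum_of_subset ?_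
        intro y hy
        obtain ⟨x, hx, rfl⟩ := mem_image.1 hy
        have hsx := hsub x hx
        obtain ⟨D, C⟩ := x
        obtain ⟨hD, hC⟩ := mem_sigma.1 hx
        obtain ⟨e, he, h1, h2, h3⟩ := hpair D hD
        obtain ⟨q1, q2, q3, q4⟩ := hu D hD
        rw [mem_powersetCard] at hC
        simp only [hφ, h1, Nat.add_sub_cancel] at hsx hC q3 q4 ⊢
        rw [mem_sigma, mem_filter, mem_powersetCard, Finset.mem_Icc]
        have hdisj : Disjoint D C := by
          rw [Finset.disjoint_left]
          intro y hy hy'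
          have h5 : y ≤ D.sup id := Finset.le_sup (f := id) hy
          have h6 := (Finset.mem_Ioc.1 (hC.1 hy')).1
          omega
        refine ⟨by simp only; omega, ⟨fun y hy => ?_, ?_⟩, disjoint_sdiff⟩
        · rw [Finset.mem_Icc]
          rcases mem_union.1 (sdiff_subset hy) with h | h
          · have h5 : y ≤ D.sup id := Finset.le_sup (f := id) h
            exact ⟨q1.1 y h, by omega⟩
          · have h6 := Finset.mem_Ioc.1 (hC.1 h)
            omega
        · simp only
          rw [Finset.card_sdiff_of_subset hsx, Finset.card_pair (by omega),
            Finset.card_union_of_disjoint hdisj, q2, hC.2]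

end PartitionPattern

/-! ### Asymptotics of the sum over all extremal sets -/

namespace PartitionPattern

open Finset PowerSeries

theorem eventually_one_add_log_pow_le (j : ℕ) :
    ∀ᶠ n : ℕ in atTop, 1 ≤ Real.log n ∧ (1 + Real.log n) ^ j ≤ n := by
  have h1 : ∀ᶠ x : ℝ in atTop, 1 ≤ Real.log x :=
    Real.tendsto_log_atTop.eventually_ge_atTop 1
  -- The constant `(1 / 2) ^ j` compensates for `1 + log x ≤ 2 * log x`.
  have h2 := (Real.isLittleO_pow_log_id_atTop (n := j)).def (c := (1 / 2) ^ j) (by positivity)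
  have h3 : ∀ᶠ x : ℝ in atTop, 1 ≤ Real.log x ∧ (1 + Real.log x) ^ j ≤ x := by
    filter_upwards [h1, h2, eventually_ge_atTop 0] with x hx1 hx2 hx0
    refine ⟨hx1, ?_⟩
    rw [Real.norm_eq_abs, Real.norm_eq_abs, abs_of_nonneg (by positivity), id,
      abs_of_nonneg hx0] at hx2
    calc (1 + Real.log x) ^ j ≤ (2 * Real.log x) ^ j := by gcongr; linarith
      _ = 2 ^ j * Real.log x ^ j := mul_pow _ _ _
      _ ≤ 2 ^ j * ((1 / 2) ^ j * x) := by gcongr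
      _ = x := by rw [← mul_assoc, ← mul_pow]; norm_num
  exact tendsto_natCast_atTop_atTop.eventually h3

theorem EndsInPair.subset_Icc_iff {D : Finset ℕ} (hD : EndsInPair D) (n : ℕ) :
    D ⊆ Icc 1 n ↔ D.sup id ≤ n := by
  constructor
  · intro h
    exact Finset.sup_le fun d hd => (Finset.mem_Icc.1 (h hd)).2
  · intro h d hd
    exact Finset.mem_Icc.2 ⟨hD.1 d hd, (Finset.le_sup (f := id) hd).trans h⟩

theorem EndsInPair.two_le_card {D : Finset ℕ} (hD : EndsInPair D) (h : 1 < D.sup id) :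
    2 ≤ D.card := by
  obtain ⟨e, -, -, h2, h3⟩ := hD.exists_pair (by rintro rfl; simp at h)
  have : ({e, e + 1} : Finset ℕ) ⊆ D := by
    intro x hx
    simp only [mem_insert, mem_singleton] at hx
    rcases hx with rfl | rfl <;> assumption
  simpa using card_le_card this

-- A Markov-type bound: every omitted set has maximum at least `E`, so inserting the factor `√(D.sup
-- id) / √E ≥ 1` reduces the tail to the weighted sum already bounded.
open Classical in
theorem hasSum_sub_le {𝒟 : Set (Finset ℕ)} {κ : ℕ}
    (h𝒟 : ∀ D ∈ 𝒟, EndsInPair D ∧ D.card = κ) {S : ℝ} (hS : HasSum (𝒟.indicator invProd) S)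
    {E : ℕ} (hE : 1 ≤ E) :
    0 ≤ S - ∑ D ∈ (Icc 1 E).powerset.filter (· ∈ 𝒟), invProd D ∧
      S - ∑ D ∈ (Icc 1 E).powerset.filter (· ∈ 𝒟), invProd D
        ≤ (1 + ∑' e, pairWeight (κ - 2) e) / Real.sqrt E := by
  set u := (Icc 1 E).powerset.filter (· ∈ 𝒟) with hu
  have hnn : ∀ D, 0 ≤ 𝒟.indicator invProd D := fun D =>
    Set.indicator_nonneg (fun D _ => invProd_nonneg D) D
  have hind : ∑ D ∈ u, invProd D = ∑ D ∈ u, 𝒟.indicator invProd D :=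
    Finset.sum_congr rfl fun D hD => by rw [Set.indicator_of_mem (mem_filter.1 hD).2]
  constructor
  · rw [hind, sub_nonneg]
    exact sum_le_hasSum u (fun D _ => hnn D) hS
  · rw [sub_le_iff_le_add]
    refine hasSum_le_of_sum_le hS fun t => ?_
    have hEp : 0 < Real.sqrt E := Real.sqrt_pos.2 (by exact_mod_cast hE)
    rw [← Finset.sum_filter_add_sum_filter_not t (· ∈ u), add_comm]
    refine add_le_add ?_ ?_
    · set v := (t.filter (· ∉ u)).filter (· ∈ 𝒟) with hv
      have h1 : ∑ D ∈ t.filter (· ∉ u), 𝒟.indicator invProd D = ∑ D ∈ v, invProd D := by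
        rw [hv, Finset.sum_filter (s := t.filter (· ∉ u))]
        exact Finset.sum_congr rfl fun D _ => by rw [Set.indicator_apply]
      rw [h1]
      have h2 := sum_sqrt_mul_invProd_le κ v fun D hD => h𝒟 D (mem_filter.1 hD).2
      rw [le_div_iff₀ hEp, Finset.sum_mul]
      refine le_trans (Finset.sum_le_sum fun D hD => ?_) h2
      rw [mul_comm]
      refine mul_le_mul_of_nonneg_right (Real.sqrt_le_sqrt ?_) (invProd_nonneg D)
      have hD𝒟 := (mem_filter.1 hD).2
      have hDu := (mem_filter.1 (mem_filter.1 hD).1).2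
      have : ¬ D ⊆ Icc 1 E := fun h => hDu (mem_filter.2 ⟨mem_powerset.2 h, hD𝒟⟩)
      rw [(h𝒟 D hD𝒟).1.subset_Icc_iff] at this
      exact_mod_cast (not_le.1 this).le
    · rw [hind]
      refine Finset.sum_le_sum_of_subset_of_nonneg (fun D hD => (mem_filter.1 hD).2)
        fun D _ _ => hnn D

-- The sum is split at a polylogarithmic cutoff `E`: below it the individual asymptotics apply
-- (`part1`), the truncated series is compared with `S` (`part2`), and above it the pair bound
-- suffices (`part3`).
open Classical in
theorem exists_abs_sum_sum_numSol_sub_le {𝒟 : Set (Finset ℕ)} {κ : ℕ} (hκ : 1 ≤ κ) (ℓ : ℕ)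
    (h𝒟 : ∀ D ∈ 𝒟, EndsInPair D ∧ D.card = κ) {S : ℝ} (hS : HasSum (𝒟.indicator invProd) S) :
    ∃ K : ℝ, ∀ᶠ n : ℕ in atTop,
      |∑ D ∈ (Icc 1 n).powerset.filter (· ∈ 𝒟), ∑ C ∈ (Ioc (D.sup id) n).powersetCard ℓ,
          (numSol (D ∪ C) n : ℝ)
        - (n : ℝ) ^ (κ + ℓ - 1) * Real.log n ^ ℓ
          / ((κ + ℓ - 1).factorial * ℓ.factorial) * S|
      ≤ K * ((n : ℝ) ^ (κ + ℓ - 1) * (1 + Real.log n) ^ ℓ / (1 + Real.log n)) := by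
  set W := 1 + ∑' e, pairWeight (κ - 2) e with hW
  have hW0 : 0 ≤ W := by
    have : 0 ≤ ∑' e, pairWeight (κ - 2) e := tsum_nonneg (pairWeight_nonneg _)
    linarith
  set k := κ + ℓ with hk
  refine ⟨κ * 2 ^ κ + 6 * ℓ ^ 2 * W + W + 1, ?_⟩
  filter_upwards [eventually_one_add_log_pow_le (2 * k * κ + 1),
    eventually_one_add_log_pow_le (2 * k + 1), eventually_ge_atTop 1] with n ⟨hL1, hn1⟩ ⟨_, hn2⟩ hn
  have hn0 : (0 : ℝ) < n := by exact_mod_cast hn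
  set L := Real.log n with hL
  set Y := 1 + L with hY
  have hY2 : 2 ≤ Y := by linarith
  have hY1 : 1 ≤ Y := by linarith
  have hY0 : 0 < Y := by linarith
  -- Large enough that `√E ≥ Y` and that `n / E` absorbs the `Y ^ (k - 2)` of the upper bound; small
  -- enough that the at most `E ^ κ` sets below it stay negligible against `n / Y`.
  set E := ⌈Y ^ (2 * k)⌉₊ with hE
  have hYk : 1 ≤ Y ^ (2 * k) := one_le_pow₀ hY1
  have hE1 : Y ^ (2 * k) ≤ E := Nat.le_ceil _
  have hE2 : (E : ℝ) ≤ 2 * Y ^ (2 * k) := by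
    have := (Nat.ceil_lt_add_one (by positivity : 0 ≤ Y ^ (2 * k))).le
    linarith
  have hEone : 1 ≤ E := by
    have : (1 : ℝ) ≤ E := hYk.trans hE1
    exact_mod_cast this
  have hEn : E ≤ n := by
    have : (E : ℝ) ≤ n := by
      refine hE2.trans (le_trans ?_ hn2)
      rw [pow_succ]
      nlinarith
    exact_mod_cast this
  set u := (Icc 1 n).powerset.filter (· ∈ 𝒟) with hu
  set v := (Icc 1 E).powerset.filter (· ∈ 𝒟) with hv
  set c := (n : ℝ) ^ (k - 1) * L ^ ℓ / ((k - 1).factorial * ℓ.factorial) with hc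
  have hc0 : 0 ≤ c := by positivity
  set Z := (n : ℝ) ^ (k - 1) * Y ^ ℓ with hZ
  have hZ0 : 0 ≤ Z := by positivity
  have hcZ : c ≤ Z := by
    have hf1 : (1 : ℝ) ≤ (k - 1).factorial := by
      exact_mod_cast Nat.succ_le_of_lt (Nat.factorial_pos _)
    have hf2 : (1 : ℝ) ≤ ℓ.factorial := by exact_mod_cast Nat.succ_le_of_lt (Nat.factorial_pos _)
    refine (div_le_self (by positivity) (by nlinarith)).trans ?_
    have : L ≤ Y := by linarith
    rw [hZ]
    gcongr
  set F : Finset ℕ → ℝ := fun D =>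
    ∑ C ∈ (Ioc (D.sup id) n).powersetCard ℓ, (numSol (D ∪ C) n : ℝ) with hF
  have hvu : v ⊆ u := by
    intro D hD
    rw [hv, mem_filter, mem_powerset] at hD
    rw [hu, mem_filter, mem_powerset]
    exact ⟨hD.1.trans (Finset.Icc_subset_Icc_right hEn), hD.2⟩
  have hsplit : ∑ D ∈ u, F D = ∑ D ∈ u \ v, F D + ∑ D ∈ v, F D :=
    (Finset.sum_sdiff hvu).symm
  have hvD : ∀ D ∈ v, EndsInPair D ∧ D.card = κ ∧ D.sup id ≤ E := by
    intro D hD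
    rw [hv, mem_filter, mem_powerset] at hD
    have h := h𝒟 D hD.2
    exact ⟨h.1, h.2, (h.1.subset_Icc_iff E).1 hD.1⟩
  have hwD : ∀ D ∈ u \ v, EndsInPair D ∧ D.card = κ ∧ E < D.sup id ∧ D.sup id ≤ n := by
    intro D hD
    rw [Finset.mem_sdiff, hu, hv, mem_filter, mem_filter, mem_powerset, mem_powerset] at hD
    have h := h𝒟 D hD.1.2
    refine ⟨h.1, h.2, ?_, (h.1.subset_Icc_iff n).1 hD.1.1⟩
    by_contra hcon
    exact hD.2 ⟨(h.1.subset_Icc_iff E).2 (not_lt.1 hcon), hD.1.2⟩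
  have part1 : |∑ D ∈ v, F D - c * ∑ D ∈ v, invProd D|
      ≤ (κ * 2 ^ κ + 6 * ℓ ^ 2 * W) * (Z / Y) := by
    rw [Finset.mul_sum, ← Finset.sum_sub_distrib]
    refine (Finset.abs_sum_le_sum_abs _ _).trans ?_
    have hterm : ∀ D ∈ v, |F D - c * invProd D|
        ≤ Z * (κ / n) + Z * (6 * ℓ ^ 2 / Y) * (Real.sqrt (D.sup id : ℕ) * invProd D) := by
      intro D hD
      obtain ⟨h1, h2, h3⟩ := hvD D hD
      have := abs_sum_numSol_sub_le h1 (h3.trans hEn) ℓ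
      rw [h2, ← hk, ← hL, ← hY, ← hc, ← hZ] at this
      refine this.trans (le_of_eq ?_)
      unfold invProd
      ring
    refine (Finset.sum_le_sum hterm).trans ?_
    rw [Finset.sum_add_distrib, Finset.sum_const, nsmul_eq_mul, ← Finset.mul_sum]
    have h1 := sum_sqrt_mul_invProd_le κ v fun D hD => ⟨(hvD D hD).1, (hvD D hD).2.1⟩
    have h2 : (v.card : ℝ) ≤ (2 * Y ^ (2 * k)) ^ κ := by
      have h3 : v.card ≤ E ^ κ := by
        have : v ⊆ (Icc 1 E).powersetCard κ := by
          intro D hD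
          have h4 := hvD D hD
          rw [mem_powersetCard]
          exact ⟨(h4.1.subset_Icc_iff E).2 h4.2.2, h4.2.1⟩
        refine (card_le_card this).trans ?_
        rw [card_powersetCard, Nat.card_Icc, Nat.add_sub_cancel]
        exact Nat.choose_le_pow E κ
      calc (v.card : ℝ) ≤ (E : ℝ) ^ κ := by exact_mod_cast h3
        _ ≤ _ := by gcongr
    have h4 : (v.card : ℝ) / n ≤ 2 ^ κ / Y := by
      rw [div_le_div_iff₀ hn0 hY0]
      calc (v.card : ℝ) * Y ≤ (2 * Y ^ (2 * k)) ^ κ * Y := by gcongr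
        _ = 2 ^ κ * Y ^ (2 * k * κ + 1) := by rw [mul_pow, ← pow_mul, pow_succ]; ring
        _ ≤ 2 ^ κ * n := by gcongr
    calc _ ≤ Z * κ * ((v.card : ℝ) / n) + Z * (6 * ℓ ^ 2 / Y) * W := by
          exact add_le_add (le_of_eq (by ring)) (mul_le_mul_of_nonneg_left h1 (by positivity))
      _ ≤ Z * κ * (2 ^ κ / Y) + Z * (6 * ℓ ^ 2 / Y) * W := by gcongr
      _ = _ := by ring
  have part2 : |c * ∑ D ∈ v, invProd D - c * S| ≤ W * (Z / Y) := by
    obtain ⟨h1, h2⟩ := hasSum_sub_le h𝒟 hS hEone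
    rw [← hv] at h1 h2
    rw [← mul_sub, abs_mul, abs_of_nonneg hc0, abs_sub_comm, abs_of_nonneg h1]
    have h3 : Y ≤ Real.sqrt E := by
      apply Real.le_sqrt_of_sq_le
      refine le_trans ?_ hE1
      exact pow_le_pow_right₀ hY1 (by omega)
    calc _ ≤ Z * (W / Real.sqrt E) := mul_le_mul hcZ h2 h1 hZ0
      _ ≤ Z * (W / Y) := by gcongr
      _ = _ := by ring
  have part3 : |∑ D ∈ u \ v, F D| ≤ Z / Y := by
    rw [abs_of_nonneg (Finset.sum_nonneg fun D _ => Finset.sum_nonneg fun C _ => Nat.cast_nonneg _)]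
    rcases Finset.eq_empty_or_nonempty (u \ v) with he | ⟨D, hD⟩
    · rw [he]
      simp only [Finset.sum_empty]
      positivity
    have hκ2 : 2 ≤ κ := by
      obtain ⟨h1, h2, h3, -⟩ := hwD D hD
      rw [← h2]
      exact h1.two_le_card (by omega)
    have h1 := sum_sum_numSol_le_of_lt_sup (ℓ := ℓ) hEone (u \ v) hwD
    have h2 : ∑ D ∈ u \ v, F D
        ≤ (coeffSum n (∑ c ∈ Icc 1 n, multSeries c) : ℝ) ^ (k - 2) * (n / E : ℕ) := by
      have h3 : ∑ D ∈ u \ v, F D = ((∑ D ∈ u \ v,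
          ∑ C ∈ (Ioc (D.sup id) n).powersetCard ℓ, numSol (D ∪ C) n : ℕ) : ℝ) := by
        simp only [hF]
        push_cast
        rfl
      rw [h3]
      refine (Nat.cast_le.2 h1).trans (le_of_eq ?_)
      rw [Nat.cast_mul, Nat.cast_pow]
    have h3 := coeffSum_sum_multSeries_le n
    have h4 : ((n / E : ℕ) : ℝ) ≤ n / Y ^ (2 * k) := by
      refine Nat.cast_div_le.trans ?_
      gcongr
    have h5 : (n : ℝ) ^ (k - 1) = n ^ (k - 2) * n := by
      rw [← pow_succ]; congr 1; omega
    calc _ ≤ _ := h2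
      _ ≤ (n * Y) ^ (k - 2) * (n / Y ^ (2 * k)) := by gcongr
      _ = (n : ℝ) ^ (k - 1) * (Y ^ (k - 2) / Y ^ (2 * k)) := by rw [h5, mul_pow]; ring
      _ ≤ (n : ℝ) ^ (k - 1) * (Y ^ ℓ / Y) := by
          gcongr (n : ℝ) ^ (k - 1) * ?_
          rw [div_le_div_iff₀ (by positivity) hY0, ← pow_succ, ← pow_add]
          exact pow_le_pow_right₀ hY1 (by omega)
      _ = Z / Y := by rw [hZ]; ring
  calc _ = |∑ D ∈ u \ v, F D + (∑ D ∈ v, F D - c * ∑ D ∈ v, invProd D)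
        + (c * ∑ D ∈ v, invProd D - c * S)| := by
        rw [show ∑ D ∈ u, ∑ C ∈ (Ioc (D.sup id) n).powersetCard ℓ, (numSol (D ∪ C) n : ℝ)
          = ∑ D ∈ u, F D from rfl, hsplit]
        congr 1
        ring
    _ ≤ _ := abs_add_three _ _ _
    _ ≤ Z / Y + (κ * 2 ^ κ + 6 * ℓ ^ 2 * W) * (Z / Y) + W * (Z / Y) :=
        add_le_add (add_le_add part3 part1) part2
    _ = _ := by ring

end PartitionPattern

/-! ### Extremal sets and the exact value of their reciprocal sum -/

namespace PartitionPattern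

open Finset

/-- The extremal sets above level `c`: blocks of consecutive integers, of sizes prescribed by the
gaps `γ j, …, γ 0`, with freely chosen starting points. -/
def Full (γ : ℕ → ℕ) : ℕ → ℕ → Set (Finset ℕ)
  | 0, c => {Icc (c + 1) (c + (γ 0 - 1))}
  | j + 1, c => {D | ∃ b, c + γ (j + 1) ≤ b ∧ ∃ D' ∈ Full γ j b,
      D = Icc (c + 1) (c + (γ (j + 1) - 1)) ∪ insert b D'}

theorem Full.lt_of_mem {γ : ℕ → ℕ} {j c : ℕ} (hγ : ∀ i, 1 ≤ γ i) {D : Finset ℕ}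
    (hD : D ∈ Full γ j c) : ∀ d ∈ D, c < d := by
  induction j generalizing c D with
  | zero =>
    rw [Full, Set.mem_singleton_iff] at hD
    subst hD
    intro d hd
    rw [Finset.mem_Icc] at hd
    omega
  | succ j ih =>
    obtain ⟨b, hb, D', hD', rfl⟩ := hD
    intro d hd
    have := hγ (j + 1)
    rw [mem_union, mem_insert, Finset.mem_Icc] at hd
    rcases hd with h | h | h
    · omega
    · omega
    · have := ih hD' d h
      omega

theorem Full.disjoint {γ : ℕ → ℕ} {j b c g : ℕ} (hγ : ∀ i, 1 ≤ γ i) {D : Finset ℕ} (hg : 1 ≤ g)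
    (hb : c + g ≤ b) (hD : D ∈ Full γ j b) :
    b ∉ D ∧ Disjoint (Icc (c + 1) (c + (g - 1))) (insert b D) := by
  have h := Full.lt_of_mem hγ hD
  refine ⟨fun hb => (h b hb).false, ?_⟩
  rw [Finset.disjoint_left]
  intro x hx hx'
  rw [Finset.mem_Icc] at hx
  rcases mem_insert.1 hx' with h1 | h1
  · omega
  · have := h x h1
    omega

theorem Full.card_add_one {γ : ℕ → ℕ} {j c : ℕ} (hγ : ∀ i, 1 ≤ γ i) {D : Finset ℕ}
    (hD : D ∈ Full γ j c) : D.card + 1 = ∑ i ∈ range (j + 1), γ i := by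
  induction j generalizing c D with
  | zero =>
    rw [Full, Set.mem_singleton_iff] at hD
    subst hD
    have := hγ 0
    simp
    omega
  | succ j ih =>
    obtain ⟨b, hb, D', hD', rfl⟩ := hD
    have h1 := hγ (j + 1)
    obtain ⟨h2, h3⟩ := Full.disjoint hγ h1 hb hD'
    rw [card_union_of_disjoint h3, card_insert_of_notMem h2, Finset.sum_range_succ, ← ih hD',
      Nat.card_Icc]
    omega

/-- The top block has `γ 0 - 1 ≥ 1` elements immediately above the last starting point, which itself
belongs to the set or is the base level `c`. Hence the consecutive pair at the top. -/
theorem Full.sup_mem {γ : ℕ → ℕ} {j c : ℕ} (hγ0 : 2 ≤ γ 0) (hγ : ∀ i, 1 ≤ γ i) {D : Finset ℕ}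
    (hD : D ∈ Full γ j c) : c < D.sup id ∧ D.sup id ∈ D ∧ D.sup id - 1 ∈ insert c D := by
  induction j generalizing c D with
  | zero =>
    rw [Full, Set.mem_singleton_iff] at hD
    subst hD
    have hs : (Icc (c + 1) (c + (γ 0 - 1))).sup id = c + (γ 0 - 1) := by
      apply le_antisymm
      · exact Finset.sup_le fun d hd => (Finset.mem_Icc.1 hd).2
      · exact Finset.le_sup (f := id) (Finset.mem_Icc.2 ⟨by omega, le_rfl⟩)
    rw [hs, mem_insert, Finset.mem_Icc, Finset.mem_Icc]
    omega
  | succ j ih =>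
    obtain ⟨b, hb, D', hD', rfl⟩ := hD
    obtain ⟨h1, h2, h3⟩ := ih hD'
    have hg := hγ (j + 1)
    have hs : (Icc (c + 1) (c + (γ (j + 1) - 1)) ∪ insert b D').sup id = D'.sup id := by
      apply le_antisymm
      · refine Finset.sup_le fun d hd => ?_
        rw [mem_union, mem_insert, Finset.mem_Icc] at hd
        rcases hd with h | h | h
        · simp only [id]; omega
        · simp only [id]; omega
        · exact Finset.le_sup (f := id) h
      · exact Finset.sup_mono ((subset_insert b D').trans subset_union_right)
    rw [hs]
    refine ⟨by omega, mem_union_right _ (mem_insert_of_mem h2), ?_⟩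
    exact mem_insert_of_mem (mem_union_right _ h3)

theorem Full.endsInPair {γ : ℕ → ℕ} {j : ℕ} (hγ0 : 2 ≤ γ 0) (hγ : ∀ i, 1 ≤ γ i) {D : Finset ℕ}
    (hD : D ∈ Full γ j 0) : EndsInPair D := by
  have hpos := Full.lt_of_mem hγ hD
  obtain ⟨h1, h2, h3⟩ := Full.sup_mem hγ0 hγ hD
  refine ⟨fun d hd => hpos d hd, ?_⟩
  rcases Nat.lt_or_ge (D.sup id) 2 with h | h
  · left
    ext x
    rw [mem_singleton]
    constructor
    · intro hx
      have h4 : x ≤ D.sup id := Finset.le_sup (f := id) hx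
      have := hpos x hx
      omega
    · rintro rfl
      have : D.sup id = 1 := by omega
      rwa [this] at h2
  · right
    refine ⟨h, ?_, h2⟩
    rcases mem_insert.1 h3 with h4 | h4
    · omega
    · exact h4

/-- Telescoping: the reciprocal of a product of `w + 1` consecutive integers is `1 / w` times the
difference of the reciprocals of its first `w` and its last `w` factors. -/
theorem hasSum_inv_ascFactorial {a w : ℕ} (ha : 1 ≤ a) (hw : 1 ≤ w) :
    HasSum (fun i : ℕ => ((((a + i).ascFactorial (w + 1) : ℕ) : ℝ))⁻¹)
      ((w : ℝ)⁻¹ * ((a.ascFactorial w : ℕ) : ℝ)⁻¹) := by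
  have hpos : ∀ b v : ℕ, 1 ≤ b → (0 : ℝ) < ((b.ascFactorial v : ℕ) : ℝ) := by
    intro b v hb
    obtain ⟨b, rfl⟩ := Nat.exists_eq_add_of_le' hb
    exact_mod_cast Nat.ascFactorial_pos b v
  have hw0 : (0 : ℝ) < w := by exact_mod_cast hw
  set g : ℕ → ℝ := fun i => (w : ℝ)⁻¹ * (((a + i).ascFactorial w : ℕ) : ℝ)⁻¹ with hg
  have hterm : ∀ i : ℕ, ((((a + i).ascFactorial (w + 1) : ℕ) : ℝ))⁻¹ = g i - g (i + 1) := by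
    intro i
    have e1 : (((a + i).ascFactorial (w + 1) : ℕ) : ℝ)
        = ((a + i : ℕ) + w : ℝ) * (((a + i).ascFactorial w : ℕ) : ℝ) := by
      rw [Nat.ascFactorial_succ]; push_cast; ring
    have e2 : ((a + i : ℕ) : ℝ) * (((a + (i + 1)).ascFactorial w : ℕ) : ℝ)
        = ((a + i : ℕ) + w : ℝ) * (((a + i).ascFactorial w : ℕ) : ℝ) := by
      have := Nat.succ_ascFactorial (a + i) w
      rw [← add_assoc]
      exact_mod_cast this
    have h1 := hpos (a + i) w (by omega)
    have h2 := hpos (a + (i + 1)) w (by omega)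
    have h3 : (0 : ℝ) < ((a + i : ℕ) : ℝ) := by exact_mod_cast (by omega : 0 < a + i)
    rw [e1, hg]
    simp only
    have e3 : (((a + (i + 1)).ascFactorial w : ℕ) : ℝ)
        = ((a + i : ℕ) + w : ℝ) * (((a + i).ascFactorial w : ℕ) : ℝ) / ((a + i : ℕ) : ℝ) := by
      rw [← e2]; field_simp
    rw [e3]
    field_simp
    ring
  rw [hasSum_iff_tendsto_nat_of_nonneg (fun i => by positivity)]
  have hsum : ∀ N, ∑ i ∈ range N, ((((a + i).ascFactorial (w + 1) : ℕ) : ℝ))⁻¹ = g 0 - g N := by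
    intro N
    rw [← Finset.sum_range_sub']
    exact Finset.sum_congr rfl fun i _ => hterm i
  simp_rw [hsum]
  have hlim : Tendsto g atTop (nhds 0) := by
    have h0 : Tendsto (fun N : ℕ => (w : ℝ)⁻¹ * ((N : ℝ))⁻¹) atTop (nhds 0) := by
      simpa using (tendsto_inv_atTop_nhds_zero_nat (𝕜 := ℝ)).const_mul (w : ℝ)⁻¹
    refine squeeze_zero' (Eventually.of_forall fun N => by positivity) ?_ h0
    filter_upwards [eventually_ge_atTop 1] with N hN
    have hN0 : (0 : ℝ) < N := by exact_mod_cast hN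
    rw [hg]
    simp only
    gcongr
    obtain ⟨v, rfl⟩ := Nat.exists_eq_add_of_le' hw
    rw [Nat.ascFactorial_succ]
    have h1 : 1 ≤ (a + N).ascFactorial v := by
      have := hpos (a + N) v (by omega)
      exact_mod_cast this
    nlinarith
  have := hlim.const_sub (g 0)
  simpa [hg] using this

theorem invProd_Icc (c m : ℕ) :
    invProd (Icc (c + 1) (c + m)) = (((c + 1).ascFactorial m : ℕ) : ℝ)⁻¹ := by
  unfold invProd
  rw [Finset.prod_inv_distrib, ← Nat.cast_prod]
  congr 2
  induction m with
  | zero => simp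
  | succ m ih =>
    rw [← add_assoc, Finset.prod_Icc_succ_top (by omega), ih, Nat.ascFactorial_succ]
    ring

theorem invProd_union {s t : Finset ℕ} (h : Disjoint s t) :
    invProd (s ∪ t) = invProd s * invProd t := Finset.prod_union h

theorem invProd_insert {s : Finset ℕ} {b : ℕ} (h : b ∉ s) :
    invProd (insert b s) = (b : ℝ)⁻¹ * invProd s := Finset.prod_insert h

/-- The free choices in `Full γ (j + 1) c`: a starting point and a set above it. -/
noncomputable def Full.succEquiv (γ : ℕ → ℕ) (hγ : ∀ i, 1 ≤ γ i) (j c : ℕ) :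
    (Σ i : ℕ, Full γ j (c + γ (j + 1) + i)) ≃ Full γ (j + 1) c :=
  Equiv.ofBijective
    (fun x => ⟨Icc (c + 1) (c + (γ (j + 1) - 1)) ∪ insert (c + γ (j + 1) + x.1) x.2.1,
      ⟨c + γ (j + 1) + x.1, by omega, x.2.1, x.2.2, rfl⟩⟩) (by
    have hg := hγ (j + 1)
    constructor
    · rintro ⟨i, D, hD⟩ ⟨i', D', hD'⟩ h
      replace h := congrArg Subtype.val h
      simp only at h
      have l1 := Full.lt_of_mem hγ hD
      have l2 := Full.lt_of_mem hγ hD'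
      have key : ∀ x, c + γ (j + 1) ≤ x →
          ((x = c + γ (j + 1) + i ∨ x ∈ D) ↔ (x = c + γ (j + 1) + i' ∨ x ∈ D')) := by
        intro x hx
        have := Finset.ext_iff.1 h x
        simp only [mem_union, mem_insert, Finset.mem_Icc] at this
        constructor
        · intro h1
          rcases this.1 (Or.inr h1) with h2 | h2
          · omega
          · exact h2
        · intro h1
          rcases this.2 (Or.inr h1) with h2 | h2
          · omega
          · exact h2
      have hi : i = i' := by
        have k1 := (key (c + γ (j + 1) + i) (by omega)).1 (Or.inl rfl)
        have k2 := (key (c + γ (j + 1) + i') (by omega)).2 (Or.inl rfl)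
        rcases k1 with k1 | k1
        · omega
        · have := l2 _ k1
          rcases k2 with k2 | k2
          · omega
          · have := l1 _ k2
            omega
      subst hi
      have hDD : D = D' := by
        ext x
        constructor
        · intro hx
          have := l1 x hx
          rcases (key x (by omega)).1 (Or.inr hx) with h1 | h1
          · omega
          · exact h1
        · intro hx
          have := l2 x hx
          rcases (key x (by omega)).2 (Or.inr hx) with h1 | h1
          · omega
          · exact h1
      subst hDD
      rfl
    · rintro ⟨D, b, hb, D', hD', rfl⟩
      obtain ⟨i, rfl⟩ := Nat.exists_eq_add_of_le hb
      exact ⟨⟨i, D', hD'⟩, rfl⟩)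

/-- The excess `∑_{i ≤ j} (γ i - 1)`. -/
def excess (γ : ℕ → ℕ) (j : ℕ) : ℕ := ∑ i ∈ range (j + 1), (γ i - 1)

/-- Induction on the number of blocks, with the base level `c` free. Summing over the starting point
`b` of the upper part telescopes and yields the factor `1 / excess γ j`; the lowest block then
extends the rising factorial. Working in `ENNReal` allows iterated sums before summability is known.
-/
theorem tsum_invProd_full {γ : ℕ → ℕ} (hγ0 : 2 ≤ γ 0) (hγ : ∀ i, 1 ≤ γ i) (j c : ℕ) :
    ∑' D : Full γ j c, ENNReal.ofReal (invProd D.1)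
      = ENNReal.ofReal ((∏ i ∈ range j, (excess γ i : ℝ)⁻¹)
        * (((c + 1).ascFactorial (excess γ j) : ℕ) : ℝ)⁻¹) := by
  induction j generalizing c with
  | zero =>
    have : ∀ D : Full γ 0 c, ENNReal.ofReal (invProd D.1)
        = ENNReal.ofReal (((c + 1).ascFactorial (γ 0 - 1) : ℕ) : ℝ)⁻¹ := by
      rintro ⟨D, hD⟩
      rw [Full, Set.mem_singleton_iff] at hD
      subst hD
      rw [invProd_Icc]
    simp_rw [this]
    rw [Full, tsum_singleton (Icc (c + 1) (c + (γ 0 - 1)))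
      (fun _ => ENNReal.ofReal (((c + 1).ascFactorial (γ 0 - 1) : ℕ) : ℝ)⁻¹)]
    simp [excess]
  | succ j ih =>
    have hg := hγ (j + 1)
    set A := ∏ i ∈ range j, (excess γ i : ℝ)⁻¹ with hA
    set a := c + γ (j + 1) with ha
    set w := excess γ j with hw
    have hA0 : 0 ≤ A := Finset.prod_nonneg fun i _ => by positivity
    have hw1 : 1 ≤ w := by
      have : γ 0 - 1 ≤ w :=
        Finset.single_le_sum (f := fun i => γ i - 1) (fun i _ => Nat.zero_le _)
          (Finset.mem_range.2 (Nat.succ_pos j))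
      omega
    set B := (((c + 1).ascFactorial (γ (j + 1) - 1) : ℕ) : ℝ)⁻¹ with hB
    have hB0 : 0 ≤ B := by positivity
    rw [← (Full.succEquiv γ hγ j c).tsum_eq (fun D => ENNReal.ofReal (invProd D.1)),
      ENNReal.tsum_sigma']
    have hinner : ∀ i : ℕ, ∑' D : Full γ j (a + i),
        ENNReal.ofReal (invProd (Full.succEquiv γ hγ j c ⟨i, D⟩).1)
        = ENNReal.ofReal (B * A * ((((a + i).ascFactorial (w + 1) : ℕ) : ℝ))⁻¹) := by
      intro i
      have h1 : ∀ D : Full γ j (a + i),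
          ENNReal.ofReal (invProd (Full.succEquiv γ hγ j c ⟨i, D⟩).1)
          = ENNReal.ofReal (B * ((a + i : ℕ) : ℝ)⁻¹) * ENNReal.ofReal (invProd D.1) := by
        rintro ⟨D, hD⟩
        obtain ⟨h2, h3⟩ := Full.disjoint hγ hg (b := a + i) (c := c) (by omega) hD
        rw [← ENNReal.ofReal_mul (by positivity)]
        congr 1
        change invProd (Icc (c + 1) (c + (γ (j + 1) - 1)) ∪ insert (a + i) D) = _
        rw [invProd_union h3, invProd_insert h2, invProd_Icc, mul_assoc]
      simp_rw [h1]
      rw [ENNReal.tsum_mul_left, ih, ← ENNReal.ofReal_mul (by positivity)]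
      congr 1
      have e2 : (((a + i).ascFactorial (w + 1) : ℕ) : ℝ)
          = ((a + i : ℕ) : ℝ) * (((a + i + 1).ascFactorial w : ℕ) : ℝ) := by
        have := Nat.succ_ascFactorial (a + i) w
        rw [Nat.ascFactorial_succ, ← this]
        push_cast
        ring
      rw [e2, mul_inv]
      ring
    rw [tsum_congr hinner]
    have hs := (hasSum_inv_ascFactorial (a := a) (by omega) hw1).mul_left (B * A)
    rw [← ENNReal.ofReal_tsum_of_nonneg (fun i => by positivity) hs.summable, hs.tsum_eq]
    congr 1
    have e3 : (((c + 1).ascFactorial (excess γ (j + 1)) : ℕ) : ℝ)⁻¹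
        = B * ((a.ascFactorial w : ℕ) : ℝ)⁻¹ := by
      have h4 : excess γ (j + 1) = (γ (j + 1) - 1) + w := by
        rw [excess, Finset.sum_range_succ, add_comm]
        rfl
      have h5 : c + 1 + (γ (j + 1) - 1) = a := by omega
      rw [h4, ← Nat.ascFactorial_mul_ascFactorial, h5, Nat.cast_mul, mul_inv]
    rw [e3, Finset.prod_range_succ]
    ring

theorem hasSum_invProd_full {γ : ℕ → ℕ} (hγ0 : 2 ≤ γ 0) (hγ : ∀ i, 1 ≤ γ i) (j : ℕ) :
    HasSum ((Full γ j 0).indicator invProd)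
      ((∏ i ∈ range j, (excess γ i : ℝ)⁻¹) * ((excess γ j).factorial : ℝ)⁻¹) := by
  have h := tsum_invProd_full hγ0 hγ j 0
  rw [← hasSum_subtype_iff_indicator]
  have h1 := ENNReal.hasSum_toReal (f := fun D : Full γ j 0 => ENNReal.ofReal (invProd D.1))
    (by rw [h]; exact ENNReal.ofReal_ne_top)
  have h2 : (fun D : Full γ j 0 => (ENNReal.ofReal (invProd D.1)).toReal)
      = invProd ∘ Subtype.val := by
    ext D
    exact ENNReal.toReal_ofReal (invProd_nonneg _)
  have hA0 : 0 ≤ ∏ i ∈ range j, (excess γ i : ℝ)⁻¹ := Finset.prod_nonneg fun i _ => by positivity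
  rw [← ENNReal.tsum_toReal_eq (fun D => ENNReal.ofReal_ne_top), h, h2,
    ENNReal.toReal_ofReal (by positivity), zero_add, Nat.one_ascFactorial] at h1
  exact h1

end PartitionPattern

/-! ### Chain-free sets: maximal size and structure -/

namespace PartitionPattern

open Finset

/-- `D` contains a chain above `c` with successive gaps `γ j, …, γ 0`, followed by `ℓ` further
elements. -/
def HasChain (γ : ℕ → ℕ) (ℓ : ℕ) (D : Finset ℕ) : ℕ → ℕ → Prop
  | 0, c => ℓ < (D.filter (c + γ 0 ≤ ·)).card
  | j + 1, c => ∃ b ∈ D, c + γ (j + 1) ≤ b ∧ HasChain γ ℓ D j b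

theorem HasChain.anti {γ : ℕ → ℕ} {ℓ : ℕ} {D : Finset ℕ} {j c c' : ℕ} (h : c ≤ c')
    (hc : HasChain γ ℓ D j c') : HasChain γ ℓ D j c := by
  cases j with
  | zero =>
    refine lt_of_lt_of_le hc (card_le_card fun x hx => ?_)
    rw [mem_filter] at hx ⊢
    exact ⟨hx.1, by omega⟩
  | succ j =>
    obtain ⟨b, hb, h1, h2⟩ := hc
    exact ⟨b, hb, by omega, h2⟩

/-- Greedy search: let `b` be the least element of `D` at distance at least `γ (j + 1)` above `c`.
At most `γ (j + 1) - 1` elements precede it, and no shorter chain starts at `b`. Equality forces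
every skipped interval to be full. -/
theorem card_filter_lt_of_not_hasChain {γ : ℕ → ℕ} (hγ0 : 2 ≤ γ 0) (hγ : ∀ i, 1 ≤ γ i) {ℓ : ℕ}
    {D : Finset ℕ} {j c : ℕ} (h : ¬ HasChain γ ℓ D j c) :
    (D.filter (c < ·)).card + 1 ≤ ∑ i ∈ range (j + 1), γ i + ℓ ∧
      ((D.filter (c < ·)).card + 1 = ∑ i ∈ range (j + 1), γ i + ℓ →
        ∃ D' ∈ Full γ j c, ∃ C : Finset ℕ, C.card = ℓ ∧ (∀ x ∈ C, D'.sup id < x) ∧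
          D.filter (c < ·) = D' ∪ C) := by
  induction j generalizing c with
  | zero =>
    rw [HasChain, not_lt] at h
    set A := D.filter (fun x => c < x ∧ x < c + γ 0) with hA
    set C := D.filter (c + γ 0 ≤ ·) with hC
    have hun : D.filter (c < ·) = A ∪ C := by
      ext x
      simp only [hA, hC, mem_filter, mem_union]
      constructor
      · rintro ⟨h1, h2⟩
        rcases Nat.lt_or_ge x (c + γ 0) with h3 | h3
        · exact Or.inl ⟨h1, h2, h3⟩
        · exact Or.inr ⟨h1, h3⟩
      · rintro (⟨h1, h2, h3⟩ | ⟨h1, h2⟩)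
        · exact ⟨h1, h2⟩
        · exact ⟨h1, by omega⟩
    have hdisj : Disjoint A C := by
      rw [Finset.disjoint_left]
      intro x hx hx'
      rw [hA, mem_filter] at hx
      rw [hC, mem_filter] at hx'
      omega
    have hAsub : A ⊆ Icc (c + 1) (c + (γ 0 - 1)) := by
      intro x hx
      rw [hA, mem_filter] at hx
      rw [Finset.mem_Icc]
      omega
    have hAcard := card_le_card hAsub
    rw [Nat.card_Icc] at hAcard
    rw [hun, card_union_of_disjoint hdisj, zero_add, Finset.sum_range_one]
    refine ⟨by omega, fun heq => ⟨_, rfl, C, by omega, ?_, ?_⟩⟩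
    · intro x hx
      rw [hC, mem_filter] at hx
      rw [Finset.sup_lt_iff (by rw [Nat.bot_eq_zero]; omega)]
      intro y hy
      rw [Finset.mem_Icc] at hy
      simp only [id]
      omega
    · rw [Finset.eq_of_subset_of_card_le hAsub (by rw [Nat.card_Icc]; omega)]
  | succ j ih =>
    have hg := hγ (j + 1)
    set A := D.filter (fun x => c < x ∧ x < c + γ (j + 1)) with hA
    set U := D.filter (c + γ (j + 1) ≤ ·) with hU
    have hAsub : A ⊆ Icc (c + 1) (c + (γ (j + 1) - 1)) := by
      intro x hx
      rw [hA, mem_filter] at hx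
      rw [Finset.mem_Icc]
      omega
    have hAcard := card_le_card hAsub
    rw [Nat.card_Icc] at hAcard
    have hγsum : 2 ≤ ∑ i ∈ range (j + 1), γ i :=
      hγ0.trans (Finset.single_le_sum (f := γ) (fun i _ => Nat.zero_le _)
        (Finset.mem_range.2 (Nat.succ_pos j)))
    rw [Finset.sum_range_succ _ (j + 1)]
    rcases Finset.eq_empty_or_nonempty U with hUe | hUne
    · have hsub : D.filter (c < ·) ⊆ A := by
        intro x hx
        rw [mem_filter] at hx
        rw [hA, mem_filter]
        refine ⟨hx.1, hx.2, ?_⟩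
        by_contra hcon
        have : x ∈ U := mem_filter.2 ⟨hx.1, not_lt.1 hcon⟩
        rw [hUe] at this
        exact absurd this (Finset.notMem_empty x)
      have := card_le_card hsub
      -- With no admissible `b` there are fewer than `γ (j + 1)` elements, and equality fails
      -- because the remaining gaps sum to at least 2.
      exact ⟨by omega, fun heq => by omega⟩
    · set b := U.min' hUne with hb
      have hbU : b ∈ U := Finset.min'_mem _ _
      have hbD : b ∈ D := (mem_filter.1 hbU).1
      have hbc : c + γ (j + 1) ≤ b := (mem_filter.1 hbU).2
      have hmin : ∀ x ∈ D, c + γ (j + 1) ≤ x → b ≤ x := fun x hx hx' =>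
        Finset.min'_le _ _ (mem_filter.2 ⟨hx, hx'⟩)
      have hnot : ¬ HasChain γ ℓ D j b := fun h' => h ⟨b, hbD, hbc, h'⟩
      obtain ⟨ih1, ih2⟩ := ih hnot
      have hun : D.filter (c < ·) = A ∪ insert b (D.filter (b < ·)) := by
        ext x
        simp only [hA, mem_filter, mem_union, mem_insert]
        constructor
        · rintro ⟨h1, h2⟩
          rcases Nat.lt_or_ge x (c + γ (j + 1)) with h3 | h3
          · exact Or.inl ⟨h1, h2, h3⟩
          · have := hmin x h1 h3
            rcases Nat.eq_or_lt_of_le this with h4 | h4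
            · exact Or.inr (Or.inl h4.symm)
            · exact Or.inr (Or.inr ⟨h1, h4⟩)
        · rintro (⟨h1, h2, h3⟩ | h1 | ⟨h1, h2⟩)
          · exact ⟨h1, h2⟩
          · rw [h1]; exact ⟨hbD, by omega⟩
          · exact ⟨h1, by omega⟩
      have hbn : b ∉ D.filter (b < ·) := by simp
      have hdisj : Disjoint A (insert b (D.filter (b < ·))) := by
        rw [Finset.disjoint_left]
        intro x hx hx'
        rw [hA, mem_filter] at hx
        rw [mem_insert, mem_filter] at hx'
        omega
      rw [hun, card_union_of_disjoint hdisj, card_insert_of_notMem hbn]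
      refine ⟨by omega, fun heq => ?_⟩
      obtain ⟨D', hD', C, hC1, hC2, hC3⟩ := ih2 (by omega)
      have hAeq : A = Icc (c + 1) (c + (γ (j + 1) - 1)) :=
        Finset.eq_of_subset_of_card_le hAsub (by rw [Nat.card_Icc]; omega)
      refine ⟨_, ⟨b, hbc, D', hD', rfl⟩, C, hC1, ?_, ?_⟩
      · intro x hx
        have h1 := hC2 x hx
        have h2 := (Full.sup_mem hγ0 hγ hD').1
        rw [Finset.sup_lt_iff (by rw [Nat.bot_eq_zero]; omega)]
        intro y hy
        rw [mem_union, mem_insert, Finset.mem_Icc] at hy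
        simp only [id]
        rcases hy with h3 | h3 | h3
        · omega
        · omega
        · have h4 : y ≤ D'.sup id := Finset.le_sup (f := id) h3
          omega
      · rw [hC3, hAeq, Finset.union_assoc, Finset.insert_union]

/-- The lower block is too short to be used, so every admissible first step lands at `b` or above;
by `HasChain.anti` starting from `b` is the best choice. -/
theorem not_hasChain_of_full {γ : ℕ → ℕ} (hγ0 : 2 ≤ γ 0) (hγ : ∀ i, 1 ≤ γ i) {ℓ : ℕ}
    {D D' C : Finset ℕ} {j c : ℕ} (hD' : D' ∈ Full γ j c) (hC : C.card = ℓ)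
    (hCD : ∀ x ∈ C, D'.sup id < x) (hD : D.filter (c < ·) = D' ∪ C) :
    ¬ HasChain γ ℓ D j c := by
  induction j generalizing c D' with
  | zero =>
    rw [Full, Set.mem_singleton_iff] at hD'
    subst hD'
    rw [HasChain, not_lt, ← hC]
    refine card_le_card fun x hx => ?_
    rw [mem_filter] at hx
    have h1 : x ∈ D.filter (c < ·) := mem_filter.2 ⟨hx.1, by omega⟩
    rw [hD, mem_union, Finset.mem_Icc] at h1
    rcases h1 with h1 | h1
    · omega
    · exact h1
  | succ j ih =>
    obtain ⟨b, hb, D₂, hD₂, rfl⟩ := hD'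
    have hg := hγ (j + 1)
    have hlt := Full.lt_of_mem hγ hD₂
    have hsup := Full.sup_mem hγ0 hγ hD₂
    have hCD₂ : ∀ x ∈ C, D₂.sup id < x := fun x hx =>
      lt_of_le_of_lt (Finset.sup_mono ((subset_insert b D₂).trans subset_union_right)) (hCD x hx)
    have hDb : D.filter (b < ·) = D₂ ∪ C := by
      ext x
      have hx := Finset.ext_iff.1 hD x
      simp only [mem_filter, mem_union, mem_insert, Finset.mem_Icc] at hx ⊢
      constructor
      · rintro ⟨h1, h2⟩
        rcases hx.1 ⟨h1, by omega⟩ with (h3 | h3 | h3) | h3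
        · omega
        · omega
        · exact Or.inl h3
        · exact Or.inr h3
      · rintro (h1 | h1)
        · exact ⟨(hx.2 (Or.inl (Or.inr (Or.inr h1)))).1, hlt x h1⟩
        · refine ⟨(hx.2 (Or.inr h1)).1, ?_⟩
          have := hCD₂ x h1
          omega
    have hnot := ih hD₂ hCD₂ hDb
    rintro ⟨b', hb', h1, h2⟩
    refine hnot (h2.anti ?_)
    have hx := Finset.ext_iff.1 hD b'
    simp only [mem_filter, mem_union, mem_insert, Finset.mem_Icc] at hx
    rcases hx.1 ⟨hb', by omega⟩ with (h3 | h3 | h3) | h3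
    · omega
    · omega
    · exact (hlt b' h3).le
    · have := hCD₂ b' h3
      omega

end PartitionPattern

/-! ### Containment in terms of part sizes -/

namespace PartitionPattern

open Finset

/-- The set of positive row lengths. -/
def partSet (α : YoungDiagram) : Finset ℕ := α.rowLens.toFinset

theorem lt_colLen_zero_iff (α : YoungDiagram) (i : ℕ) : i < α.colLen 0 ↔ 0 < α.rowLen i := by
  rw [← YoungDiagram.mem_iff_lt_colLen, YoungDiagram.mem_iff_lt_rowLen]

theorem mem_partSet {α : YoungDiagram} {d : ℕ} :
    d ∈ partSet α ↔ 0 < d ∧ ∃ i, α.rowLen i = d := by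
  rw [partSet, List.mem_toFinset, YoungDiagram.rowLens, List.mem_map]
  constructor
  · rintro ⟨i, hi, rfl⟩
    rw [List.mem_range, lt_colLen_zero_iff] at hi
    exact ⟨hi, i, rfl⟩
  · rintro ⟨h, i, rfl⟩
    exact ⟨i, by rwa [List.mem_range, lt_colLen_zero_iff], rfl⟩

theorem count_notMem (R : Finset ℕ) (n : ℕ) :
    Nat.count (· ∉ R) n = n - (R.filter (· < n)).card := by
  rw [Nat.count_eq_card_filter_range]
  have h1 := Finset.card_filter_add_card_filter_not (s := range n) (· ∈ R)
  have h2 : (range n).filter (· ∈ R) = R.filter (· < n) := by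
    ext x; simp only [mem_filter, mem_range]; tauto
  rw [h2, card_range] at h1
  omega

theorem infinite_notMem (R : Finset ℕ) : {x | x ∉ R}.Infinite :=
  R.finite_toSet.infinite_compl

theorem mem_image_justify_iff (α : YoungDiagram) (R C : Finset ℕ) (i j : ℕ) :
    (i, j) ∈ (α.cells.filter (fun c => c.1 ∉ R ∧ c.2 ∉ C)).image (justify R C) ↔
      j < Nat.count (· ∉ C) (α.rowLen (Nat.nth (· ∉ R) i)) := by
  simp only [mem_image, mem_filter, YoungDiagram.mem_cells, Prod.exists, justify, Prod.mk.injEq,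
    ← count_notMem]
  constructor
  · rintro ⟨r, c, ⟨h1, h2, h3⟩, rfl, rfl⟩
    rw [Nat.nth_count (p := (· ∉ R)) h2]
    exact Nat.count_strict_mono h3 (YoungDiagram.mem_iff_lt_rowLen.1 h1)
  · intro h
    refine ⟨Nat.nth (· ∉ R) i, Nat.nth (· ∉ C) j, ⟨?_, ?_, ?_⟩, ?_, ?_⟩
    · exact YoungDiagram.mem_iff_lt_rowLen.2 (Nat.nth_lt_of_lt_count h)
    · exact Nat.nth_mem_of_infinite (infinite_notMem R) i
    · exact Nat.nth_mem_of_infinite (infinite_notMem C) j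
    · exact Nat.count_nth_of_infinite (infinite_notMem R) i
    · exact Nat.count_nth_of_infinite (infinite_notMem C) j

theorem contains_iff_exists_count (α μ : YoungDiagram) :
    Contains α μ ↔ ∃ R C : Finset ℕ, ∀ i,
      μ.rowLen i = Nat.count (· ∉ C) (α.rowLen (Nat.nth (· ∉ R) i)) := by
  unfold Contains
  refine exists_congr fun R => exists_congr fun C => ?_
  constructor
  · intro h i
    refine eq_of_forall_lt_iff fun j => ?_
    rw [← mem_image_justify_iff, h, YoungDiagram.mem_cells, YoungDiagram.mem_iff_lt_rowLen]
  · intro h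
    ext ⟨i, j⟩
    rw [mem_image_justify_iff, YoungDiagram.mem_cells, YoungDiagram.mem_iff_lt_rowLen, h i]

theorem count_le_count_add (p : ℕ → Prop) [DecidablePred p] {a b : ℕ} (h : a ≤ b) :
    Nat.count p b ≤ Nat.count p a + (b - a) := by
  obtain ⟨c, rfl⟩ := Nat.exists_eq_add_of_le h
  rw [Nat.count_add, Nat.add_sub_cancel_left]
  exact Nat.add_le_add_left (Nat.count_le fun k => p (a + k)) _

/-- The columns to delete are the places where `f` does not increase. -/
theorem exists_finset_count_eq (f : ℕ → ℕ) (h0 : f 0 = 0)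
    (hf : ∀ x, f x ≤ f (x + 1) ∧ f (x + 1) ≤ f x + 1) (B : ℕ) :
    ∃ C : Finset ℕ, ∀ x ≤ B, Nat.count (· ∉ C) x = f x := by
  refine ⟨(range B).filter fun x => f (x + 1) = f x, fun x hx => ?_⟩
  induction x with
  | zero => simp [h0]
  | succ x ih =>
    rw [Nat.count_succ, ih (by omega)]
    have hxB : x < B := by omega
    have := hf x
    by_cases h : f (x + 1) = f x
    · simp [hxB, h]
    · simp [hxB, h]
      omega

/-- The Lipschitz extension `x ↦ min_i (v i + (x - b i))`. Truncated subtraction makes each term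
nondecreasing with steps 0 or 1, and the gap condition makes the minimum at `b j` equal `v j`. -/
theorem exists_interpolation (m : ℕ) (b v : ℕ → ℕ) (hanti : Antitone v)
    (hbv : ∀ i < m, b (i + 1) + v i ≤ b i + v (i + 1)) :
    ∃ f : ℕ → ℕ, (∀ x, f x ≤ f (x + 1) ∧ f (x + 1) ≤ f x + 1) ∧ ∀ j ≤ m, f (b j) = v j := by
  have hne : (range (m + 1)).Nonempty := ⟨0, by simp⟩
  have hchain : ∀ i j, j ≤ i → i ≤ m → b i + v j ≤ b j + v i := by
    intro i j hji
    induction i, hji using Nat.le_induction with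
    | base => intro _; omega
    | succ i hji ih =>
      intro him
      have := ih (by omega)
      have := hbv i (by omega)
      omega
  refine ⟨fun x => (range (m + 1)).inf' hne fun i => v i + (x - b i), fun x => ⟨?_, ?_⟩, ?_⟩
  · refine Finset.le_inf' _ _ fun i hi => (Finset.inf'_le _ hi).trans ?_
    omega
  · obtain ⟨i, hi, h⟩ := Finset.exists_mem_eq_inf' hne fun i => v i + (x - b i)
    beta_reduce
    rw [h]
    refine (Finset.inf'_le _ hi).trans ?_
    omega
  · intro j hj
    apply le_antisymm
    · exact (Finset.inf'_le _ (Finset.mem_range.2 (by omega : j < m + 1))).trans (by omega)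
    · refine Finset.le_inf' _ _ fun i hi => ?_
      have him : i ≤ m := by have := Finset.mem_range.1 hi; omega
      rcases le_total i j with h | h
      · have := hanti h
        omega
      · have := hchain i j h him
        omega

/-- Deleting columns can only shrink differences of row lengths, so the surviving rows have large
enough gaps. Conversely, large enough gaps permit a function with steps 0 or 1 sending the chosen
row lengths to those of `μ`, and such a function counts surviving columns. Strictness of `μ` makes
the chosen rows distinct. -/
theorem contains_iff_exists_parts {α μ : YoungDiagram} (hμ : IsStrict μ) :
    Contains α μ ↔ ∃ b : ℕ → ℕ, b (μ.colLen 0) = 0 ∧ ∀ i < μ.colLen 0, b i ∈ partSet α ∧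
      b (i + 1) + (μ.rowLen i - μ.rowLen (i + 1)) ≤ b i := by
  set m := μ.colLen 0 with hm
  have hμm : ∀ i, m ≤ i → μ.rowLen i = 0 := by
    intro i hi
    by_contra h
    have := (lt_colLen_zero_iff μ i).2 (Nat.pos_of_ne_zero h)
    omega
  have hanti : Antitone μ.rowLen := fun i j h => μ.rowLen_anti i j h
  rw [contains_iff_exists_count]
  constructor
  · rintro ⟨R, C, h⟩
    set r := Nat.nth (· ∉ R) with hr
    refine ⟨fun i => if i < m then α.rowLen (r i) else 0, by simp, fun i hi => ?_⟩
    have hpos : 0 < μ.rowLen i := (lt_colLen_zero_iff μ i).1 hi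
    have hle : μ.rowLen i ≤ α.rowLen (r i) := by
      rw [h i]
      exact Nat.count_le _
    simp only [hi, if_true]
    refine ⟨mem_partSet.2 ⟨by omega, _, rfl⟩, ?_⟩
    by_cases hi' : i + 1 < m
    · simp only [hi', if_true]
      have hrr : r i < r (i + 1) := Nat.nth_strictMono (infinite_notMem R) (Nat.lt_succ_self i)
      have h1 := α.rowLen_anti _ _ hrr.le
      have h2 := count_le_count_add (· ∉ C) h1
      rw [← h i, ← h (i + 1)] at h2
      omega
    · simp only [hi', if_false]
      omega
  · rintro ⟨b, hb0, hb⟩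
    have hstrict : ∀ i < m, μ.rowLen (i + 1) < μ.rowLen i := by
      intro i hi
      have h1 := hanti (Nat.le_succ i)
      have hpos : 0 < μ.rowLen i := (lt_colLen_zero_iff μ i).1 hi
      rcases Nat.lt_or_eq_of_le h1 with h2 | h2
      · exact h2
      · have := hμ i (i + 1) hpos h2.symm
        omega
    have hbb : ∀ i j, i < j → j ≤ m → b j < b i := by
      intro i j hij
      induction j, hij using Nat.le_induction with
      | base =>
        intro h
        change b (i + 1) < b i
        have := (hb i (by omega)).2
        have := hstrict i (by omega)
        omega
      | succ j hij ih =>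
        intro h
        have := ih (by omega)
        have := (hb j (by omega)).2
        omega
    have hrow : ∀ i, ∃ x, i < m → α.rowLen x = b i := by
      intro i
      by_cases hi : i < m
      · obtain ⟨-, x, hx⟩ := mem_partSet.1 (hb i hi).1
        exact ⟨x, fun _ => hx⟩
      · exact ⟨0, fun h => absurd h hi⟩
    choose r hr using hrow
    have hrmono : ∀ i j, i < j → j < m → r i < r j := by
      intro i j hij hj
      by_contra hcon
      have h1 := α.rowLen_anti _ _ (not_lt.1 hcon)
      rw [hr i (by omega), hr j hj] at h1
      have := hbb i j hij hj.le
      omega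
    have hrlt : ∀ i j, i < m → j < m → r i < r j → i < j := by
      intro i j hi hj h
      by_contra hcon
      rcases Nat.eq_or_lt_of_le (not_lt.1 hcon) with h1 | h1
      · subst h1; omega
      · have := hrmono j i h1 hi
        omega
    obtain ⟨f, hf1, hf2⟩ := exists_interpolation m b μ.rowLen hanti (by
      intro i hi
      have := (hb i hi).2
      have := hanti (Nat.le_succ i)
      omega)
    have hf0 : f 0 = 0 := by
      have := hf2 m le_rfl
      rwa [hb0, hμm m le_rfl] at this
    obtain ⟨C, hC⟩ := exists_finset_count_eq f hf0 hf1 (b 0)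
    -- Only nonempty rows are deleted, so `R` is finite; the rows surviving after the first `m` are
    -- empty.
    set R := (range (α.colLen 0)).filter fun x => ∀ t < m, r t ≠ x with hR
    have hrR : ∀ i < m, r i ∉ R := by
      intro i hi h
      exact (mem_filter.1 h).2 i hi rfl
    have hcount : ∀ i < m, Nat.count (· ∉ R) (r i) = i := by
      intro i hi
      have hri : r i < α.colLen 0 := by
        rw [lt_colLen_zero_iff, hr i hi]
        exact (mem_partSet.1 (hb i hi).1).1
      rw [Nat.count_eq_card_filter_range]
      have heq : (range (r i)).filter (· ∉ R) = (range i).image r := by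
        ext x
        simp only [hR, mem_filter, mem_range, mem_image, not_and, not_forall, not_not]
        constructor
        · rintro ⟨h1, h2⟩
          obtain ⟨t, ht, rfl⟩ := h2 (by omega)
          exact ⟨t, hrlt t i ht hi h1, rfl⟩
        · rintro ⟨t, ht, rfl⟩
          exact ⟨hrmono t i ht hi, fun _ => ⟨t, by omega, rfl⟩⟩
      rw [heq, card_image_of_injOn, card_range]
      intro s hs t ht hst
      simp only [coe_range, Set.mem_Iio] at hs ht
      by_contra hne
      rcases Nat.lt_or_gt_of_ne hne with h1 | h1
      · have := hrmono s t h1 (by omega); omega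
      · have := hrmono t s h1 (by omega); omega
    refine ⟨R, C, fun i => ?_⟩
    rcases Nat.lt_or_ge i m with hi | hi
    · have hnth : Nat.nth (· ∉ R) i = r i := by
        have := Nat.nth_count (p := (· ∉ R)) (hrR i hi)
        rwa [hcount i hi] at this
      have hb0i : b i ≤ b 0 := by
        rcases Nat.eq_zero_or_pos i with h | h
        · rw [h]
        · exact (hbb 0 i h hi.le).le
      rw [hnth, hr i hi, hC _ hb0i, hf2 i hi.le]
    · rw [hμm i hi]
      have hzero : α.rowLen (Nat.nth (· ∉ R) i) = 0 := by
        by_contra h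
        have h1 := (lt_colLen_zero_iff α _).2 (Nat.pos_of_ne_zero h)
        have h2 : Nat.nth (· ∉ R) i ∉ R := Nat.nth_mem_of_infinite (infinite_notMem R) i
        have h3 : Nat.count (· ∉ R) (Nat.nth (· ∉ R) i) = i :=
          Nat.count_nth_of_infinite (infinite_notMem R) i
        have h4 : ∃ t < m, r t = Nat.nth (· ∉ R) i := by
          by_contra hcon
          push Not at hcon
          exact h2 (mem_filter.2 ⟨mem_range.2 h1, hcon⟩)
        obtain ⟨t, ht, hrt⟩ := h4
        rw [← hrt, hcount t ht] at h3
        omega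
      rw [hzero, Nat.count_zero]

end PartitionPattern

/-! ### Chains as gap conditions, and the count of avoiders as a sum over part sets -/

namespace PartitionPattern

open Finset

/-- `D` contains a chain above `c` with successive gaps `g (i - 1), …, g 0`. -/
def GapChain (g : ℕ → ℕ) (D : Finset ℕ) : ℕ → ℕ → Prop
  | 0, _ => True
  | i + 1, c => ∃ b ∈ D, c + g i ≤ b ∧ GapChain g D i b

theorem gapChain_iff_exists (g : ℕ → ℕ) (D : Finset ℕ) (i c : ℕ) :
    GapChain g D i c ↔
      ∃ b : ℕ → ℕ, b i = c ∧ ∀ t < i, b t ∈ D ∧ b (t + 1) + g t ≤ b t := by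
  induction i generalizing c with
  | zero => exact ⟨fun _ => ⟨fun _ => c, rfl, by simp⟩, fun _ => trivial⟩
  | succ i ih =>
    constructor
    · rintro ⟨d, hd, h1, h2⟩
      obtain ⟨b, rfl, hb⟩ := (ih d).1 h2
      refine ⟨Function.update b (i + 1) c, by simp, fun t ht => ?_⟩
      rw [Function.update_of_ne (by omega : t ≠ i + 1)]
      rcases Nat.lt_or_eq_of_le (Nat.le_of_lt_succ ht) with h | h
      · rw [Function.update_of_ne (by omega)]
        exact hb t h
      · subst h
        rw [Function.update_self]
        exact ⟨hd, h1⟩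
    · rintro ⟨b, rfl, hb⟩
      exact ⟨b i, (hb i (by omega)).1, (hb i (by omega)).2,
        (ih (b i)).2 ⟨b, rfl, fun t ht => hb t (by omega)⟩⟩

theorem exists_le_card_filter_iff (D : Finset ℕ) (a t : ℕ) :
    (∃ b ∈ D, a ≤ b ∧ t ≤ (D.filter (b < ·)).card) ↔ t < (D.filter (a ≤ ·)).card := by
  constructor
  · rintro ⟨b, hb, hab, ht⟩
    have hsub : insert b (D.filter (b < ·)) ⊆ D.filter (a ≤ ·) := by
      intro x hx
      rw [mem_insert, mem_filter] at hx
      rw [mem_filter]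
      rcases hx with rfl | h
      · exact ⟨hb, hab⟩
      · exact ⟨h.1, by omega⟩
    have := card_le_card hsub
    rw [card_insert_of_notMem (by simp)] at this
    omega
  · intro h
    have hne : (D.filter (a ≤ ·)).Nonempty := card_pos.1 (by omega)
    set b := (D.filter (a ≤ ·)).min' hne with hb
    have hbm := Finset.min'_mem _ hne
    rw [← hb, mem_filter] at hbm
    refine ⟨b, hbm.1, hbm.2, ?_⟩
    have hsub : D.filter (a ≤ ·) ⊆ insert b (D.filter (b < ·)) := by
      intro x hx
      have hbx : b ≤ x := Finset.min'_le _ _ hx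
      rw [mem_insert, mem_filter]
      rcases Nat.eq_or_lt_of_le hbx with h1 | h1
      · exact Or.inl h1.symm
      · exact Or.inr ⟨(mem_filter.1 hx).1, h1⟩
    have := (card_le_card hsub).trans (card_insert_le _ _)
    omega

/-- Gaps equal to 1 only ask for distinct elements, so the top of the chain reduces to a cardinality
condition. -/
theorem gapChain_iff_card {g : ℕ → ℕ} (D : Finset ℕ) {t : ℕ} (hg : ∀ i < t, g i = 1) (c : ℕ) :
    GapChain g D t c ↔ t ≤ (D.filter (c < ·)).card := by
  induction t generalizing c with
  | zero => simp [GapChain]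
  | succ t ih =>
    rw [GapChain, hg t (by omega)]
    simp_rw [ih fun i hi => hg i (by omega)]
    exact exists_le_card_filter_iff D (c + 1) t

theorem gapChain_iff_hasChain {g γ : ℕ → ℕ} {ℓ j : ℕ} (D : Finset ℕ) (hg : ∀ i < ℓ, g i = 1)
    (hγ : ∀ i ≤ j, g (ℓ + i) = γ i) (c : ℕ) :
    GapChain g D (ℓ + 1 + j) c ↔ HasChain γ ℓ D j c := by
  induction j generalizing c with
  | zero =>
    rw [add_zero, GapChain, HasChain]
    simp_rw [gapChain_iff_card D hg]
    have := hγ 0 le_rfl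
    rw [add_zero] at this
    rw [this]
    exact exists_le_card_filter_iff D _ ℓ
  | succ j ih =>
    rw [← add_assoc, GapChain, HasChain]
    have := hγ (j + 1) le_rfl
    rw [show ℓ + 1 + j = ℓ + (j + 1) by ring, this]
    rw [show ℓ + (j + 1) = ℓ + 1 + j by ring]
    simp_rw [ih fun i hi => hγ i (by omega)]

theorem card_eq_sum_rowLens (α : YoungDiagram) : α.card = α.rowLens.sum := by
  have h1 : α.rowLens.sum = ∑ i ∈ range (α.colLen 0), α.rowLen i := by
    rw [YoungDiagram.rowLens, Finset.sum_range, ← List.sum_ofFn]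
    congr 1
    exact List.ext_getElem (by simp) (by simp)
  rw [h1, YoungDiagram.card, Finset.card_eq_sum_card_fiberwise (f := Prod.fst)
    (t := range (α.colLen 0))]
  · refine Finset.sum_congr rfl fun i _ => ?_
    rw [YoungDiagram.rowLen_eq_card]
    rfl
  · rintro ⟨i, j⟩ hc
    have hc' : (i, j) ∈ α := by simpa using hc
    have := α.up_left_mem le_rfl (Nat.zero_le j) hc'
    simpa using YoungDiagram.mem_iff_lt_colLen.1 this

/-- A partition corresponds to the function sending `d` to `d` times its multiplicity; positive
multiples on all of `D` mean that every size in `D` occurs. -/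
theorem card_filter_partSet_eq (n : ℕ) (D : Finset ℕ) (A : Finset YoungDiagram)
    (hA : ∀ α, α ∈ A ↔ α.card = n ∧ partSet α = D) (hD : ∀ d ∈ D, 1 ≤ d) :
    A.card = numSol D n := by
  rw [numSol_eq_card]
  have hcount0 : ∀ α ∈ A, ∀ d, d ∉ D → α.rowLens.count d = 0 := by
    intro α hα d hd
    rw [List.count_eq_zero]
    intro h
    apply hd
    rw [← ((hA α).1 hα).2, partSet, List.mem_toFinset]
    exact h
  refine Finset.card_bij
    (fun α hα => Finsupp.onFinset D (fun d => d * α.rowLens.count d) (fun d hd => by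
      by_contra h
      rw [hcount0 α hα d h] at hd
      simp at hd)) ?_ ?_ ?_
  · intro α hα
    obtain ⟨h1, h2⟩ := (hA α).1 hα
    rw [mem_filter, mem_finsuppAntidiag]
    refine ⟨⟨?_, Finsupp.support_onFinset_subset⟩, fun d hd => ⟨?_, ?_⟩⟩
    · change ∑ d ∈ D, d * α.rowLens.count d = n
      rw [← h1, card_eq_sum_rowLens, Finset.sum_list_count]
      change _ = ∑ m ∈ partSet α, _
      rw [h2]
      exact Finset.sum_congr rfl fun d _ => by rw [smul_eq_mul, mul_comm]
    · simp
    · simp only [Finsupp.onFinset_apply]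
      have h3 : d ∈ α.rowLens := by
        rw [← h2, partSet, List.mem_toFinset] at hd
        exact hd
      have h4 := List.count_pos_iff.2 h3
      have h5 := hD d hd
      positivity
  · intro α hα β hβ h
    have hperm : α.rowLens.Perm β.rowLens := by
      rw [List.perm_iff_count]
      intro d
      by_cases hd : d ∈ D
      · have := DFunLike.congr_fun h d
        simp only [Finsupp.onFinset_apply] at this
        exact Nat.eq_of_mul_eq_mul_left (hD d hd) this
      · rw [hcount0 α hα d hd, hcount0 β hβ d hd]
    have heq := hperm.eq_of_pairwise' α.rowLens_sorted.pairwise β.rowLens_sorted.pairwise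
    apply YoungDiagram.equivListRowLens.injective
    exact Subtype.ext heq
  · intro l hl
    rw [mem_filter, mem_finsuppAntidiag] at hl
    obtain ⟨⟨h1, h2⟩, h3⟩ := hl
    set s : Multiset ℕ := ∑ d ∈ D, Multiset.replicate (l d / d) d with hs
    have hcount : ∀ d, s.count d = if d ∈ D then l d / d else 0 := by
      intro d
      rw [hs, Multiset.count_sum']
      simp_rw [Multiset.count_replicate]
      rw [Finset.sum_ite_eq']
    set w := s.sort (· ≥ ·) with hw
    have hwc : ∀ d, w.count d = if d ∈ D then l d / d else 0 := by
      intro d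
      rw [← hcount, ← Multiset.sort_eq s (· ≥ ·), Multiset.coe_count]
    have hmem : ∀ d, d ∈ w ↔ d ∈ D := by
      intro d
      rw [← List.count_pos_iff, hwc]
      constructor
      · intro h
        by_contra hd
        simp [hd] at h
      · intro hd
        rw [if_pos hd]
        obtain ⟨h4, h5⟩ := h3 d hd
        exact Nat.div_pos (Nat.le_of_dvd (Nat.pos_of_ne_zero h5) h4) (hD d hd)
    have hwpos : ∀ x ∈ w, 0 < x := fun x hx => hD x ((hmem x).1 hx)
    have hsorted : w.SortedGE := (Multiset.pairwise_sort s (· ≥ ·)).sortedGE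
    set α := YoungDiagram.ofRowLens w hsorted with hα
    have hrl : α.rowLens = w := YoungDiagram.rowLens_ofRowLens_eq_self hwpos
    have hpart : partSet α = D := by
      ext d
      rw [partSet, List.mem_toFinset, hrl, hmem]
    have hval : ∀ d ∈ D, d * w.count d = l d := by
      intro d hd
      rw [hwc, if_pos hd]
      exact Nat.mul_div_cancel' (h3 d hd).1
    have hcard : α.card = n := by
      rw [card_eq_sum_rowLens, Finset.sum_list_count]
      change ∑ m ∈ partSet α, _ = _
      rw [hpart, ← h1]
      refine Finset.sum_congr rfl fun d hd => ?_
      rw [smul_eq_mul, mul_comm, hrl, hval d hd]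
    refine ⟨α, (hA α).2 ⟨hcard, hpart⟩, ?_⟩
    ext d
    simp only [Finsupp.onFinset_apply]
    rw [hrl]
    by_cases hd : d ∈ D
    · exact hval d hd
    · rw [hwc, if_neg hd, mul_zero]
      have : d ∉ l.support := fun h => hd (h2 h)
      rw [Finsupp.notMem_support_iff] at this
      exact this.symm

theorem partSet_subset_Icc (α : YoungDiagram) : partSet α ⊆ Icc 1 α.card := by
  intro d hd
  rw [Finset.mem_Icc]
  refine ⟨(mem_partSet.1 hd).1, ?_⟩
  rw [card_eq_sum_rowLens]
  exact List.le_sum_of_mem (List.mem_toFinset.1 hd)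

open Classical in
theorem ncard_Av_eq_sum {μ : YoungDiagram} {P : Finset ℕ → Prop}
    (hP : ∀ α, Contains α μ ↔ P (partSet α)) (n : ℕ) :
    (Av n μ).ncard = ∑ D ∈ (Icc 1 n).powerset.filter (fun D => ¬ P D), numSol D n := by
  rw [Set.ncard_eq_toFinset_card _ (Av_finite n μ),
    Finset.card_eq_sum_card_fiberwise (f := partSet)
      (t := (Icc 1 n).powerset.filter (fun D => ¬ P D))]
  · refine Finset.sum_congr rfl fun D hD => ?_
    rw [mem_filter, mem_powerset] at hD
    refine card_filter_partSet_eq n D _ (fun α => ?_) fun d hd => (Finset.mem_Icc.1 (hD.1 hd)).1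
    rw [mem_filter, Set.Finite.mem_toFinset, Av, Set.mem_ofPred_eq, hP]
    constructor
    · rintro ⟨⟨h1, -⟩, h2⟩
      exact ⟨h1, h2⟩
    · rintro ⟨h1, h2⟩
      exact ⟨⟨h1, by rw [h2]; exact hD.2⟩, h2⟩
  · intro α hα
    have hα' : α.card = n ∧ ¬ Contains α μ := by simpa [Av] using hα
    rw [mem_coe, mem_filter, mem_powerset, ← hP, ← hα'.1]
    exact ⟨partSet_subset_Icc α, hα'.2⟩

end PartitionPattern

/-! ### Asymptotics of the sum over chain-free sets -/

namespace PartitionPattern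

open Finset

-- The decomposition of a chain-free set of maximal size is unique: the `Full` component has fixed
-- size `κ` and consists of the smallest elements.
open Classical in
theorem sum_not_hasChain_filter_card {γ : ℕ → ℕ} (hγ0 : 2 ≤ γ 0) (hγ : ∀ i, 1 ≤ γ i) {ℓ r κ : ℕ}
    (hκ : κ + 1 = ∑ i ∈ range (r + 1), γ i) (n : ℕ) (f : Finset ℕ → ℝ) :
    ∑ D ∈ ((Icc 1 n).powerset.filter (fun D => ¬ HasChain γ ℓ D r 0)).filter
        (fun D => D.card = κ + ℓ), f D =
      ∑ D ∈ (Icc 1 n).powerset.filter (· ∈ Full γ r 0),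
        ∑ C ∈ (Ioc (D.sup id) n).powersetCard ℓ, f (D ∪ C) := by
  have hpos : ∀ D : Finset ℕ, D ⊆ Icc 1 n → D.filter (0 < ·) = D := fun D hD =>
    Finset.filter_true_of_mem fun x hx => (Finset.mem_Icc.1 (hD hx)).1
  have hdisj : ∀ D C : Finset ℕ, (∀ x ∈ C, D.sup id < x) → Disjoint D C := by
    intro D C hC
    rw [Finset.disjoint_left]
    intro x hx hx'
    exact absurd (Finset.le_sup (f := id) hx) (not_le.2 (hC x hx'))
  rw [Finset.sum_sigma']
  symm
  refine Finset.sum_bij (fun p _ => p.1 ∪ p.2) ?_ ?_ ?_ (fun _ _ => rfl)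
  · rintro ⟨D, C⟩ h
    simp only [mem_sigma, mem_filter, mem_powerset, mem_powersetCard] at h ⊢
    obtain ⟨⟨hD, hF⟩, hC, hCc⟩ := h
    have hCD : ∀ x ∈ C, D.sup id < x := fun x hx => (Finset.mem_Ioc.1 (hC hx)).1
    have hsub : D ∪ C ⊆ Icc 1 n := Finset.union_subset hD fun x hx =>
      Finset.mem_Icc.2 ⟨Nat.one_le_of_lt (hCD x hx), (Finset.mem_Ioc.1 (hC hx)).2⟩
    refine ⟨⟨hsub, not_hasChain_of_full hγ0 hγ hF hCc hCD (hpos _ hsub)⟩, ?_⟩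
    have := Full.card_add_one hγ hF
    rw [card_union_of_disjoint (hdisj D C hCD)]
    omega
  · have key : ∀ D C D' C' : Finset ℕ, D.card = D'.card → (∀ x ∈ C, D.sup id < x) →
        (∀ x ∈ C', D'.sup id < x) → D ∪ C = D' ∪ C' → D.sup id ≤ D'.sup id → D = D' := by
      intro D C D' C' hc hC hC' hu hs
      refine Finset.eq_of_subset_of_card_le (fun x hx => ?_) hc.ge
      have : x ∈ D' ∪ C' := hu ▸ mem_union_left _ hx
      rcases mem_union.1 this with h | h
      · exact h
      · exact absurd ((Finset.le_sup (f := id) hx).trans hs) (not_le.2 (hC' x h))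
    rintro ⟨D, C⟩ h ⟨D', C'⟩ h' hu
    simp only [mem_sigma, mem_filter, mem_powersetCard] at h h' hu
    have hC : ∀ x ∈ C, D.sup id < x := fun x hx => (Finset.mem_Ioc.1 (h.2.1 hx)).1
    have hC' : ∀ x ∈ C', D'.sup id < x := fun x hx => (Finset.mem_Ioc.1 (h'.2.1 hx)).1
    have hc : D.card = D'.card := by
      have h1 := Full.card_add_one hγ h.1.2
      have h2 := Full.card_add_one hγ h'.1.2
      omega
    have hDD : D = D' := by
      rcases le_total (D.sup id) (D'.sup id) with hs | hs
      · exact key D C D' C' hc hC hC' hu hs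
      · exact (key D' C' D C hc.symm hC' hC hu.symm hs).symm
    subst hDD
    have hCC : C = C' := by
      rw [← Finset.union_sdiff_cancel_left (hdisj D C hC), hu,
        Finset.union_sdiff_cancel_left (hdisj D C' hC')]
    rw [hCC]
  · intro D h
    simp only [mem_filter, mem_powerset] at h
    obtain ⟨⟨hD, hch⟩, hc⟩ := h
    obtain ⟨D', hF, C, hCc, hCD, hu⟩ := (card_filter_lt_of_not_hasChain hγ0 hγ hch).2 (by
      rw [hpos D hD]; omega)
    rw [hpos D hD] at hu
    refine ⟨⟨D', C⟩, ?_, hu.symm⟩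
    simp only [mem_sigma, mem_filter, mem_powerset, mem_powersetCard]
    subst hu
    exact ⟨⟨Finset.subset_union_left.trans hD, hF⟩, fun x hx => Finset.mem_Ioc.2
      ⟨hCD x hx, (Finset.mem_Icc.1 (hD (mem_union_right _ hx))).2⟩, hCc⟩

/-- For each size the half power of `n` saved in `sum_numSol_powersetCard_le` absorbs all powers of
the logarithm, since `(1 + log n) ^ k ≤ √n` eventually. -/
theorem eventually_sum_numSol_card_lt_le (k : ℕ) :
    ∀ᶠ n : ℕ in atTop,
      ∑ D ∈ (Icc 1 n).powerset.filter (fun D => D.card < k), (numSol D n : ℝ)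
        ≤ 2 * k * ((n : ℝ) ^ (k - 1) / (1 + Real.log n)) := by
  filter_upwards [eventually_one_add_log_pow_le (2 * k), eventually_ge_atTop 1] with n hn hn1
  set Y := 1 + Real.log n with hY
  have hY1 : 1 ≤ Y := by linarith [hn.1]
  have hY0 : 0 < Y := by linarith
  have hn1' : (1 : ℝ) ≤ n := by exact_mod_cast hn1
  have hsq : Y ^ k ≤ Real.sqrt n := Real.le_sqrt_of_sq_le (by rw [← pow_mul, mul_comm]; exact hn.2)
  have hlevel : ∀ s ∈ range k, ∑ D ∈ (Icc 1 n).powersetCard s, (numSol D n : ℝ)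
      ≤ 2 * ((n : ℝ) ^ (k - 1) / Y) := by
    intro s hs
    rw [mem_range] at hs
    rcases s with _ | s
    · rw [powersetCard_zero, sum_singleton]
      have : numSol ∅ n = 0 := by
        simp [numSol, PowerSeries.coeff_one, Nat.one_le_iff_ne_zero.1 hn1]
      rw [this, Nat.cast_zero]
      positivity
    · have h1 : ∑ D ∈ (Icc 1 n).powersetCard (s + 1), (numSol D n : ℝ)
          ≤ (n * Y) ^ s * (2 * Real.sqrt n) := by
        have := sum_numSol_powersetCard_le n s
        have h2 := coeffSum_sum_multSeries_le n
        have h3 : ((∑ D ∈ (Icc 1 n).powersetCard (s + 1), numSol D n : ℕ) : ℝ) ≤ _ :=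
          Nat.cast_le.2 this
        push_cast at h3
        refine h3.trans ?_
        gcongr
        exact Real.nat_sqrt_le_real_sqrt
      obtain ⟨t, rfl⟩ : ∃ t, k = s + 2 + t := ⟨k - (s + 2), by omega⟩
      refine h1.trans ?_
      rw [mul_div_assoc', le_div_iff₀ hY0]
      calc (n * Y) ^ s * (2 * Real.sqrt n) * Y
          = 2 * (n : ℝ) ^ s * (Y ^ (s + 1) * Real.sqrt n) := by rw [mul_pow]; ring
        _ ≤ 2 * (n : ℝ) ^ s * (Real.sqrt n * Real.sqrt n) := by
          gcongr
          exact (pow_le_pow_right₀ hY1 (by omega)).trans hsq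
        _ = 2 * (n : ℝ) ^ (s + 1) := by
          rw [Real.mul_self_sqrt (by positivity)]; ring
        _ ≤ 2 * (n : ℝ) ^ (s + 2 + t - 1) := by
          gcongr 2 * ?_
          exact pow_le_pow_right₀ hn1' (by omega)
  have hfib := Finset.sum_fiberwise_of_maps_to (s := (Icc 1 n).powerset.filter (fun D => D.card < k))
    (t := range k) (g := Finset.card) (fun D hD => mem_range.2 (mem_filter.1 hD).2)
    (fun D => (numSol D n : ℝ))
  rw [← hfib]
  calc _ ≤ ∑ s ∈ range k, ∑ D ∈ (Icc 1 n).powersetCard s, (numSol D n : ℝ) := by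
        refine sum_le_sum fun s _ => sum_le_sum_of_subset_of_nonneg (fun D hD => ?_)
          fun _ _ _ => Nat.cast_nonneg _
        simp only [mem_filter, mem_powerset] at hD
        exact mem_powersetCard.2 ⟨hD.1.1, hD.2⟩
    _ ≤ ∑ s ∈ range k, 2 * ((n : ℝ) ^ (k - 1) / Y) := sum_le_sum hlevel
    _ = _ := by rw [sum_const, card_range, nsmul_eq_mul]; ring

open Classical in
theorem exists_abs_sum_not_hasChain_sub_le {γ : ℕ → ℕ} (hγ0 : 2 ≤ γ 0) (hγ : ∀ i, 1 ≤ γ i)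
    {ℓ r κ : ℕ} (hκ : κ + 1 = ∑ i ∈ range (r + 1), γ i) (hκ1 : 1 ≤ κ) :
    ∃ K : ℝ, ∀ᶠ n : ℕ in atTop,
      |∑ D ∈ (Icc 1 n).powerset.filter (fun D => ¬ HasChain γ ℓ D r 0), (numSol D n : ℝ)
        - (n : ℝ) ^ (κ + ℓ - 1) * Real.log n ^ ℓ / ((κ + ℓ - 1).factorial * ℓ.factorial)
          * ((∏ i ∈ range r, (excess γ i : ℝ)⁻¹) * ((excess γ r).factorial : ℝ)⁻¹)|
        ≤ K * ((n : ℝ) ^ (κ + ℓ - 1) * (1 + Real.log n) ^ ℓ / (1 + Real.log n)) := by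
  obtain ⟨K, hK⟩ := exists_abs_sum_sum_numSol_sub_le (𝒟 := Full γ r 0) hκ1 ℓ
    (fun D hD => ⟨Full.endsInPair hγ0 hγ hD, by have := Full.card_add_one hγ hD; omega⟩)
    (hasSum_invProd_full hγ0 hγ r)
  refine ⟨K + 2 * (κ + ℓ : ℕ), ?_⟩
  filter_upwards [hK, eventually_sum_numSol_card_lt_le (κ + ℓ),
    eventually_one_add_log_pow_le 0] with n h1 h2 h3
  have hY1 : (1 : ℝ) ≤ 1 + Real.log n := by linarith [h3.1]
  set T := (Icc 1 n).powerset.filter (fun D => ¬ HasChain γ ℓ D r 0) with hT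
  have hle : ∀ D ∈ T, D.card ≤ κ + ℓ := by
    intro D hD
    rw [hT, mem_filter, mem_powerset] at hD
    have := (card_filter_lt_of_not_hasChain hγ0 hγ hD.2).1
    rw [Finset.filter_true_of_mem (p := (0 < ·))
      fun x hx => (Finset.mem_Icc.1 (hD.1 hx)).1] at this
    omega
  have hsplit := Finset.sum_filter_add_sum_filter_not T (fun D => D.card = κ + ℓ)
    (fun D => (numSol D n : ℝ))
  rw [hT, sum_not_hasChain_filter_card hγ0 hγ hκ, ← hT] at hsplit
  have hB0 : 0 ≤ ∑ D ∈ T with ¬ D.card = κ + ℓ, (numSol D n : ℝ) :=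
    sum_nonneg fun _ _ => Nat.cast_nonneg _
  have hB : ∑ D ∈ T with ¬ D.card = κ + ℓ, (numSol D n : ℝ)
      ≤ 2 * (κ + ℓ : ℕ) * ((n : ℝ) ^ (κ + ℓ - 1) / (1 + Real.log n)) := by
    refine le_trans (sum_le_sum_of_subset_of_nonneg (fun D hD => ?_)
      fun _ _ _ => Nat.cast_nonneg _) h2
    rw [mem_filter] at hD ⊢
    exact ⟨(mem_filter.1 hD.1).1, lt_of_le_of_ne (hle D hD.1) hD.2⟩
  have hB' : 2 * (κ + ℓ : ℕ) * ((n : ℝ) ^ (κ + ℓ - 1) / (1 + Real.log n)) ≤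
      2 * (κ + ℓ : ℕ) * ((n : ℝ) ^ (κ + ℓ - 1) * (1 + Real.log n) ^ ℓ / (1 + Real.log n)) := by
    gcongr
    exact le_mul_of_one_le_right (by positivity) (one_le_pow₀ hY1)
  rw [← hsplit, add_mul]
  rw [abs_le] at h1 ⊢
  constructor <;> linarith [h1.1, h1.2]

end PartitionPattern

/-! ### The shape of `μ`, the product in the main term, and the final estimate -/

namespace PartitionPattern

open Finset

theorem IsStrict.rowLen_succ_lt {μ : YoungDiagram} (hμ : IsStrict μ) {i : ℕ}
    (hi : 0 < μ.rowLen i) : μ.rowLen (i + 1) < μ.rowLen i := by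
  refine lt_of_le_of_ne (μ.rowLen_anti i (i + 1) (by omega)) fun h => ?_
  have := hμ i (i + 1) hi h.symm
  omega

theorem exists_hasForm {μ : YoungDiagram} (hμ : IsStrict μ) (hstair : ¬ IsStaircase μ) :
    ∃ (k ℓ : ℕ) (a : ℕ → ℕ), HasForm μ k ℓ a := by
  classical
  have hex : ∃ i, μ.rowLen (i + 1) + 1 ≠ μ.rowLen i := by
    by_contra! h
    have : ∀ i, μ.rowLen i + i = μ.rowLen 0 := by
      intro i
      induction i with
      | zero => rfl
      | succ i ih => have := h i; omega
    have := this (μ.rowLen 0 + 1)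
    omega
  set ℓ := Nat.find hex with hℓ
  have hne : μ.rowLen (ℓ + 1) + 1 ≠ μ.rowLen ℓ := Nat.find_spec hex
  have hhead : ∀ i ≤ ℓ, μ.rowLen i + i = μ.rowLen 0 := by
    intro i hi
    induction i with
    | zero => rfl
    | succ i ih =>
      have h1 := ih (by omega)
      have h2 : μ.rowLen (i + 1) + 1 = μ.rowLen i := not_not.1 (Nat.find_min hex hi)
      omega
  have hpos : 0 < μ.rowLen ℓ := by
    by_contra h
    refine hstair ⟨μ.rowLen 0, fun i => ?_⟩
    have h0 := hhead ℓ le_rfl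
    rcases le_total i ℓ with hi | hi
    · have := hhead i hi
      omega
    · have := μ.rowLen_anti ℓ i hi
      omega
  have hlt := hμ.rowLen_succ_lt hpos
  have h0 := hhead ℓ le_rfl
  refine ⟨μ.rowLen 0 - 1, ℓ, fun j => μ.rowLen (ℓ + 1 + j), fun i hi => ?_, fun j => rfl, ?_⟩
  · have := hhead i hi
    omega
  · change μ.rowLen (ℓ + 1) + ℓ < μ.rowLen 0 - 1
    omega

theorem HasForm.exists_gaps {μ : YoungDiagram} (hμ : IsStrict μ) {k ℓ : ℕ} {a : ℕ → ℕ}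
    (h : HasForm μ k ℓ a) :
    ∃ (γ : ℕ → ℕ) (r : ℕ), 2 ≤ γ 0 ∧ (∀ i, 1 ≤ γ i) ∧
      (∀ α, Contains α μ ↔ HasChain γ ℓ (partSet α) r 0) ∧
      (∀ j ≤ r, ∑ i ∈ range (j + 1), γ i + a j + ℓ = k + 1) ∧ ∀ j, r ≤ j → a j = 0 := by
  have hgap := h.gap
  have hhead := h.head ℓ le_rfl
  have htail : ∀ j, μ.rowLen (ℓ + 1 + j) = a j := h.tail
  have hm : ℓ < μ.colLen 0 := by
    rw [lt_colLen_zero_iff]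
    omega
  obtain ⟨r, hr⟩ := Nat.exists_eq_add_of_le (Nat.succ_le_of_lt hm)
  have hg0 : μ.rowLen ℓ - μ.rowLen (ℓ + 1) + a 0 + ℓ = k + 1 := by
    have h1 : μ.rowLen (ℓ + 1) = a 0 := htail 0
    omega
  have hpos : ∀ i ≤ r, μ.rowLen (ℓ + i + 1) < μ.rowLen (ℓ + i) := fun i hi =>
    hμ.rowLen_succ_lt ((lt_colLen_zero_iff μ (ℓ + i)).1 (by omega))
  -- The maximum only matters for `i > r`, beyond the rows of `μ`, where it keeps `1 ≤ γ i` for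
  -- every `i`.
  set γ : ℕ → ℕ := fun i => max 1 (μ.rowLen (ℓ + i) - μ.rowLen (ℓ + i + 1)) with hγ
  have hγr : ∀ i ≤ r, μ.rowLen (ℓ + i) - μ.rowLen (ℓ + i + 1) = γ i := by
    intro i hi
    have := hpos i hi
    simp only [hγ]
    omega
  have hγ0 : γ 0 + a 0 + ℓ = k + 1 := by
    rw [← hγr 0 (by omega)]
    exact hg0
  refine ⟨γ, r, by omega, fun i => le_max_left _ _, fun α => ?_, fun j hj => ?_, fun j hj => ?_⟩
  · rw [contains_iff_exists_parts hμ, hr,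
      ← gapChain_iff_exists (fun i => μ.rowLen i - μ.rowLen (i + 1))]
    refine gapChain_iff_hasChain _ (fun i hi => ?_) (fun i hi => hγr i hi) 0
    have h1 := h.head i hi.le
    have h2 := h.head (i + 1) hi
    show μ.rowLen i - μ.rowLen (i + 1) = 1
    omega
  · induction j with
    | zero => simpa using hγ0
    | succ j ih =>
      rw [sum_range_succ]
      have h1 := ih (by omega)
      have h2 := hγr (j + 1) hj
      have h3 := hpos (j + 1) hj
      have h4 := htail j
      have h5 := htail (j + 1)
      rw [show ℓ + (j + 1) + 1 = ℓ + 1 + (j + 1) by ring, h5,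
        show ℓ + (j + 1) = ℓ + 1 + j by ring, h4] at h2 h3
      omega
  · have h1 := htail j
    have h2 : ¬ (ℓ + 1 + j < μ.colLen 0) := by omega
    rw [lt_colLen_zero_iff] at h2
    omega

theorem excess_add (γ : ℕ → ℕ) (hγ : ∀ i, 1 ≤ γ i) (j : ℕ) :
    excess γ j + (j + 1) = ∑ i ∈ range (j + 1), γ i := by
  have : ∑ i ∈ range (j + 1), γ i = ∑ i ∈ range (j + 1), ((γ i - 1) + 1) :=
    sum_congr rfl fun i _ => by have := hγ i; omega
  rw [this, sum_add_distrib, excess, sum_const, card_range, smul_eq_mul, mul_one]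

theorem one_le_excess {γ : ℕ → ℕ} (hγ0 : 2 ≤ γ 0) (j : ℕ) : 1 ≤ excess γ j := by
  rw [excess, sum_range_succ']
  omega

theorem prod_range_sub_eq_factorial (e : ℕ) :
    ∏ x ∈ range e, ((e : ℝ) - x) = (e.factorial : ℝ) := by
  induction e with
  | zero => simp
  | succ e ih =>
    rw [prod_range_succ', Nat.factorial_succ, Nat.cast_mul, ← ih, mul_comm]
    simp

/-- For `j ≤ r` one has `k - ℓ - a j - j = excess γ j`. From `j = r` on, `a j = 0` and the factors
run down from `excess γ r` to 1, giving the factorial. -/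
theorem prod_mainTerm_eq {γ a : ℕ → ℕ} {k ℓ r : ℕ} (hγ : ∀ i, 1 ≤ γ i)
    (hsum : ∀ j ≤ r, ∑ i ∈ range (j + 1), γ i + a j + ℓ = k + 1) (ha : ∀ j, r ≤ j → a j = 0) :
    ∏ j ∈ range (k - ℓ), ((k : ℝ) - ℓ - a j - j) =
      (∏ j ∈ range r, (excess γ j : ℝ)) * ((excess γ r).factorial : ℝ) := by
  have hex : ∀ j ≤ r, excess γ j + j + a j + ℓ = k := by
    intro j hj
    have h1 := excess_add γ hγ j
    have h2 := hsum j hj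
    omega
  have hr := hex r le_rfl
  rw [ha r le_rfl] at hr
  have hkℓ : k - ℓ = r + excess γ r := by omega
  have hk : (k : ℝ) = excess γ r + r + ℓ := by exact_mod_cast (by omega : k = excess γ r + r + ℓ)
  rw [hkℓ, prod_range_add, ← prod_range_sub_eq_factorial]
  congr 1
  · refine prod_congr rfl fun j hj => ?_
    have h : ((excess γ j + j + a j + ℓ : ℕ) : ℝ) = k := by
      exact_mod_cast hex j (mem_range.1 hj).le
    push_cast at h
    linarith
  · refine prod_congr rfl fun j _ => ?_
    rw [ha (r + j) (by omega), hk]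
    push_cast
    ring

theorem HasForm.prod_pos {μ : YoungDiagram} (hμ : IsStrict μ) {k ℓ : ℕ} {a : ℕ → ℕ}
    (h : HasForm μ k ℓ a) : 0 < ∏ j ∈ range (k - ℓ), ((k : ℝ) - ℓ - a j - j) := by
  obtain ⟨γ, r, hγ0, hγ, -, hsum, ha⟩ := h.exists_gaps hμ
  rw [prod_mainTerm_eq hγ hsum ha]
  have : 0 < ∏ j ∈ range r, (excess γ j : ℝ) :=
    Finset.prod_pos fun j _ => by exact_mod_cast one_le_excess hγ0 j
  positivity

theorem HasForm.mainTerm_pos {μ : YoungDiagram} (hμ : IsStrict μ) {k ℓ : ℕ} {a : ℕ → ℕ}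
    (h : HasForm μ k ℓ a) {n : ℕ} (hn : 2 ≤ n) : 0 < mainTerm k ℓ a n := by
  have hP := h.prod_pos hμ
  have hlog : 0 < Real.log n := Real.log_pos (by exact_mod_cast hn)
  have hn0 : (0 : ℝ) < n := by exact_mod_cast (by omega : 0 < n)
  rw [mainTerm]
  positivity

theorem HasForm.exists_abs_ncard_sub_le {μ : YoungDiagram} (hμ : IsStrict μ) {k ℓ : ℕ} {a : ℕ → ℕ}
    (h : HasForm μ k ℓ a) :
    ∃ K : ℝ, ∀ᶠ n : ℕ in atTop,
      |((Av n μ).ncard : ℝ) - mainTerm k ℓ a n| ≤ K * (mainTerm k ℓ a n * (1 / Real.log n)) := by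
  classical
  have hP := h.prod_pos hμ
  have hgap := h.gap
  obtain ⟨γ, r, hγ0, hγ, hcont, hsum, ha⟩ := h.exists_gaps hμ
  have hκ : k - ℓ + 1 = ∑ i ∈ range (r + 1), γ i := by
    have h1 := hsum r le_rfl
    rw [ha r le_rfl] at h1
    omega
  obtain ⟨K, hK⟩ := exists_abs_sum_not_hasChain_sub_le (ℓ := ℓ) hγ0 hγ hκ (by omega)
  have hPe := prod_mainTerm_eq hγ hsum ha
  have hkℓ : k - ℓ + ℓ = k := by omega
  rw [hkℓ] at hK
  set P := ∏ j ∈ range (k - ℓ), ((k : ℝ) - ℓ - a j - j) with hPdef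
  have hmain : ∀ n : ℕ, (n : ℝ) ^ (k - 1) * Real.log n ^ ℓ / ((k - 1).factorial * ℓ.factorial)
      * ((∏ i ∈ range r, (excess γ i : ℝ)⁻¹) * ((excess γ r).factorial : ℝ)⁻¹)
      = mainTerm k ℓ a n := by
    intro n
    rw [prod_inv_distrib, ← mul_inv, ← hPe, mainTerm, ← hPdef]
    field_simp
  -- The factor `2 ^ ℓ` comes from `1 + log n ≤ 2 * log n`, the rest restores the denominator of
  -- `mainTerm`; the absolute value is needed because the sign of `K` is unknown.
  refine ⟨|K| * (2 ^ ℓ * (ℓ.factorial * (k - 1).factorial * P)), ?_⟩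
  filter_upwards [hK, eventually_one_add_log_pow_le 0] with n h1 h2
  have hL : 1 ≤ Real.log n := h2.1
  rw [hmain] at h1
  rw [ncard_Av_eq_sum (P := fun D => HasChain γ ℓ D r 0) hcont, Nat.cast_sum]
  refine h1.trans ?_
  calc K * ((n : ℝ) ^ (k - 1) * (1 + Real.log n) ^ ℓ / (1 + Real.log n))
      ≤ |K| * ((n : ℝ) ^ (k - 1) * (2 * Real.log n) ^ ℓ / Real.log n) := by
        gcongr
        · exact le_abs_self K
        · linarith
        · linarith
    _ = _ := by
        rw [mainTerm, ← hPdef, mul_pow]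
        field_simp

end PartitionPattern

theorem theorem4p9 (μ : YoungDiagram) (hstrict : PartitionPattern.IsStrict μ)
    (hstair : ¬ PartitionPattern.IsStaircase μ) :
    (∃ (k ℓ : ℕ) (a : ℕ → ℕ), PartitionPattern.HasForm μ k ℓ a) ∧
    ∀ (k ℓ : ℕ) (a : ℕ → ℕ), PartitionPattern.HasForm μ k ℓ a →
      ∃ ε : ℕ → ℝ, ε =O[atTop] (fun n : ℕ => 1 / Real.log n) ∧
        ∀ n : ℕ, 2 ≤ n →
          ((PartitionPattern.Av n μ).ncard : ℝ) =
            PartitionPattern.mainTerm k ℓ a n * (1 + ε n) := by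
  refine ⟨PartitionPattern.exists_hasForm hstrict hstair, fun k ℓ a h => ?_⟩
  obtain ⟨K, hK⟩ := h.exists_abs_ncard_sub_le hstrict
  refine ⟨fun n => ((PartitionPattern.Av n μ).ncard - PartitionPattern.mainTerm k ℓ a n) /
    PartitionPattern.mainTerm k ℓ a n, IsBigO.of_bound K ?_, fun n hn => ?_⟩
  · filter_upwards [hK, eventually_ge_atTop 2] with n h1 hn
    have hM := h.mainTerm_pos hstrict hn
    have hL : 0 < Real.log n := Real.log_pos (by exact_mod_cast hn)
    rw [Real.norm_eq_abs, Real.norm_eq_abs, abs_div, abs_of_pos hM,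
      abs_of_pos (one_div_pos.2 hL), div_le_iff₀ hM]
    linarith
  · have hM := (h.mainTerm_pos hstrict hn).ne'
    field_simp
    ring
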